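/- Let $K$ and $T$ be (affine) complex algebraic groups with Lie algebras $\mathfrak k$ and $\mathfrak t$, and let $\gamma:T\to K$ be a morphism of algebraic groups whose differential is injective, so that $\mathfrak t$ is viewed as a subalgebra of $\mathfrak k$. For a Lie algebra $\mathfrak l$ let $N(\mathfrak l)$ be its standard complex $N^{-i}(\mathfrak l)=U(\mathfrak l)\otimes\bigwedge^i\mathfrak l$, with its DG algebra structure, i.e. the universal enveloping algebra of the DG Lie algebra $\mathfrak l\xrightarrow{\,1\,}\mathfrak l$ in degrees $-1,0$. It is generated by $X\in\mathfrak l$ in degree $0$ and $\xi\in\mathfrak l$ in degree $-1$, and its differential sends a generator $\xi$ of degree $-1$ to the same element in degree $0$. Let $\iota$ be its principal antiautomorphism, so that ${}^\iota x=-x$ for $x$ in either copy of $\mathfrak l$ and ${}^\iota(uv)=(-1)^{\deg u\deg v}\,{}^\iota v\,{}^\iota u$. A $(\mathfrak k,T,N(\mathfrak t))$-module is a complex of complex vector spaces with an action $\pi$ of $U(\mathfrak k)$ and an algebraic action $\nu$ of $T$, both by chain maps, and a DG action $\omega$ of $N(\mathfrak t)$, such that $\pi$ and $\omega$ are $T$-equivariant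 and commute and such that $\pi(X)+\omega(X)$ is the differential of $\nu$ at $X$, for every $X\in\mathfrak t$. Isomorphisms are isomorphisms of complexes that respect $\pi$, $\nu$ and $\omega$. Let $U(\mathfrak k)$ act on $N(\mathfrak k)$ by left multiplication, $T$ by the action induced by $\mathrm{Ad}\circ\gamma$, and $N(\mathfrak t)$ by $\omega_N(m)n=(-1)^{\deg m\deg n}\,n\cdot{}^\iota m$. The Hochschild–Serre filtration of $N(\mathfrak k)$ is $$F_pN(\mathfrak k)=\omega_N(N(\mathfrak t))\Bigl(\bigoplus_{0\le i\le p}N^{-i}(\mathfrak k)\Bigr),\qquad F_{-1}N(\mathfrak k)=0 .$$ Let $T$ act on $W_p=\operatorname{ind}_{U(\mathfrak k),\mathbb C}\bigwedge^p(\mathfrak k/\mathfrak t)=U(\mathfrak k)\otimes_{\mathbb C}\bigwedge^p(\mathfrak k/\mathfrak t)$ on both factors and $\mathfrak k$ by left multiplication on the first factor. The right action of $U(\mathfrak t)$ on $W_p$ is determined by $w\cdot X=-\omega(X)w$ for $X\in\mathfrak t$, where $\omega(X)$ is the differential of the $T$-action minus left multiplication by $X$. Let $W_p[p]$ be the complex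 with $W_p$ in degree $-p$, and put $$C_{\mathfrak t}(W_p[p])=W_p[p]\otimes_{U(\mathfrak t)}N(\mathfrak t),$$ where $U(\mathfrak t)$ acts on $N(\mathfrak t)$ by left multiplication. The differential is $(-1)^p\,1\otimes d_{N(\mathfrak t)}$, $\mathfrak k$ acts on the first factor, $T$ acts on both factors, and $N(\mathfrak t)$ acts by $\omega(m)(w\otimes e)=(-1)^{\deg m(\deg e-p)}\,w\otimes e\cdot{}^\iota m$. **Proposition.** For every integer $p\ge 0$, both $\mathrm{Gr}_pN(\mathfrak k)=F_pN(\mathfrak k)/F_{p-1}N(\mathfrak k)$ and $C_{\mathfrak t}(W_p[p])$ are $(\mathfrak k,T,N(\mathfrak t))$-modules, and there is an isomorphism of $(\mathfrak k,T,N(\mathfrak t))$-modules $$\mathrm{Gr}_pN(\mathfrak k)\;\cong\;C_{\mathfrak t}\Bigl(\operatorname{ind}_{U(\mathfrak k),\mathbb C}\textstyle\bigwedge^p(\mathfrak k/\mathfrak t)[p]\Bigr)=\Bigl(U(\mathfrak k)\otimes_{\mathbb C}\textstyle\bigwedge^p(\mathfrak k/\mathfrak t)[p]\Bigr)\otimes_{U(\mathfrak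 t)}N(\mathfrak t)$$ that sends the class of $u\,\xi_1\cdots\xi_p$ ($u\in U(\mathfrak k)$, $\xi_i\in\mathfrak k$ placed in degree $-1$) to $(u\otimes\bar\xi_1\wedge\dots\wedge\bar\xi_p)\otimes 1$. -/

import Mathlib

noncomputable section

open scoped TensorProduct

attribute [local instance 100] LieRing.ofAssociativeRing

namespace HS

section Standard

variable (L : Type*) [LieRing L] [LieAlgebra ℂ L]

/-- The defining relations of the enveloping algebra of the DG Lie algebra `L → L` placed in
degrees `-1` and `0`. Its total space is `L × L`: `(x, 0)` is the element `x` in degree `0`,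
`(0, ξ)` is the element `ξ` in degree `-1`. -/
inductive StdRel : TensorAlgebra ℂ (L × L) → TensorAlgebra ℂ (L × L) → Prop
  | even_even (x y : L) : StdRel
      (TensorAlgebra.ι ℂ (x, 0) * TensorAlgebra.ι ℂ (y, 0))
      (TensorAlgebra.ι ℂ (y, 0) * TensorAlgebra.ι ℂ (x, 0) + TensorAlgebra.ι ℂ (⁅x, y⁆, 0))
  | even_odd (x ξ : L) : StdRel
      (TensorAlgebra.ι ℂ (x, 0) * TensorAlgebra.ι ℂ (0, ξ))
      (TensorAlgebra.ι ℂ (0, ξ) * TensorAlgebra.ι ℂ (x, 0) + TensorAlgebra.ι ℂ (0, ⁅x, ξ⁆))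
  | odd_odd (ξ η : L) : StdRel
      (TensorAlgebra.ι ℂ (0, ξ) * TensorAlgebra.ι ℂ (0, η)
        + TensorAlgebra.ι ℂ (0, η) * TensorAlgebra.ι ℂ (0, ξ)) 0

/-- The standard complex `N(L)` of a Lie algebra, with its algebra structure: the universal
enveloping algebra of the DG Lie algebra `L → L`. As a graded vector space it is `U(L) ⊗ ⋀ L`, with
`u ⊗ λ₁ ∧ ⋯ ∧ λ_p` corresponding to the product of `u` in degree `0` and the `λ_i` in degree `-1`;
grading and differential are `N.gr` and `N.d` below. -/
def N : Type _ := RingQuot (StdRel L)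

instance : Ring (N L) := inferInstanceAs (Ring (RingQuot (StdRel L)))
instance : Algebra ℂ (N L) := inferInstanceAs (Algebra ℂ (RingQuot (StdRel L)))

namespace N

/-- The quotient map from the tensor algebra. -/
def mk : TensorAlgebra ℂ (L × L) →ₐ[ℂ] N L := RingQuot.mkAlgHom ℂ (StdRel L)

variable {L}

/-- The generators of degree `0`. -/
def ev : L →ₗ[ℂ] N L := (mk L).toLinearMap ∘ₗ TensorAlgebra.ι ℂ ∘ₗ LinearMap.inl ℂ L L

/-- The generators of degree `-1`. -/
def od : L →ₗ[ℂ] N L := (mk L).toLinearMap ∘ₗ TensorAlgebra.ι ℂ ∘ₗ LinearMap.inr ℂ L L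

theorem ev_ev (x y : L) : ev x * ev y = ev y * ev x + ev ⁅x, y⁆ := by
  have := RingQuot.mkAlgHom_rel ℂ (StdRel.even_even x y)
  rwa [map_mul, map_add, map_mul] at this

theorem ev_od (x ξ : L) : ev x * od ξ = od ξ * ev x + od ⁅x, ξ⁆ := by
  have := RingQuot.mkAlgHom_rel ℂ (StdRel.even_odd x ξ)
  rwa [map_mul, map_add, map_mul] at this

theorem od_od (ξ η : L) : od ξ * od η + od η * od ξ = 0 := by
  have := RingQuot.mkAlgHom_rel ℂ (StdRel.odd_odd ξ η)
  rwa [map_add, map_mul, map_mul, map_zero] at this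

variable {B : Type*} [Ring B] [Algebra ℂ B]

/-- The universal property of `N(L)`. -/
def lift (f₀ f₁ : L →ₗ[ℂ] B)
    (h00 : ∀ x y, f₀ x * f₀ y = f₀ y * f₀ x + f₀ ⁅x, y⁆)
    (h01 : ∀ x y, f₀ x * f₁ y = f₁ y * f₀ x + f₁ ⁅x, y⁆)
    (h11 : ∀ x y, f₁ x * f₁ y + f₁ y * f₁ x = 0) : N L →ₐ[ℂ] B :=
  RingQuot.liftAlgHom ℂ ⟨TensorAlgebra.lift ℂ (f₀.coprod f₁), by
    intro a b h
    induction h with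
    | even_even x y => simpa using h00 x y
    | even_odd x y => simpa using h01 x y
    | odd_odd x y => simpa using h11 x y⟩

section

variable (f₀ f₁ : L →ₗ[ℂ] B)
    (h00 : ∀ x y, f₀ x * f₀ y = f₀ y * f₀ x + f₀ ⁅x, y⁆)
    (h01 : ∀ x y, f₀ x * f₁ y = f₁ y * f₀ x + f₁ ⁅x, y⁆)
    (h11 : ∀ x y, f₁ x * f₁ y + f₁ y * f₁ x = 0)

@[simp] theorem lift_ev (x : L) : lift f₀ f₁ h00 h01 h11 (ev x) = f₀ x := by
  have := RingQuot.liftAlgHom_mkAlgHom_apply ℂ (TensorAlgebra.lift ℂ (f₀.coprod f₁))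
    (s := StdRel L) (by
      intro a b h
      induction h with
      | even_even x y => simpa using h00 x y
      | even_odd x y => simpa using h01 x y
      | odd_odd x y => simpa using h11 x y) (TensorAlgebra.ι ℂ (x, 0))
  refine this.trans ?_
  simp

@[simp] theorem lift_od (x : L) : lift f₀ f₁ h00 h01 h11 (od x) = f₁ x := by
  have := RingQuot.liftAlgHom_mkAlgHom_apply ℂ (TensorAlgebra.lift ℂ (f₀.coprod f₁))
    (s := StdRel L) (by
      intro a b h
      induction h with
      | even_even x y => simpa using h00 x y
      | even_odd x y => simpa using h01 x y
      | odd_odd x y => simpa using h11 x y) (TensorAlgebra.ι ℂ (0, x))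
  refine this.trans ?_
  simp

end

theorem mk_surjective : Function.Surjective (mk L) := RingQuot.mkAlgHom_surjective ℂ (StdRel L)

/-- Induction on words in the generators. -/
theorem induction {p : N L → Prop} (one : p 1)
    (hev : ∀ x n, p n → p (ev x * n)) (hod : ∀ x n, p n → p (od x * n))
    (add : ∀ m n, p m → p n → p (m + n)) (smul : ∀ (c : ℂ) n, p n → p (c • n)) (n : N L) :
    p n := by
  obtain ⟨a, rfl⟩ := mk_surjective n
  suffices h : ∀ m, p m → p (mk L a * m) by simpa using h 1 one
  induction a using TensorAlgebra.induction with
  | algebraMap r =>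
    intro m hm
    rw [AlgHom.commutes, ← Algebra.smul_def]
    exact smul r m hm
  | ι x =>
    intro m hm
    have : mk L (TensorAlgebra.ι ℂ x) = ev x.1 + od x.2 := by
      change mk L _ = mk L (TensorAlgebra.ι ℂ (x.1, 0)) + mk L (TensorAlgebra.ι ℂ (0, x.2))
      rw [← map_add, ← map_add]
      simp
    rw [this, add_mul]
    exact add _ _ (hev _ _ hm) (hod _ _ hm)
  | mul a b ha hb =>
    intro m hm
    rw [map_mul, mul_assoc]
    exact ha _ (hb _ hm)
  | add a b ha hb =>
    intro m hm
    rw [map_add, add_mul]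
    exact add _ _ (ha _ hm) (hb _ hm)

theorem hom_ext {f g : N L →ₐ[ℂ] B} (h0 : ∀ x, f (ev x) = g (ev x))
    (h1 : ∀ x, f (od x) = g (od x)) : f = g := by
  ext n
  induction n using induction with
  | one => simp
  | hev x n ih => simp [h0, ih]
  | hod x n ih => simp [h1, ih]
  | add m n hm hn => simp [hm, hn]
  | smul c n hn => simp [hn]

/-- The parity automorphism: multiplication by `(-1)^i` in degree `i`. -/
def par : N L →ₐ[ℂ] N L := lift ev (-od) ev_ev
  (fun x y => by simp [ev_od]; abel) (fun x y => by simpa using od_od x y)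

@[simp] theorem par_ev (x : L) : par (ev x) = ev x := by simp [par]
@[simp] theorem par_od (x : L) : par (od x) = -od x := by simp [par]

@[simp] theorem par_par (n : N L) : par (par n) = n := by
  have : (par (L := L)).comp par = AlgHom.id ℂ _ := hom_ext (by simp) (by simp)
  exact DFunLike.congr_fun this n

/-- Auxiliary homomorphism: `n ↦ [[par n, d n], [0, n]]`. -/
def dMat : N L →ₐ[ℂ] Matrix (Fin 2) (Fin 2) (N L) :=
  lift
    { toFun := fun x => !![ev x, 0; 0, ev x]
      map_add' := fun x y => by ext i j; fin_cases i <;> fin_cases j <;> simp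
      map_smul' := fun c x => by ext i j; fin_cases i <;> fin_cases j <;> simp }
    { toFun := fun x => !![-od x, ev x; 0, od x]
      map_add' := fun x y => by ext i j; fin_cases i <;> fin_cases j <;> simp [add_comm]
      map_smul' := fun c x => by ext i j; fin_cases i <;> fin_cases j <;> simp }
    (fun x y => by ext i j; fin_cases i <;> fin_cases j <;> simp [ev_ev x y])
    (fun x y => by
      ext i j
      fin_cases i <;> fin_cases j <;> simp [ev_od x y, ev_ev x y]
      abel)
    (fun x y => by
      ext i j
      fin_cases i <;> fin_cases j <;> simp [od_od x y]
      rw [ev_od, ev_od, ← lie_skew x y, map_neg]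
      abel)

theorem dMat_ev (x : L) : dMat (ev x) = !![ev x, 0; 0, ev x] := lift_ev _ _ _ _ _ x
theorem dMat_od (x : L) : dMat (od x) = !![-od x, ev x; 0, od x] := lift_od _ _ _ _ _ x

theorem dMat_apply (n : N L) : dMat n 1 0 = 0 ∧ dMat n 0 0 = par n ∧ dMat n 1 1 = n := by
  induction n using induction with
  | one => simp
  | hev x n ih =>
    obtain ⟨h1, h2, h3⟩ := ih
    simp [dMat_ev, Matrix.mul_apply, h1, h2, h3]
  | hod x n ih =>
    obtain ⟨h1, h2, h3⟩ := ih
    simp [dMat_od, Matrix.mul_apply, h1, h2, h3]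
  | add m n hm hn => simp [hm, hn]
  | smul c n hn => simp [hn]

/-- The differential of `N(L)`: the derivation of degree `1` that sends a generator of degree `-1`
to the same element of `L` in degree `0`, and kills the generators of degree `0`. -/
def d : N L →ₗ[ℂ] N L where
  toFun n := dMat n 0 1
  map_add' := by simp
  map_smul' := by simp

theorem d_mul (m n : N L) : d (m * n) = d m * n + par m * d n := by
  simp [d, Matrix.mul_apply, dMat_apply, add_comm]

@[simp] theorem d_ev (x : L) : d (ev x) = 0 := by simp [d, dMat_ev]
@[simp] theorem d_od (x : L) : d (od x) = ev x := by simp [d, dMat_od]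
@[simp] theorem d_one : d (1 : N L) = 0 := by simp [d]

theorem d_par (n : N L) : d (par n) = -par (d n) := by
  induction n using induction with
  | one => simp
  | hev x n ih => simp [d_mul, ih]
  | hod x n ih => simp [d_mul, ih]
  | add m n hm hn => simp [hm, hn]; abel
  | smul c n hn => simp [hn]

variable (L) in
/-- A word in the generators: `Sum.inl x` stands for `x` in degree `0`, `Sum.inr ξ` for `ξ` in
degree `-1`. -/
def word (l : List (L ⊕ L)) : N L := (l.map (Sum.elim ev od)).prod

variable (L) in
/-- The component of degree `i`: the span of the words whose degrees add up to `i`. -/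
def gr (i : ℤ) : Submodule ℂ (N L) :=
  Submodule.span ℂ {n | ∃ l : List (L ⊕ L), -(l.countP Sum.isRight : ℤ) = i ∧ n = word L l}

theorem one_mem_gr : (1 : N L) ∈ gr L 0 := Submodule.subset_span ⟨[], by simp, by simp [word]⟩

/-- Induction on the words of a given degree. -/
theorem gr_induction {p : (i : ℤ) → N L → Prop} (one : p 0 1)
    (hev : ∀ i x n, n ∈ gr L i → p i n → p i (ev x * n))
    (hod : ∀ i x n, n ∈ gr L i → p i n → p (i - 1) (od x * n))
    (zero : ∀ i, p i 0)
    (add : ∀ i m n, p i m → p i n → p i (m + n)) (smul : ∀ i (c : ℂ) n, p i n → p i (c • n))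
    {i : ℤ} {n : N L} (hn : n ∈ gr L i) : p i n := by
  induction hn using Submodule.span_induction with
  | mem n hn =>
    obtain ⟨l, rfl, rfl⟩ := hn
    induction l with
    | nil => simpa [word] using one
    | cons a l ih =>
      have hl : word L l ∈ gr L (-(l.countP Sum.isRight : ℤ)) := Submodule.subset_span ⟨l, rfl, rfl⟩
      cases a with
      | inl x => simpa [word] using hev _ x _ hl ih
      | inr x =>
        have := hod _ x _ hl ih
        have e1 : word L (Sum.inr x :: l) = od x * word L l := by simp [word]
        have e2 : (-((Sum.inr x :: l).countP Sum.isRight : ℤ)) = -(l.countP Sum.isRight : ℤ) - 1 := by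
          rw [List.countP_cons]; simp; ring
        rwa [e1, e2]
  | zero => exact zero i
  | add x y _ _ hx hy => exact add i x y hx hy
  | smul c x _ hx => exact smul i c x hx

theorem ev_mul_mem {i : ℤ} (x : L) {n : N L} (hn : n ∈ gr L i) : ev x * n ∈ gr L i := by
  induction hn using Submodule.span_induction with
  | mem n hn =>
    obtain ⟨l, rfl, rfl⟩ := hn
    exact Submodule.subset_span ⟨Sum.inl x :: l, by simp, by simp [word]⟩
  | zero => simp
  | add x y _ _ hx hy => rw [mul_add]; exact add_mem hx hy
  | smul c x _ hx => rw [mul_smul_comm]; exact Submodule.smul_mem _ _ hx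

theorem od_mul_mem {i : ℤ} (x : L) {n : N L} (hn : n ∈ gr L i) : od x * n ∈ gr L (i - 1) := by
  induction hn using Submodule.span_induction with
  | mem n hn =>
    obtain ⟨l, rfl, rfl⟩ := hn
    exact Submodule.subset_span ⟨Sum.inr x :: l, by rw [List.countP_cons]; simp; ring, by simp [word]⟩
  | zero => simp
  | add x y _ _ hx hy => rw [mul_add]; exact add_mem hx hy
  | smul c x _ hx => rw [mul_smul_comm]; exact Submodule.smul_mem _ _ hx

theorem mul_mem_gr {i j : ℤ} {m n : N L} (hm : m ∈ gr L i) (hn : n ∈ gr L j) :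
    m * n ∈ gr L (i + j) := by
  revert hn
  refine gr_induction (p := fun i m => n ∈ gr L j → m * n ∈ gr L (i + j)) ?_ ?_ ?_ ?_ ?_ ?_ hm
  · intro h; simpa using h
  · intro i x m _ ih h; rw [mul_assoc]; exact ev_mul_mem x (ih h)
  · intro i x m _ ih h
    rw [mul_assoc, show i - 1 + j = i + j - 1 by ring]
    exact od_mul_mem x (ih h)
  · intro i _; simp
  · intro i m m' h h' hn; rw [add_mul]; exact add_mem (h hn) (h' hn)
  · intro i c m h hn; rw [smul_mul_assoc]; exact Submodule.smul_mem _ _ (h hn)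

theorem par_of_mem {i : ℤ} {n : N L} (hn : n ∈ gr L i) : par n = ((-1 : ℂ) ^ i) • n := by
  refine gr_induction (p := fun i n => par n = ((-1 : ℂ) ^ i) • n) ?_ ?_ ?_ ?_ ?_ ?_ hn
  · simp
  · intro i x n _ ih; simp [ih]
  · intro i x n _ ih; simp [ih, zpow_sub₀, div_neg]
  · simp
  · intro i m n hm hn; simp [hm, hn]
  · intro i c n hn; rw [map_smul, hn, smul_comm]

theorem d_mem_gr {i : ℤ} {n : N L} (hn : n ∈ gr L i) : d n ∈ gr L (i + 1) := by
  refine gr_induction (p := fun i n => d n ∈ gr L (i + 1)) ?_ ?_ ?_ ?_ ?_ ?_ hn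
  · simp
  · intro i x n _ ih; simpa [d_mul] using ev_mul_mem x ih
  · intro i x n h ih
    rw [d_mul, d_od, par_od, neg_mul, sub_add_cancel]
    refine add_mem (ev_mul_mem x h) (neg_mem ?_)
    simpa using od_mul_mem x ih
  · simp
  · intro i m n hm hn; rw [map_add]; exact add_mem hm hn
  · intro i c n hn; rw [map_smul]; exact Submodule.smul_mem _ _ hn

theorem eq_zero_of_mem_gr {i : ℤ} (hi : 0 < i) {n : N L} (hn : n ∈ gr L i) : n = 0 := by
  have : i ≤ 0 ∨ n = 0 := by
    refine gr_induction (p := fun i n => i ≤ 0 ∨ n = 0) ?_ ?_ ?_ ?_ ?_ ?_ hn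
    · simp
    · rintro i x n - (h | h) <;> simp [h]
    · rintro i x n - (h | h)
      · left; omega
      · simp [h]
    · simp
    · rintro i m n (h | h) (h' | h') <;> simp_all
    · rintro i c n (h | h) <;> simp [h]
  rcases this with h | h
  · omega
  · exact h

variable {L' L'' : Type*} [LieRing L'] [LieAlgebra ℂ L'] [LieRing L''] [LieAlgebra ℂ L'']

/-- Functoriality of `N`. -/
def map (f : L →ₗ⁅ℂ⁆ L') : N L →ₐ[ℂ] N L' :=
  lift (ev ∘ₗ f.toLinearMap) (od ∘ₗ f.toLinearMap)
    (fun x y => by simp [ev_ev (f x)]) (fun x y => by simp [ev_od]) (fun x y => by simp [od_od])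

@[simp] theorem map_ev (f : L →ₗ⁅ℂ⁆ L') (x : L) : map f (ev x) = ev (f x) := by simp [map]
@[simp] theorem map_od (f : L →ₗ⁅ℂ⁆ L') (x : L) : map f (od x) = od (f x) := by simp [map]

theorem map_map (g : L' →ₗ⁅ℂ⁆ L'') (f : L →ₗ⁅ℂ⁆ L') (n : N L) :
    map g (map f n) = map (g.comp f) n := by
  have : (map g).comp (map f) = map (g.comp f) := hom_ext (by simp) (by simp)
  exact DFunLike.congr_fun this n

@[simp] theorem map_id (n : N L) : map (LieHom.id : L →ₗ⁅ℂ⁆ L) n = n := by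
  have : map (LieHom.id : L →ₗ⁅ℂ⁆ L) = AlgHom.id ℂ _ := hom_ext (by simp) (by simp)
  exact DFunLike.congr_fun this n

theorem par_map (f : L →ₗ⁅ℂ⁆ L') (n : N L) : par (map f n) = map f (par n) := by
  have : par.comp (map f) = (map f).comp par := hom_ext (by simp) (by simp)
  exact DFunLike.congr_fun this n

theorem d_map (f : L →ₗ⁅ℂ⁆ L') (n : N L) : d (map f n) = map f (d n) := by
  induction n using induction with
  | one => simp
  | hev x n ih => simp [d_mul, ih]
  | hod x n ih => simp [d_mul, ih]
  | add m n hm hn => simp [hm, hn]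
  | smul c n hn => simp [hn]

theorem map_mem_gr (f : L →ₗ⁅ℂ⁆ L') {i : ℤ} {n : N L} (hn : n ∈ gr L i) :
    map f n ∈ gr L' i := by
  refine gr_induction (p := fun i n => map f n ∈ gr L' i) ?_ ?_ ?_ ?_ ?_ ?_ hn
  · simpa using one_mem_gr
  · intro i x n _ ih; simpa using ev_mul_mem _ ih
  · intro i x n _ ih; simpa using od_mul_mem _ ih
  · simp
  · intro i m n hm hn; rw [map_add]; exact add_mem hm hn
  · intro i c n hn; rw [map_smul]; exact Submodule.smul_mem _ _ hn

end N

end Standard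


section Twist

variable {L : Type*} [LieRing L] [LieAlgebra ℂ L]

/-- The inclusion `U(L) → N(L)` as the degree `0` component. -/
def N.ofU : UniversalEnvelopingAlgebra ℂ L →ₐ[ℂ] N L :=
  UniversalEnvelopingAlgebra.lift ℂ
    { (N.ev : L →ₗ[ℂ] N L) with
      map_lie' := fun {x y} => by
        change N.ev ⁅x, y⁆ = N.ev x * N.ev y - N.ev y * N.ev x
        rw [N.ev_ev x y, add_sub_cancel_left] }

@[simp] theorem N.ofU_ι (x : L) : N.ofU (UniversalEnvelopingAlgebra.ι ℂ x) = N.ev x :=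
  UniversalEnvelopingAlgebra.lift_ι_apply ℂ _ x

/-- Induction on words in the enveloping algebra. -/
theorem U_induction {p : UniversalEnvelopingAlgebra ℂ L → Prop} (one : p 1)
    (hι : ∀ x n, p n → p (UniversalEnvelopingAlgebra.ι ℂ x * n))
    (add : ∀ m n, p m → p n → p (m + n)) (smul : ∀ (c : ℂ) n, p n → p (c • n))
    (n : UniversalEnvelopingAlgebra ℂ L) : p n := by
  obtain ⟨a, rfl⟩ : ∃ a, UniversalEnvelopingAlgebra.mkAlgHom ℂ L a = n :=
    RingCon.mkₐ_surjective _ n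
  suffices h : ∀ m, p m → p (UniversalEnvelopingAlgebra.mkAlgHom ℂ L a * m) by
    simpa using h 1 one
  induction a using TensorAlgebra.induction with
  | algebraMap r =>
    intro m hm
    rw [AlgHom.commutes, ← Algebra.smul_def]
    exact smul r m hm
  | ι x => intro m hm; exact hι x m hm
  | mul a b ha hb =>
    intro m hm
    rw [map_mul, mul_assoc]
    exact ha _ (hb _ hm)
  | add a b ha hb =>
    intro m hm
    rw [map_add, add_mul]
    exact add _ _ (ha _ hm) (hb _ hm)

theorem N.ofU_mem_gr (u : UniversalEnvelopingAlgebra ℂ L) : N.ofU u ∈ N.gr L 0 := by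
  induction u using U_induction with
  | one => simpa using N.one_mem_gr
  | hι x n ih => rw [map_mul, N.ofU_ι]; exact N.ev_mul_mem x ih
  | add m n hm hn => rw [map_add]; exact add_mem hm hn
  | smul c n hn => rw [map_smul]; exact Submodule.smul_mem _ _ hn

@[simp] theorem N.par_ofU (u : UniversalEnvelopingAlgebra ℂ L) :
    N.par (N.ofU u) = N.ofU u := by
  simpa using N.par_of_mem (N.ofU_mem_gr u)

@[simp] theorem N.d_ofU (u : UniversalEnvelopingAlgebra ℂ L) : N.d (N.ofU u) = 0 :=
  N.eq_zero_of_mem_gr (by norm_num) (N.d_mem_gr (N.ofU_mem_gr u))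

variable {V : Type*} [AddCommGroup V] [Module ℂ V]

/-- Passage from a right action `r` of `N(L)` on a graded space `V` (with `σ = (-1)^i` in degree
`i`) to a left action, `ω(m) v = (-1)^(deg m deg v) v · ᶥm`, where `ᶥ` is the principal
antiautomorphism. It is defined here by its values on generators; the formula is `twist_apply`. -/
def twist (r : N L →ₗ[ℂ] Module.End ℂ V) (hr : ∀ a b, r (a * b) = r b * r a)
    (σ : Module.End ℂ V) (hσ : σ * σ = 1) (hrσ : ∀ a, σ * r a = r (N.par a) * σ) :
    N L →ₐ[ℂ] Module.End ℂ V :=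
  N.lift (-(r ∘ₗ N.ev)) (-(LinearMap.mulRight ℂ σ ∘ₗ r ∘ₗ N.od))
    (fun x y => by
      have := congrArg r (N.ev_ev x y)
      rw [map_add, hr, hr] at this
      simp [this])
    (fun x y => by
      have := congrArg r (N.ev_od x y)
      rw [map_add, hr, hr] at this
      have h2 := hrσ (N.ev x)
      rw [N.par_ev] at h2
      simp [mul_assoc, h2]
      simp [← mul_assoc, this, add_mul])
    (fun x y => by
      have := congrArg r (N.od_od x y)
      rw [map_add, hr, hr, map_zero] at this
      have h1 := hrσ (N.od x)
      have h2 := hrσ (N.od y)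
      rw [N.par_od, map_neg] at h1 h2
      have e : ∀ x y : L, r (N.od x) * σ * (r (N.od y) * σ) = -(r (N.od x) * r (N.od y)) := by
        intro x y
        have h2 := hrσ (N.od y)
        rw [N.par_od, map_neg] at h2
        rw [mul_assoc, ← mul_assoc σ, h2, mul_assoc, hσ]
        simp
      simp [e]
      rw [← neg_add, add_comm, this, neg_zero])

section

variable (r : N L →ₗ[ℂ] Module.End ℂ V) (hr : ∀ a b, r (a * b) = r b * r a)
    (σ : Module.End ℂ V) (hσ : σ * σ = 1) (hrσ : ∀ a, σ * r a = r (N.par a) * σ)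

@[simp] theorem twist_ev (x : L) : twist r hr σ hσ hrσ (N.ev x) = -r (N.ev x) := by
  simp [twist]

@[simp] theorem twist_od (x : L) : twist r hr σ hσ hrσ (N.od x) = -(r (N.od x) * σ) := by
  simp [twist]

end

/-- Right multiplication in `N(L)`. -/
def N.rmul : N L →ₗ[ℂ] Module.End ℂ (N L) := (LinearMap.mul ℂ (N L)).flip

@[simp] theorem N.rmul_apply (a n : N L) : N.rmul a n = n * a := rfl

/-- The parity automorphism as a linear map. -/
def N.sgn : Module.End ℂ (N L) := N.par.toLinearMap

@[simp] theorem N.sgn_apply (n : N L) : N.sgn n = N.par n := rfl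

/-- The principal antiautomorphism `n ↦ ᶥn` of `N(L)`: it is `-1` on generators and satisfies
`ᶥ(mn) = (-1)^(deg m deg n) ᶥn ᶥm`, see `N.iota_ev`, `N.iota_od`, `N.iota_mul`. -/
def N.iota : N L →ₗ[ℂ] N L :=
  LinearMap.applyₗ (1 : N L) ∘ₗ
    (twist N.rmul (fun a b => by ext n; simp [mul_assoc]) N.sgn (by ext n; simp)
      (fun a => by ext n; simp)).toLinearMap

@[simp] theorem N.iota_one : N.iota (1 : N L) = 1 := by simp [N.iota]
@[simp] theorem N.iota_ev (x : L) : N.iota (N.ev x) = -N.ev x := by simp [N.iota]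
@[simp] theorem N.iota_od (x : L) : N.iota (N.od x) = -N.od x := by simp [N.iota]
theorem N.iota_ev_mul (x : L) (n : N L) : N.iota (N.ev x * n) = -(N.iota n * N.ev x) := by
  simp [N.iota]
theorem N.iota_od_mul (x : L) (n : N L) :
    N.iota (N.od x * n) = -(N.par (N.iota n) * N.od x) := by
  simp [N.iota]

theorem N.iota_mem_gr {i : ℤ} {n : N L} (hn : n ∈ N.gr L i) : N.iota n ∈ N.gr L i := by
  refine N.gr_induction (p := fun i n => N.iota n ∈ N.gr L i) ?_ ?_ ?_ ?_ ?_ ?_ hn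
  · simpa using N.one_mem_gr
  · intro i x n _ ih
    rw [N.iota_ev_mul]
    refine neg_mem ?_
    simpa using N.mul_mem_gr ih (N.ev_mul_mem x N.one_mem_gr)
  · intro i x n _ ih
    rw [N.iota_od_mul, N.par_of_mem ih, smul_mul_assoc]
    refine neg_mem (Submodule.smul_mem _ _ ?_)
    simpa [sub_eq_add_neg] using N.mul_mem_gr ih (N.od_mul_mem x N.one_mem_gr)
  · simp
  · intro i m n hm hn; rw [map_add]; exact add_mem hm hn
  · intro i c n hn; rw [map_smul]; exact Submodule.smul_mem _ _ hn

theorem twist_apply (r : N L →ₗ[ℂ] Module.End ℂ V) (hr : ∀ a b, r (a * b) = r b * r a)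
    (hr1 : r 1 = 1)
    (σ : Module.End ℂ V) (hσ : σ * σ = 1) (hrσ : ∀ a, σ * r a = r (N.par a) * σ)
    {i j : ℤ} {m : N L} {v : V} (hm : m ∈ N.gr L i) (hv : σ v = ((-1 : ℂ) ^ j) • v) :
    twist r hr σ hσ hrσ m v = ((-1 : ℂ) ^ (i * j)) • r (N.iota m) v := by
  have h := N.gr_induction (p := fun i m => m ∈ N.gr L i ∧
    twist r hr σ hσ hrσ m v = ((-1 : ℂ) ^ (i * j)) • r (N.iota m) v) ?_ ?_ ?_ ?_ ?_ ?_ hm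
  · exact h.2
  · exact ⟨N.one_mem_gr, by simp [hr1]⟩
  · rintro i x n - ⟨hn, ih⟩
    refine ⟨N.ev_mul_mem x hn, ?_⟩
    simp [ih, N.iota_ev_mul, hr]
  · rintro i x n - ⟨hn, ih⟩
    refine ⟨N.od_mul_mem x hn, ?_⟩
    have h1 := LinearMap.congr_fun (hrσ (N.iota n)) v
    simp only [Module.End.mul_apply, hv, N.par_of_mem (N.iota_mem_gr hn), map_smul,
      LinearMap.smul_apply] at h1
    rw [N.iota_od_mul, N.par_of_mem (N.iota_mem_gr hn)]
    simp only [map_mul, twist_od, Module.End.mul_apply, ih, LinearMap.neg_apply, map_smul, h1, hr,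
      smul_mul_assoc, map_neg, LinearMap.smul_apply]
    simp only [smul_neg, smul_smul]
    congr 2
    rw [sub_mul, one_mul, zpow_sub₀ (by norm_num)]
    have : ((-1 : ℂ) ^ j) * (-1 : ℂ) ^ j = 1 := by
      rw [← zpow_add₀ (by norm_num), ← two_mul, zpow_mul]; norm_num
    have hne : ((-1 : ℂ) ^ j) ≠ 0 := zpow_ne_zero _ (by norm_num)
    field_simp
    linear_combination this
  · intro i; exact ⟨zero_mem _, by simp⟩
  · rintro i m n ⟨hm, hm'⟩ ⟨hn, hn'⟩; exact ⟨add_mem hm hn, by simp [hm', hn']⟩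
  · rintro i c n ⟨hn, hn'⟩
    exact ⟨Submodule.smul_mem _ _ hn, by simp [hn', smul_comm c]⟩

theorem N.iota_mul {i j : ℤ} {m n : N L} (hm : m ∈ N.gr L i) (hn : n ∈ N.gr L j) :
    N.iota (m * n) = ((-1 : ℂ) ^ (i * j)) • (N.iota n * N.iota m) := by
  have := twist_apply N.rmul (fun a b => by ext n; simp [mul_assoc]) (by ext n; simp) N.sgn
    (by ext n; simp) (fun a => by ext n; simp) (v := N.iota n) hm
    (N.par_of_mem (N.iota_mem_gr hn))
  simpa [N.iota] using this

end Twist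

section Modules

universe w

/-- The data of a complex `V` (total space, grading, differential) with actions `π` of `U(K)`, `ν`
of a group `G` and `ω` of the DG algebra `N(T)`. The axioms of a `(K, G, N(T))`-module are
`IsHCModule` below. -/
structure PreModule (G K T : Type*) [Group G] [LieRing K] [LieAlgebra ℂ K]
    [LieRing T] [LieAlgebra ℂ T] where
  V : Type w
  [acg : AddCommGroup V]
  [mod : Module ℂ V]
  gr : ℤ → Submodule ℂ V
  d : V →ₗ[ℂ] V
  π : UniversalEnvelopingAlgebra ℂ K →ₐ[ℂ] Module.End ℂ V
  ν : Representation ℂ G V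
  ω : N T →ₐ[ℂ] Module.End ℂ V

attribute [instance] PreModule.acg PreModule.mod

variable {G K T : Type*} [Group G] [LieRing K] [LieAlgebra ℂ K] [LieRing T] [LieAlgebra ℂ T]

/-- An isomorphism: a linear isomorphism that respects gradings, differentials and all actions. -/
structure PreModule.Iso (M M' : PreModule G K T) where
  e : M.V ≃ₗ[ℂ] M'.V
  gr : ∀ i v, v ∈ M.gr i ↔ e v ∈ M'.gr i
  d : ∀ v, e (M.d v) = M'.d (e v)
  π : ∀ u v, e (M.π u v) = M'.π u (e v)
  ν : ∀ g v, e (M.ν g v) = M'.ν g (e v)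
  ω : ∀ n v, e (M.ω n v) = M'.ω n (e v)

/-- A subspace stable under the differential and all actions. -/
structure PreModule.Stable (M : PreModule G K T) (F : Submodule ℂ M.V) : Prop where
  d : ∀ v ∈ F, M.d v ∈ F
  π : ∀ u, ∀ v ∈ F, M.π u v ∈ F
  ν : ∀ g, ∀ v ∈ F, M.ν g v ∈ F
  ω : ∀ n, ∀ v ∈ F, M.ω n v ∈ F

section

variable {V : Type*} [AddCommGroup V] [Module ℂ V]

/-- The endomorphisms that preserve two subspaces. -/
def stab (F F' : Submodule ℂ V) : Subalgebra ℂ (Module.End ℂ V) where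
  carrier := {φ | (∀ v ∈ F, φ v ∈ F) ∧ ∀ v ∈ F', φ v ∈ F'}
  mul_mem' h h' := ⟨fun v hv => h.1 _ (h'.1 v hv), fun v hv => h.2 _ (h'.2 v hv)⟩
  add_mem' h h' := ⟨fun v hv => add_mem (h.1 v hv) (h'.1 v hv),
    fun v hv => add_mem (h.2 v hv) (h'.2 v hv)⟩
  algebraMap_mem' c := ⟨fun _ hv => Submodule.smul_mem _ c hv,
    fun _ hv => Submodule.smul_mem _ c hv⟩

/-- The endomorphism of `F / (F ∩ F')` induced by an endomorphism that preserves `F` and `F'`. -/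
def stabHom (F F' : Submodule ℂ V) :
    stab F F' →ₐ[ℂ] Module.End ℂ (F ⧸ F'.comap F.subtype) where
  toFun φ := Submodule.mapQ _ _ (φ.1.restrict φ.2.1) (fun v hv => φ.2.2 _ hv)
  map_one' := by ext; rfl
  map_mul' _ _ := by ext; rfl
  map_zero' := by ext; rfl
  map_add' _ _ := by ext; rfl
  commutes' _ := by ext; rfl

end

/-- The subquotient `F / (F ∩ F')`, with the induced structure. -/
def PreModule.subquot (M : PreModule G K T) (F F' : Submodule ℂ M.V) (hF : M.Stable F)
    (hF' : M.Stable F') : PreModule G K T where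
  V := F ⧸ F'.comap F.subtype
  gr i := ((M.gr i).comap F.subtype).map (F'.comap F.subtype).mkQ
  d := stabHom F F' ⟨M.d, hF.d, hF'.d⟩
  π := (stabHom F F').comp (M.π.codRestrict _ fun u => ⟨hF.π u, hF'.π u⟩)
  ν := (stabHom F F' : _ →* _).comp
    ((M.ν : G →* Module.End ℂ M.V).codRestrict (stab F F') fun g => ⟨hF.ν g, hF'.ν g⟩)
  ω := (stabHom F F').comp (M.ω.codRestrict _ fun n => ⟨hF.ω n, hF'.ω n⟩)

/-- Lie algebras `T → K` with compatible actions of a group `G` by automorphisms; in the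
application `G` is an algebraic group, `T` its Lie algebra, and the actions are the adjoint ones. -/
structure LiePair (G K T : Type*) [Group G] [LieRing K] [LieAlgebra ℂ K]
    [LieRing T] [LieAlgebra ℂ T] where
  j : T →ₗ⁅ℂ⁆ K
  adK : G → K →ₗ⁅ℂ⁆ K
  adT : G → T →ₗ⁅ℂ⁆ T
  adK_one : adK 1 = LieHom.id
  adK_mul : ∀ g h, adK (g * h) = (adK g).comp (adK h)
  adT_one : adT 1 = LieHom.id
  adT_mul : ∀ g h, adT (g * h) = (adT g).comp (adT h)
  j_ad : ∀ g x, j (adT g x) = adK g (j x)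

namespace LiePair

variable (P : LiePair G K T)

/-- The action of `G` on `N(K)`. -/
def νK : Representation ℂ G (N K) where
  toFun g := (N.map (P.adK g)).toLinearMap
  map_one' := by ext n; simp [P.adK_one]
  map_mul' g h := by ext n; simp [P.adK_mul, N.map_map]

/-- The action of `G` on `N(T)`. -/
def νT : Representation ℂ G (N T) where
  toFun g := (N.map (P.adT g)).toLinearMap
  map_one' := by ext n; simp [P.adT_one]
  map_mul' g h := by ext n; simp [P.adT_mul, N.map_map]

@[simp] theorem νK_apply (g : G) (n : N K) : P.νK g n = N.map (P.adK g) n := rfl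
@[simp] theorem νT_apply (g : G) (n : N T) : P.νT g n = N.map (P.adT g) n := rfl

theorem map_j_ad (g : G) (m : N T) :
    N.map (P.adK g) (N.map P.j m) = N.map P.j (N.map (P.adT g) m) := by
  rw [N.map_map, N.map_map]
  congr 2
  ext x
  simp [P.j_ad]

/-- The action `ω(m) n = (-1)^(deg m deg n) n · ᶥm` of `N(T)` on `N(K)`. -/
def ωN : N T →ₐ[ℂ] Module.End ℂ (N K) :=
  twist (N.rmul ∘ₗ (N.map P.j).toLinearMap) (fun a b => by ext n; simp [mul_assoc]) N.sgn
    (by ext n; simp) (fun a => by ext n; simp [N.par_map])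

@[simp] theorem ωN_ev (x : T) (n : N K) : P.ωN (N.ev x) n = -(n * N.ev (P.j x)) := by
  simp [ωN]

@[simp] theorem ωN_od (x : T) (n : N K) : P.ωN (N.od x) n = -(N.par n * N.od (P.j x)) := by
  simp [ωN]

theorem ωN_apply {i l : ℤ} {m : N T} {n : N K} (hm : m ∈ N.gr T i) (hn : n ∈ N.gr K l) :
    P.ωN m n = ((-1 : ℂ) ^ (i * l)) • (n * N.map P.j (N.iota m)) :=
  twist_apply _ _ (by ext n; simp) _ _ _ hm (N.par_of_mem hn)

/-- `N(K)` with `U(K)` acting by left multiplication, `G` by the action induced from `K`, and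
`N(T)` by right multiplication, twisted to a left action. -/
def std : PreModule G K T where
  V := N K
  gr := N.gr K
  d := N.d
  π := (Algebra.lmul ℂ (N K)).comp N.ofU
  ν := P.νK
  ω := P.ωN

/-- The Hochschild–Serre filtration `F_p N(K) = ω(N(T)) (⊕_{0 ≤ i ≤ p} N^{-i}(K))`; it is zero
for `p < 0`. -/
def F (p : ℤ) : Submodule ℂ (N K) :=
  Submodule.span ℂ {v | ∃ (m : N T) (i : ℕ) (n : N K),
    (i : ℤ) ≤ p ∧ n ∈ N.gr K (-(i : ℤ)) ∧ v = P.ωN m n}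

variable {P} in
theorem F_induction {p : ℤ} {q : N K → Prop}
    (base : ∀ (i : ℕ) (n : N K), (i : ℤ) ≤ p → n ∈ N.gr K (-(i : ℤ)) → q n)
    (hev : ∀ x v, v ∈ P.F p → q v → q (P.ωN (N.ev x) v))
    (hod : ∀ x v, v ∈ P.F p → q v → q (P.ωN (N.od x) v))
    (zero : q 0) (add : ∀ v w, q v → q w → q (v + w)) (smul : ∀ (c : ℂ) v, q v → q (c • v))
    {v : N K} (hv : v ∈ P.F p) : q v := by
  induction hv using Submodule.span_induction with
  | mem v hv =>
    obtain ⟨m, i, n, hi, hn, rfl⟩ := hv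
    have key : P.ωN m n ∈ P.F p ∧ q (P.ωN m n) := by
      refine ⟨Submodule.subset_span ⟨m, i, n, hi, hn, rfl⟩, ?_⟩
      induction m using N.induction with
      | one => simpa using base i n hi hn
      | hev x m ih =>
        rw [map_mul]
        exact hev x _ (Submodule.subset_span ⟨m, i, n, hi, hn, rfl⟩) ih
      | hod x m ih =>
        rw [map_mul]
        exact hod x _ (Submodule.subset_span ⟨m, i, n, hi, hn, rfl⟩) ih
      | add m m' h h' => rw [map_add]; exact add _ _ h h'
      | smul c m h => rw [map_smul]; exact smul _ _ h
    exact key.2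
  | zero => exact zero
  | add v w _ _ h h' => exact add v w h h'
  | smul c v _ h => exact smul c v h

theorem ωN_mem_F {p : ℤ} (m : N T) {v : N K} (hv : v ∈ P.F p) : P.ωN m v ∈ P.F p := by
  induction hv using Submodule.span_induction with
  | mem v hv =>
    obtain ⟨m', i, n, hi, hn, rfl⟩ := hv
    exact Submodule.subset_span ⟨m * m', i, n, hi, hn, by simp⟩
  | zero => simp
  | add v w _ _ h h' => rw [map_add]; exact add_mem h h'
  | smul c v _ h => rw [map_smul]; exact Submodule.smul_mem _ _ h

theorem mem_F {p : ℤ} {i : ℕ} {n : N K} (hi : (i : ℤ) ≤ p) (hn : n ∈ N.gr K (-(i : ℤ))) :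
    n ∈ P.F p := Submodule.subset_span ⟨1, i, n, hi, hn, by simp⟩

theorem stable_F (p : ℤ) : P.std.Stable (P.F p) where
  d v hv := by
    change N.d v ∈ P.F p
    refine F_induction (q := fun v => N.d v ∈ P.F p) ?_ ?_ ?_ ?_ ?_ ?_ hv
    · intro i n hi hn
      have h := N.d_mem_gr hn
      rcases i with _ | i
      · rw [N.eq_zero_of_mem_gr (by norm_num) h]; exact zero_mem _
      · refine P.mem_F (i := i) (by push_cast at hi; linarith) ?_
        convert h using 1
        push_cast; ring_nf
    · intro x v _ h
      have : N.d (P.ωN (N.ev x) v) = P.ωN (N.ev x) (N.d v) := by simp [N.d_mul]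
      rw [this]; exact P.ωN_mem_F _ h
    · intro x v hv h
      have : N.d (P.ωN (N.od x) v) = P.ωN (N.ev x) v - P.ωN (N.od x) (N.d v) := by
        simp [N.d_mul, N.d_par]
      rw [this]; exact sub_mem (P.ωN_mem_F _ hv) (P.ωN_mem_F _ h)
    · simp
    · intro v w h h'; rw [map_add]; exact add_mem h h'
    · intro c v h; rw [map_smul]; exact Submodule.smul_mem _ _ h
  π := fun u (v : N K) hv => by
    change N.ofU u * v ∈ P.F p
    refine F_induction (q := fun v => N.ofU u * v ∈ P.F p) ?_ ?_ ?_ ?_ ?_ ?_ hv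
    · intro i n hi hn
      exact P.mem_F hi (by simpa using N.mul_mem_gr (N.ofU_mem_gr u) hn)
    · intro x v _ h
      simpa [mul_assoc] using P.ωN_mem_F (N.ev x) h
    · intro x v _ h
      simpa [mul_assoc] using P.ωN_mem_F (N.od x) h
    · simp
    · intro v w h h'; rw [mul_add]; exact add_mem h h'
    · intro c v h; rw [mul_smul_comm]; exact Submodule.smul_mem _ _ h
  ν g v hv := by
    change N.map (P.adK g) v ∈ P.F p
    refine F_induction (q := fun v => N.map (P.adK g) v ∈ P.F p) ?_ ?_ ?_ ?_ ?_ ?_ hv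
    · intro i n hi hn
      exact P.mem_F hi (N.map_mem_gr _ hn)
    · intro x v _ h
      simpa [P.j_ad] using P.ωN_mem_F (N.ev (P.adT g x)) h
    · intro x v _ h
      simpa [P.j_ad, N.par_map] using P.ωN_mem_F (N.od (P.adT g x)) h
    · simp
    · intro v w h h'; rw [map_add]; exact add_mem h h'
    · intro c v h; rw [map_smul]; exact Submodule.smul_mem _ _ h
  ω m v hv := P.ωN_mem_F m hv

/-- The graded piece `Gr_p N(K) = F_p N(K) / F_{p-1} N(K)`. -/
def Gr (p : ℤ) : PreModule G K T :=
  P.std.subquot (P.F p) (P.F (p - 1)) (P.stable_F p) (P.stable_F (p - 1))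

end LiePair

end Modules

section Exterior

variable {M M' : Type*} [AddCommGroup M] [Module ℂ M] [AddCommGroup M'] [Module ℂ M']

/-- Auxiliary homomorphism: `a ↦ [[a, D a], [0, a]]`. -/
def derMat (D : Module.End ℂ M) :
    ExteriorAlgebra ℂ M →ₐ[ℂ] Matrix (Fin 2) (Fin 2) (ExteriorAlgebra ℂ M) :=
  ExteriorAlgebra.lift ℂ
    ⟨{ toFun := fun m => !![ExteriorAlgebra.ι ℂ m, ExteriorAlgebra.ι ℂ (D m);
          0, ExteriorAlgebra.ι ℂ m]
       map_add' := fun x y => by ext i j; fin_cases i <;> fin_cases j <;> simp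
       map_smul' := fun c x => by ext i j; fin_cases i <;> fin_cases j <;> simp }, fun m => by
      ext i j
      fin_cases i <;> fin_cases j <;> simp⟩

theorem derMat_ι (D : Module.End ℂ M) (m : M) : derMat D (ExteriorAlgebra.ι ℂ m) =
    !![ExteriorAlgebra.ι ℂ m, ExteriorAlgebra.ι ℂ (D m); 0, ExteriorAlgebra.ι ℂ m] :=
  ExteriorAlgebra.lift_ι_apply ℂ _ _ m

theorem derMat_apply (D : Module.End ℂ M) (a : ExteriorAlgebra ℂ M) :
    derMat D a 1 0 = 0 ∧ derMat D a 0 0 = a ∧ derMat D a 1 1 = a := by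
  induction a using ExteriorAlgebra.induction with
  | algebraMap r => simp [Matrix.algebraMap_matrix_apply]
  | ι x => simp [derMat_ι]
  | mul a b ha hb =>
    obtain ⟨h1, h2, h3⟩ := ha
    obtain ⟨h1', h2', h3'⟩ := hb
    simp [Matrix.mul_apply, h1, h2, h3, h1', h2', h3']
  | add a b ha hb => simp [ha, hb]

/-- The derivation of the exterior algebra that extends an endomorphism of `M`. -/
def der (D : Module.End ℂ M) : Module.End ℂ (ExteriorAlgebra ℂ M) where
  toFun a := derMat D a 0 1
  map_add' := by simp
  map_smul' := by simp

@[simp] theorem der_ι (D : Module.End ℂ M) (m : M) :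
    der D (ExteriorAlgebra.ι ℂ m) = ExteriorAlgebra.ι ℂ (D m) := by simp [der, derMat_ι]

@[simp] theorem der_algebraMap (D : Module.End ℂ M) (c : ℂ) :
    der D (algebraMap ℂ _ c) = 0 := by simp [der, Matrix.algebraMap_matrix_apply]

theorem der_mul (D : Module.End ℂ M) (a b : ExteriorAlgebra ℂ M) :
    der D (a * b) = der D a * b + a * der D b := by
  simp [der, Matrix.mul_apply, derMat_apply, add_comm]

theorem der_mem (D : Module.End ℂ M) (p : ℕ) : ∀ a ∈ ⋀[ℂ]^p M, der D a ∈ ⋀[ℂ]^p M := by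
  induction p with
  | zero =>
    intro a ha
    rw [ExteriorAlgebra.exteriorPower, pow_zero, Submodule.mem_one] at ha
    obtain ⟨c, rfl⟩ := ha
    simp
  | succ p ih =>
    intro a ha
    rw [ExteriorAlgebra.exteriorPower, pow_succ'] at ha
    induction ha using Submodule.mul_induction_on' with
    | mem_mul_mem x hx y hy =>
      obtain ⟨m, rfl⟩ := hx
      rw [der_mul, der_ι, ExteriorAlgebra.exteriorPower, pow_succ']
      exact add_mem (Submodule.mul_mem_mul ⟨_, rfl⟩ hy) (Submodule.mul_mem_mul ⟨_, rfl⟩ (ih _ hy))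
    | add x _ y _ hx hy => rw [map_add]; exact add_mem hx hy

theorem der_linear (D D' : Module.End ℂ M) (c : ℂ) (a : ExteriorAlgebra ℂ M) :
    der (D + D') a = der D a + der D' a ∧ der (c • D) a = c • der D a ∧
      der ⁅D, D'⁆ a = der D (der D' a) - der D' (der D a) := by
  induction a using ExteriorAlgebra.induction with
  | algebraMap r => simp
  | ι x => simp [LieRing.of_associative_ring_bracket]
  | mul a b ha hb =>
    obtain ⟨h1, h2, h3⟩ := ha
    obtain ⟨h1', h2', h3'⟩ := hb
    simp only [der_mul, h1, h2, h3, h1', h2', h3', map_add]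
    refine ⟨by noncomm_ring, by simp, by noncomm_ring⟩
  | add a b ha hb =>
    obtain ⟨h1, h2, h3⟩ := ha
    obtain ⟨h1', h2', h3'⟩ := hb
    simp only [map_add, h1, h2, h3, h1', h2', h3']
    refine ⟨by abel, by simp, by abel⟩

/-- The action of an endomorphism of `M` on `⋀^p M` as a derivation,
`m₁ ∧ ⋯ ∧ m_p ↦ ∑ i, m₁ ∧ ⋯ ∧ D m_i ∧ ⋯ ∧ m_p`. -/
def extDer (p : ℕ) : Module.End ℂ M →ₗ⁅ℂ⁆ Module.End ℂ (⋀[ℂ]^p M) where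
  toFun D := (der D).restrict (der_mem D p)
  map_add' D D' := LinearMap.ext fun a => Subtype.ext (der_linear D D' 0 a.1).1
  map_smul' c D := LinearMap.ext fun a => Subtype.ext (der_linear D D c a.1).2.1
  map_lie' {D D'} := LinearMap.ext fun a => Subtype.ext (der_linear D D' 0 a.1).2.2

theorem coe_exteriorPower_map (p : ℕ) (f : M →ₗ[ℂ] M') (a : ⋀[ℂ]^p M) :
    (exteriorPower.map p f a : ExteriorAlgebra ℂ M') = ExteriorAlgebra.map f a := by
  have : (⋀[ℂ]^p M').subtype ∘ₗ exteriorPower.map p f =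
      (ExteriorAlgebra.map f).toLinearMap ∘ₗ (⋀[ℂ]^p M).subtype := by
    ext m
    simp [ExteriorAlgebra.map_apply_ιMulti]
  exact LinearMap.congr_fun this a

theorem map_der (f : M →ₗ[ℂ] M') (D : Module.End ℂ M) (D' : Module.End ℂ M')
    (h : ∀ m, f (D m) = D' (f m)) (a : ExteriorAlgebra ℂ M) :
    ExteriorAlgebra.map f (der D a) = der D' (ExteriorAlgebra.map f a) := by
  induction a using ExteriorAlgebra.induction with
  | algebraMap r => simp
  | ι x => simp [h]
  | mul a b ha hb => simp [der_mul, ha, hb]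
  | add a b ha hb => simp [ha, hb]

theorem map_extDer (p : ℕ) (f : M →ₗ[ℂ] M') (D : Module.End ℂ M) (D' : Module.End ℂ M')
    (h : ∀ m, f (D m) = D' (f m)) (a : ⋀[ℂ]^p M) :
    exteriorPower.map p f (extDer p D a) = extDer p D' (exteriorPower.map p f a) := by
  apply Subtype.ext
  rw [coe_exteriorPower_map]
  change ExteriorAlgebra.map f (der D a) = der D' (exteriorPower.map p f a : ExteriorAlgebra ℂ M')
  rw [coe_exteriorPower_map]
  exact map_der f D D' h a

end Exterior

section Induced

universe w

/-- Functoriality of the enveloping algebra. -/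
def Umap {L L' : Type*} [LieRing L] [LieAlgebra ℂ L] [LieRing L'] [LieAlgebra ℂ L']
    (f : L →ₗ⁅ℂ⁆ L') : UniversalEnvelopingAlgebra ℂ L →ₐ[ℂ] UniversalEnvelopingAlgebra ℂ L' :=
  UniversalEnvelopingAlgebra.lift ℂ ((UniversalEnvelopingAlgebra.ι ℂ).comp f)

@[simp] theorem Umap_ι {L L' : Type*} [LieRing L] [LieAlgebra ℂ L] [LieRing L'] [LieAlgebra ℂ L']
    (f : L →ₗ⁅ℂ⁆ L') (x : L) : Umap f (UniversalEnvelopingAlgebra.ι ℂ x) =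
      UniversalEnvelopingAlgebra.ι ℂ (f x) :=
  UniversalEnvelopingAlgebra.lift_ι_apply ℂ _ x

/-- The principal antiautomorphism of the enveloping algebra, `x ↦ -x` for `x ∈ L`. -/
def Uiota (L : Type*) [LieRing L] [LieAlgebra ℂ L] :
    UniversalEnvelopingAlgebra ℂ L →ₐ[ℂ] (UniversalEnvelopingAlgebra ℂ L)ᵐᵒᵖ :=
  UniversalEnvelopingAlgebra.lift ℂ
    { toFun := fun x => -MulOpposite.op (UniversalEnvelopingAlgebra.ι ℂ x)
      map_add' := fun x y => by rw [map_add, MulOpposite.op_add, neg_add]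
      map_smul' := fun c x => by rw [map_smul, MulOpposite.op_smul, smul_neg]; rfl
      map_lie' := fun {x y} => by
        rw [LieHom.map_lie, LieRing.of_associative_ring_bracket,
          LieRing.of_associative_ring_bracket, neg_mul_neg, neg_mul_neg, ← MulOpposite.op_mul,
          ← MulOpposite.op_mul, ← MulOpposite.op_sub, ← MulOpposite.op_neg, neg_sub] }

theorem Uiota_ι {L : Type*} [LieRing L] [LieAlgebra ℂ L] (x : L) :
    Uiota L (UniversalEnvelopingAlgebra.ι ℂ x) =
      -MulOpposite.op (UniversalEnvelopingAlgebra.ι ℂ x) :=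
  UniversalEnvelopingAlgebra.lift_ι_apply ℂ _ x

variable {G K T : Type*} [Group G] [LieRing K] [LieAlgebra ℂ K] [LieRing T] [LieAlgebra ℂ T]

namespace LiePair

variable (P : LiePair G K T)

/-- A representation `ν` of `G`, together with the corresponding action `dν` of its Lie algebra `T`.
Of their compatibility only the equivariance, which is needed below, is recorded; in the only case
that is used, `extPow`, `dν` is the differential of `ν`. -/
structure TRep where
  V : Type w
  [acg : AddCommGroup V]
  [mod : Module ℂ V]
  ν : Representation ℂ G V
  dν : T →ₗ⁅ℂ⁆ Module.End ℂ V
  ν_dν : ∀ g x v, ν g (dν x v) = dν (P.adT g x) (ν g v)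

attribute [instance] TRep.acg TRep.mod

/-- A weak `(K, G)`-module with its actions `π` of `U(K)` and `ν` of `G`, together with the third
action `ω = ν - π` of the Lie algebra `T` of `G`. In the only case that is used, `ind`, the action
`ω` is built as this difference. -/
structure WeakModule where
  V : Type w
  [acg : AddCommGroup V]
  [mod : Module ℂ V]
  π : UniversalEnvelopingAlgebra ℂ K →ₐ[ℂ] Module.End ℂ V
  ν : Representation ℂ G V
  ω : T →ₗ⁅ℂ⁆ Module.End ℂ V
  ν_π : ∀ g u v, ν g (π u v) = π (Umap (P.adK g) u) (ν g v)
  ν_ω : ∀ g x v, ν g (ω x v) = ω (P.adT g x) (ν g v)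
  π_ω : ∀ u x v, π u (ω x v) = ω x (π u v)

attribute [instance] WeakModule.acg WeakModule.mod

/-- The action of `G` on `U(K)`. -/
def νU : Representation ℂ G (UniversalEnvelopingAlgebra ℂ K) where
  toFun g := (Umap (P.adK g)).toLinearMap
  map_one' := by
    have : Umap (P.adK 1) = AlgHom.id ℂ _ := by
      apply UniversalEnvelopingAlgebra.hom_ext
      ext x
      change Umap (P.adK 1) (UniversalEnvelopingAlgebra.ι ℂ x) = UniversalEnvelopingAlgebra.ι ℂ x
      rw [Umap_ι, P.adK_one]; rfl
    rw [this]; rfl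
  map_mul' g h := by
    have : Umap (P.adK (g * h)) = (Umap (P.adK g)).comp (Umap (P.adK h)) := by
      apply UniversalEnvelopingAlgebra.hom_ext
      ext x
      change Umap (P.adK (g * h)) (UniversalEnvelopingAlgebra.ι ℂ x) =
        Umap (P.adK g) (Umap (P.adK h) (UniversalEnvelopingAlgebra.ι ℂ x))
      rw [Umap_ι, Umap_ι, Umap_ι, P.adK_mul]; rfl
    rw [this]; rfl

/-- The inner derivation `[x, -]` of `U(K)`. -/
def adU (x : K) : Module.End ℂ (UniversalEnvelopingAlgebra ℂ K) :=
  LinearMap.mulLeft ℂ (UniversalEnvelopingAlgebra.ι ℂ x)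
    - LinearMap.mulRight ℂ (UniversalEnvelopingAlgebra.ι ℂ x)

/-- The action `ω` of `T` on `U(K) ⊗ E`, i.e. the differential of the action of `G` on the tensor
product minus left multiplication on the first factor. -/
def ωInd (E : P.TRep) (x : T) : Module.End ℂ (UniversalEnvelopingAlgebra ℂ K ⊗[ℂ] E.V) :=
  ((adU (P.j x)).rTensor E.V + (E.dν x).lTensor _)
    - (LinearMap.mulLeft ℂ (UniversalEnvelopingAlgebra.ι ℂ (P.j x))).rTensor E.V

theorem ωInd_tmul (E : P.TRep) (x : T) (u : UniversalEnvelopingAlgebra ℂ K) (v : E.V) :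
    P.ωInd E x (u ⊗ₜ v) =
      u ⊗ₜ E.dν x v - (u * UniversalEnvelopingAlgebra.ι ℂ (P.j x)) ⊗ₜ v := by
  simp only [ωInd, adU, LinearMap.sub_apply, LinearMap.add_apply, LinearMap.rTensor_tmul,
    LinearMap.lTensor_tmul, LinearMap.mulLeft_apply, LinearMap.mulRight_apply,
    TensorProduct.sub_tmul]
  abel

/-- `ind_{U(K), ℂ} E = U(K) ⊗ E`: `U(K)` acts by left multiplication on the first factor, and `G`
acts on both factors. -/
def ind (E : P.TRep) : P.WeakModule where
  V := UniversalEnvelopingAlgebra ℂ K ⊗[ℂ] E.V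
  π := (Module.End.rTensorAlgHom ℂ (UniversalEnvelopingAlgebra ℂ K) E.V).comp
    (Algebra.lmul ℂ (UniversalEnvelopingAlgebra ℂ K))
  ν := Representation.tprod P.νU E.ν
  ω :=
    { toFun := P.ωInd E
      map_add' := fun x y => by
        refine TensorProduct.ext' fun u v => ?_
        simp only [ωInd_tmul, map_add, LinearMap.add_apply, mul_add, TensorProduct.tmul_add,
          TensorProduct.add_tmul]
        abel
      map_smul' := fun c x => by
        refine TensorProduct.ext' fun u v => ?_
        simp only [ωInd_tmul, map_smul, LinearMap.smul_apply, mul_smul_comm, TensorProduct.tmul_smul,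
          TensorProduct.smul_tmul', smul_sub, RingHom.id_apply]
      map_lie' := fun {x y} => by
        refine TensorProduct.ext' fun u v => ?_
        simp only [ωInd_tmul, LieHom.map_lie, LieRing.of_associative_ring_bracket,
          Module.End.mul_apply, LinearMap.sub_apply, map_sub, mul_sub, TensorProduct.tmul_sub,
          TensorProduct.sub_tmul, mul_assoc]
        abel }
  ν_π g u v := by
    change Representation.tprod P.νU E.ν g (LinearMap.rTensor E.V (LinearMap.mulLeft ℂ u) v) =
      LinearMap.rTensor E.V (LinearMap.mulLeft ℂ (Umap (P.adK g) u))
        (Representation.tprod P.νU E.ν g v)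
    induction v using TensorProduct.induction_on with
    | zero => simp
    | tmul a b => simp [νU]
    | add v w hv hw => simp only [map_add, hv, hw]
  ν_ω g x v := by
    change Representation.tprod P.νU E.ν g (P.ωInd E x v) =
      P.ωInd E (P.adT g x) (Representation.tprod P.νU E.ν g v)
    induction v using TensorProduct.induction_on with
    | zero => simp
    | tmul a b =>
      simp only [ωInd_tmul, map_sub, Representation.tprod_apply, TensorProduct.map_tmul, E.ν_dν]
      simp only [νU, MonoidHom.coe_mk, OneHom.coe_mk, AlgHom.toLinearMap_apply, map_mul, Umap_ι,
        P.j_ad]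
    | add v w hv hw => simp only [map_add, hv, hw]
  π_ω u x v := by
    change LinearMap.rTensor E.V (LinearMap.mulLeft ℂ u) (P.ωInd E x v) =
      P.ωInd E x (LinearMap.rTensor E.V (LinearMap.mulLeft ℂ u) v)
    induction v using TensorProduct.induction_on with
    | zero => simp
    | tmul a b =>
      simp only [ωInd_tmul, map_sub, LinearMap.rTensor_tmul, LinearMap.mulLeft_apply, mul_assoc]
    | add v w hv hw => simp only [map_add, hv, hw]

/-- The adjoint action of `G` on `K / T`. -/
def adQuot (g : G) : Module.End ℂ (K ⧸ LinearMap.range (P.j : T →ₗ[ℂ] K)) :=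
  Submodule.mapQ _ _ (P.adK g : K →ₗ[ℂ] K) (by
    rintro _ ⟨x, rfl⟩
    exact ⟨P.adT g x, P.j_ad g x⟩)

/-- The adjoint action of the Lie algebra `T` on `K / T`. -/
def lieQuot : T →ₗ⁅ℂ⁆ Module.End ℂ (K ⧸ LinearMap.range (P.j : T →ₗ[ℂ] K)) where
  toFun x := Submodule.mapQ _ _ (LieAlgebra.ad ℂ K (P.j x)) (by
    rintro _ ⟨y, rfl⟩
    exact ⟨⁅x, y⁆, P.j.map_lie x y⟩)
  map_add' x y := by ext z; simp
  map_smul' c x := by ext z; simp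
  map_lie' {x y} := by
    ext z
    simp [LieRing.of_associative_ring_bracket]

/-- The representation of `G` on `⋀^p (K / T)` induced by the adjoint action, with its differential,
the action of `T` by derivations extending the adjoint action on `K / T`. -/
def extPow (p : ℕ) : P.TRep where
  V := ⋀[ℂ]^p (K ⧸ LinearMap.range (P.j : T →ₗ[ℂ] K))
  ν :=
    { toFun := fun g => exteriorPower.map p (P.adQuot g)
      map_one' := by
        have : P.adQuot 1 = LinearMap.id := by ext x; simp [adQuot, P.adK_one]
        rw [this, exteriorPower.map_id]; rfl
      map_mul' := fun g h => by
        have : P.adQuot (g * h) = P.adQuot g ∘ₗ P.adQuot h := by ext x; simp [adQuot, P.adK_mul]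
        rw [this]; exact exteriorPower.map_comp (P.adQuot h) (P.adQuot g) }
  dν := (extDer p).comp P.lieQuot
  ν_dν g x v := by
    refine map_extDer p (P.adQuot g) _ _ ?_ v
    intro m
    obtain ⟨y, rfl⟩ := Submodule.Quotient.mk_surjective _ m
    simp [adQuot, lieQuot, P.j_ad]

section Quot

variable {V : Type*} [AddCommGroup V] [Module ℂ V]

/-- The endomorphism of `V / Z` induced by an endomorphism that preserves `Z`. -/
def quotHom (Z : Submodule ℂ V) : stab Z Z →ₐ[ℂ] Module.End ℂ (V ⧸ Z) where
  toFun φ := Submodule.mapQ Z Z φ.1 φ.2.1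
  map_one' := by ext; rfl
  map_mul' _ _ := by ext; rfl
  map_zero' := by ext; rfl
  map_add' _ _ := by ext; rfl
  commutes' _ := by ext; rfl

end Quot

variable {P}

namespace WeakModule

variable (W : P.WeakModule)

/-- The right action `v · x = ω(ᶥx) v` of `U(T)` on a weak module. -/
def rU (x : UniversalEnvelopingAlgebra ℂ T) : Module.End ℂ W.V :=
  UniversalEnvelopingAlgebra.lift ℂ W.ω (Uiota T x).unop

theorem rU_ι_mul (x : T) (u : UniversalEnvelopingAlgebra ℂ T) (v : W.V) :
    W.rU (UniversalEnvelopingAlgebra.ι ℂ x * u) v = -W.rU u (W.ω x v) := by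
  simp only [rU, map_mul, Uiota_ι, MulOpposite.unop_mul, MulOpposite.unop_neg,
    MulOpposite.unop_op, map_neg, UniversalEnvelopingAlgebra.lift_ι_apply, Module.End.mul_apply,
    LinearMap.neg_apply]

theorem π_rU (u : UniversalEnvelopingAlgebra ℂ K) (x : UniversalEnvelopingAlgebra ℂ T) (v : W.V) :
    W.π u (W.rU x v) = W.rU x (W.π u v) := by
  induction x using U_induction generalizing v with
  | one => simp [rU]
  | hι x n ih => rw [rU_ι_mul, rU_ι_mul, map_neg, ih, W.π_ω]
  | add m n hm hn => simp only [rU, map_add, MulOpposite.unop_add, LinearMap.add_apply] at *; rw [hm, hn]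
  | smul c n hn => simp only [rU, map_smul, MulOpposite.unop_smul, LinearMap.smul_apply] at *; rw [hn]

theorem ν_rU (g : G) (x : UniversalEnvelopingAlgebra ℂ T) (v : W.V) :
    W.ν g (W.rU x v) = W.rU (Umap (P.adT g) x) (W.ν g v) := by
  induction x using U_induction generalizing v with
  | one => simp [rU]
  | hι x n ih => rw [rU_ι_mul, map_mul, Umap_ι, rU_ι_mul, map_neg, ih, W.ν_ω]
  | add m n hm hn => simp only [rU, map_add, MulOpposite.unop_add, LinearMap.add_apply] at *; rw [hm, hn]
  | smul c n hn => simp only [rU, map_smul, MulOpposite.unop_smul, LinearMap.smul_apply] at *; rw [hn]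

/-- The subspace of `W ⊗_ℂ N(T)` spanned by the elements `v x ⊗ e - v ⊗ x e` with `x ∈ U(T)`. -/
def Z : Submodule ℂ (W.V ⊗[ℂ] N T) :=
  Submodule.span ℂ {z | ∃ (v : W.V) (x : UniversalEnvelopingAlgebra ℂ T) (e : N T),
    z = W.rU x v ⊗ₜ e - v ⊗ₜ (N.ofU x * e)}

theorem mem_stab_of (φ : Module.End ℂ (W.V ⊗[ℂ] N T))
    (h : ∀ v x e, φ (W.rU x v ⊗ₜ e - v ⊗ₜ (N.ofU x * e)) ∈ W.Z) : φ ∈ stab W.Z W.Z := by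
  have : ∀ z ∈ W.Z, φ z ∈ W.Z := by
    intro z hz
    induction hz using Submodule.span_induction with
    | mem z hz => obtain ⟨v, x, e, rfl⟩ := hz; exact h v x e
    | zero => simp
    | add y z _ _ hy hz => rw [map_add]; exact add_mem hy hz
    | smul c z _ hz => rw [map_smul]; exact Submodule.smul_mem _ _ hz
  exact ⟨this, this⟩

theorem lTensor_mem_stab (φ : Module.End ℂ (N T))
    (h : ∀ x e, φ (N.ofU x * e) = N.ofU x * φ e) : φ.lTensor W.V ∈ stab W.Z W.Z :=
  W.mem_stab_of _ fun v x e => by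
    rw [map_sub, LinearMap.lTensor_tmul, LinearMap.lTensor_tmul, h]
    exact Submodule.subset_span ⟨v, x, φ e, rfl⟩

theorem π_mem_stab (u : UniversalEnvelopingAlgebra ℂ K) :
    (W.π u).rTensor (N T) ∈ stab W.Z W.Z :=
  W.mem_stab_of _ fun v x e => by
    rw [map_sub, LinearMap.rTensor_tmul, LinearMap.rTensor_tmul, π_rU]
    exact Submodule.subset_span ⟨W.π u v, x, e, rfl⟩

theorem map_ofU (g : G) (x : UniversalEnvelopingAlgebra ℂ T) :
    N.map (P.adT g) (N.ofU x) = N.ofU (Umap (P.adT g) x) := by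
  induction x using U_induction with
  | one => simp
  | hι x n ih => rw [map_mul, map_mul, map_mul, map_mul, ih, Umap_ι, N.ofU_ι, N.ofU_ι, N.map_ev]
  | add m n hm hn => simp [hm, hn]
  | smul c n hn => simp [hn]

theorem ν_mem_stab (g : G) : Representation.tprod W.ν P.νT g ∈ stab W.Z W.Z :=
  W.mem_stab_of _ fun v x e => by
    rw [map_sub, Representation.tprod_apply, TensorProduct.map_tmul, TensorProduct.map_tmul,
      νT_apply, νT_apply, ν_rU, map_mul, map_ofU]
    exact Submodule.subset_span ⟨W.ν g v, Umap (P.adT g) x, N.map (P.adT g) e, rfl⟩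

/-- Right multiplication by elements of `N(T)` on `W ⊗_{U(T)} N(T)`. -/
def rC : N T →ₗ[ℂ] Module.End ℂ ((W.V ⊗[ℂ] N T) ⧸ W.Z) :=
  (quotHom W.Z).toLinearMap ∘ₗ
    ((Module.End.lTensorAlgHom ℂ (N T) W.V).toLinearMap ∘ₗ N.rmul).codRestrict
      (Subalgebra.toSubmodule (stab W.Z W.Z))
      (fun a => W.lTensor_mem_stab (N.rmul a) fun x e => by simp [mul_assoc])

/-- Multiplication by `(-1)^i` in degree `i` on `W[p] ⊗_{U(T)} N(T)`. -/
def sgnC (p : ℕ) : Module.End ℂ ((W.V ⊗[ℂ] N T) ⧸ W.Z) :=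
  ((-1 : ℂ) ^ p) • quotHom W.Z ⟨N.sgn.lTensor W.V, W.lTensor_mem_stab _ fun x e => by simp⟩

/-- The class of `v ⊗ e` in `W ⊗_{U(T)} N(T)`. -/
def tm (v : W.V) (e : N T) : (W.V ⊗[ℂ] N T) ⧸ W.Z := Submodule.Quotient.mk (v ⊗ₜ e)

theorem hom_ext_tm {φ ψ : Module.End ℂ ((W.V ⊗[ℂ] N T) ⧸ W.Z)}
    (h : ∀ v e, φ (W.tm v e) = ψ (W.tm v e)) : φ = ψ :=
  Submodule.linearMap_qext _ (TensorProduct.ext' h)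

theorem rC_tm (a : N T) (v : W.V) (e : N T) : W.rC a (W.tm v e) = W.tm v (e * a) := rfl

theorem sgnC_tm (p : ℕ) (v : W.V) (e : N T) :
    W.sgnC p (W.tm v e) = ((-1 : ℂ) ^ p) • W.tm v (N.par e) := rfl

theorem rC_mul (a b : N T) : W.rC (a * b) = W.rC b * W.rC a :=
  W.hom_ext_tm fun v e => by simp only [Module.End.mul_apply, rC_tm, mul_assoc]

theorem rC_one : W.rC 1 = 1 :=
  W.hom_ext_tm fun v e => by rw [rC_tm, mul_one, Module.End.one_apply]

theorem sgnC_mul_self (p : ℕ) : W.sgnC p * W.sgnC p = 1 :=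
  W.hom_ext_tm fun v e => by
    rw [Module.End.mul_apply, sgnC_tm, map_smul, sgnC_tm, N.par_par, smul_smul, ← mul_pow]
    simp

theorem sgnC_rC (p : ℕ) (a : N T) : W.sgnC p * W.rC a = W.rC (N.par a) * W.sgnC p :=
  W.hom_ext_tm fun v e => by
    simp only [Module.End.mul_apply, rC_tm, sgnC_tm, map_smul, map_mul]

/-- The `(K, G, N(T))`-module `C_T(W[p]) = W[p] ⊗_{U(T)} N(T)`, where `W[p]` is the complex with `W`
in degree `-p`. The differential is `(-1)^p 1 ⊗ d`; `U(K)` acts on `W`, `G` acts on both factors, and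
`N(T)` acts by right multiplication, twisted to a left action. -/
def C (p : ℕ) : PreModule G K T where
  V := (W.V ⊗[ℂ] N T) ⧸ W.Z
  gr i := Submodule.span ℂ {z | ∃ (v : W.V) (e : N T), e ∈ N.gr T (i + p) ∧
    z = W.tm v e}
  d := ((-1 : ℂ) ^ p) • quotHom W.Z
    ⟨(N.d : N T →ₗ[ℂ] N T).lTensor W.V, W.lTensor_mem_stab _ fun x e => by simp [N.d_mul]⟩
  π := (quotHom W.Z).comp
    (((Module.End.rTensorAlgHom ℂ W.V (N T)).comp W.π).codRestrict (stab W.Z W.Z) W.π_mem_stab)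
  ν := (quotHom W.Z : _ →* _).comp
    ((Representation.tprod W.ν P.νT : G →* Module.End ℂ (W.V ⊗[ℂ] N T)).codRestrict
      (stab W.Z W.Z) W.ν_mem_stab)
  ω := twist W.rC W.rC_mul (W.sgnC p) (W.sgnC_mul_self p) (W.sgnC_rC p)

theorem tm_rU (v : W.V) (x : UniversalEnvelopingAlgebra ℂ T) (e : N T) :
    W.tm (W.rU x v) e = W.tm v (N.ofU x * e) :=
  (Submodule.Quotient.eq _).2 (Submodule.subset_span ⟨v, x, e, rfl⟩)

theorem C_d (p : ℕ) (v : W.V) (e : N T) :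
    (W.C p).d (W.tm v e) = ((-1 : ℂ) ^ p) • W.tm v (N.d e) := rfl

theorem C_π (p : ℕ) (u : UniversalEnvelopingAlgebra ℂ K) (v : W.V) (e : N T) :
    (W.C p).π u (W.tm v e) = W.tm (W.π u v) e := rfl

theorem C_ν (p : ℕ) (g : G) (v : W.V) (e : N T) :
    (W.C p).ν g (W.tm v e) = W.tm (W.ν g v) (N.map (P.adT g) e) := rfl

theorem C_ω (p : ℕ) {i l : ℤ} {m e : N T} (hm : m ∈ N.gr T i) (he : e ∈ N.gr T l) (v : W.V) :
    (W.C p).ω m (W.tm v e) = ((-1 : ℂ) ^ (i * (l - p))) • W.tm v (e * N.iota m) := by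
  refine twist_apply W.rC W.rC_mul W.rC_one (W.sgnC p) (W.sgnC_mul_self p) (W.sgnC_rC p) hm ?_
  have h : W.tm v (N.par e) = ((-1 : ℂ) ^ l) • W.tm v e := by
    rw [N.par_of_mem he]
    simp only [tm, TensorProduct.tmul_smul, Submodule.Quotient.mk_smul]
  rw [sgnC_tm, h, smul_smul, zpow_sub₀ (by norm_num), zpow_natCast]
  congr 1
  have : ((-1 : ℂ) ^ p) * (-1 : ℂ) ^ p = 1 := by rw [← mul_pow]; simp
  have hne : ((-1 : ℂ) ^ p) ≠ 0 := pow_ne_zero _ (by norm_num)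
  field_simp
  linear_combination this

end WeakModule

end LiePair

end Induced

section Groups

open Coalgebra WithConv

/-- The group of points of the complex algebraic group with coordinate ring `A`: the algebra
homomorphisms `A → ℂ` with the convolution product. -/
abbrev Pts (A : Type*) [CommRing A] [HopfAlgebra ℂ A] : Type _ := WithConv (A →ₐ[ℂ] ℂ)

variable (A : Type*) [CommRing A] [HopfAlgebra ℂ A]

/-- A point as an element of the convolution algebra `A* = Hom(A, ℂ)`. -/
def Pts.toDual : Pts A →* WithConv (A →ₗ[ℂ] ℂ) where
  toFun g := toConv g.ofConv.toLinearMap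
  map_one' := rfl
  map_mul' _ _ := rfl

variable {A}

theorem Pts.toDual_mul_apply (g : Pts A) (a b : A) :
    Pts.toDual A g (a * b) = Pts.toDual A g a * Pts.toDual A g b := map_mul g.ofConv a b

@[simp] theorem Pts.toDual_apply (g : Pts A) (a : A) : Pts.toDual A g a = g a := rfl

/-- `X` is a point derivation at `g`. -/
def IsPtDer (g : Pts A) (X : WithConv (A →ₗ[ℂ] ℂ)) : Prop :=
  ∀ a b : A, X (a * b) = g a * X b + X a * g b

theorem conv_mul_apply (X Y : WithConv (A →ₗ[ℂ] ℂ)) (a b : A) : (X * Y) (a * b) =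
    ∑ i ∈ (ℛ ℂ a).index, ∑ k ∈ (ℛ ℂ b).index,
      X ((ℛ ℂ a).left i * (ℛ ℂ b).left k) * Y ((ℛ ℂ a).right i * (ℛ ℂ b).right k) := by
  rw [((ℛ ℂ a).mul (ℛ ℂ b)).convMul_apply X Y]
  exact Finset.sum_product _ _ _

theorem conv_apply_mul_conv_apply (X Y X' Y' : WithConv (A →ₗ[ℂ] ℂ)) (a b : A) :
    (X * Y) a * (X' * Y') b =
    ∑ i ∈ (ℛ ℂ a).index, ∑ k ∈ (ℛ ℂ b).index,
      (X ((ℛ ℂ a).left i) * Y ((ℛ ℂ a).right i)) *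
        (X' ((ℛ ℂ b).left k) * Y' ((ℛ ℂ b).right k)) := by
  rw [(ℛ ℂ a).convMul_apply X Y, (ℛ ℂ b).convMul_apply X' Y', Finset.sum_mul_sum]

theorem Pts.mul_apply (g h : Pts A) (a : A) :
    (g * h) a = (Pts.toDual A g * Pts.toDual A h) a := rfl

theorem IsPtDer.mul_left {g : Pts A} {X : WithConv (A →ₗ[ℂ] ℂ)} (h : Pts A) (hX : IsPtDer g X) :
    IsPtDer (h * g) (Pts.toDual A h * X) := by
  intro a b
  rw [Pts.mul_apply, Pts.mul_apply, conv_mul_apply, conv_apply_mul_conv_apply,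
    conv_apply_mul_conv_apply, ← Finset.sum_add_distrib]
  refine Finset.sum_congr rfl fun i _ => ?_
  rw [← Finset.sum_add_distrib]
  refine Finset.sum_congr rfl fun k _ => ?_
  rw [Pts.toDual_mul_apply, hX]
  simp only [Pts.toDual_apply]
  ring

theorem IsPtDer.mul_right {g : Pts A} {X : WithConv (A →ₗ[ℂ] ℂ)} (h : Pts A) (hX : IsPtDer g X) :
    IsPtDer (g * h) (X * Pts.toDual A h) := by
  intro a b
  rw [Pts.mul_apply, Pts.mul_apply, conv_mul_apply, conv_apply_mul_conv_apply,
    conv_apply_mul_conv_apply, ← Finset.sum_add_distrib]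
  refine Finset.sum_congr rfl fun i _ => ?_
  rw [← Finset.sum_add_distrib]
  refine Finset.sum_congr rfl fun k _ => ?_
  rw [Pts.toDual_mul_apply, hX]
  simp only [Pts.toDual_apply]
  ring

theorem IsPtDer.mul_apply {X Y : WithConv (A →ₗ[ℂ] ℂ)} (hX : IsPtDer 1 X) (hY : IsPtDer 1 Y)
    (a b : A) : (X * Y) (a * b) =
      (1 : Pts A) a * (X * Y) b + Y a * X b + X a * Y b + (X * Y) a * (1 : Pts A) b := by
  have e1 : ((1 : Pts A) a) = ((1 : WithConv (A →ₗ[ℂ] ℂ)) * 1) a := by rw [mul_one]; rfl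
  have e2 : ((1 : Pts A) b) = ((1 : WithConv (A →ₗ[ℂ] ℂ)) * 1) b := by rw [mul_one]; rfl
  have e3 : Y a * X b = ((1 : WithConv (A →ₗ[ℂ] ℂ)) * Y) a * (X * 1) b := by rw [mul_one, one_mul]
  have e4 : X a * Y b = (X * 1) a * ((1 : WithConv (A →ₗ[ℂ] ℂ)) * Y) b := by rw [mul_one, one_mul]
  rw [e1, e2, e3, e4, conv_mul_apply, conv_apply_mul_conv_apply, conv_apply_mul_conv_apply,
    conv_apply_mul_conv_apply, conv_apply_mul_conv_apply, ← Finset.sum_add_distrib,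
    ← Finset.sum_add_distrib, ← Finset.sum_add_distrib]
  refine Finset.sum_congr rfl fun i _ => ?_
  rw [← Finset.sum_add_distrib, ← Finset.sum_add_distrib, ← Finset.sum_add_distrib]
  refine Finset.sum_congr rfl fun k _ => ?_
  rw [hX, hY]
  have f : ∀ c : A, (1 : WithConv (A →ₗ[ℂ] ℂ)) c = (1 : Pts A) c := fun c => rfl
  simp only [f]
  ring

theorem IsPtDer.lie {X Y : WithConv (A →ₗ[ℂ] ℂ)} (hX : IsPtDer 1 X) (hY : IsPtDer 1 Y) :
    IsPtDer 1 (X * Y - Y * X) := by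
  intro a b
  have e : ∀ c : A, (X * Y - Y * X) c = (X * Y) c - (Y * X) c := fun c => rfl
  rw [e, e, e, hX.mul_apply hY, hY.mul_apply hX]
  ring

variable (A) in
/-- The Lie algebra of the algebraic group with coordinate ring `A`: the derivations `A → ℂ` at the
identity element, with the commutator bracket of the convolution algebra `A*`. -/
def lieSub : LieSubalgebra ℂ (WithConv (A →ₗ[ℂ] ℂ)) where
  carrier := {X | IsPtDer 1 X}
  zero_mem' := fun a b => by simp
  add_mem' {X Y} hX hY := fun a b => by
    have h1 := hX a b
    have h2 := hY a b
    simp at *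
    rw [h1, h2]; ring
  smul_mem' c X hX := fun a b => by
    have h1 := hX a b
    simp at *
    rw [h1]; ring
  lie_mem' hX hY := IsPtDer.lie hX hY

variable (A) in
/-- The Lie algebra of the algebraic group with coordinate ring `A`. -/
abbrev LieOf : Type _ := lieSub A

/-- The adjoint action `X ↦ g X g⁻¹`. -/
def Ad (g : Pts A) : LieOf A →ₗ⁅ℂ⁆ LieOf A where
  toFun X := ⟨Pts.toDual A g * X.1 * Pts.toDual A g⁻¹, by
    have := (IsPtDer.mul_left g X.2).mul_right g⁻¹
    rwa [mul_one, mul_inv_cancel] at this⟩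
  map_add' X Y := Subtype.ext (by simp [mul_add, add_mul])
  map_smul' c X := Subtype.ext (by simp)
  map_lie' {X Y} := Subtype.ext (by
    have h : Pts.toDual A g⁻¹ * Pts.toDual A g = 1 := by
      rw [← map_mul, inv_mul_cancel, map_one]
    simp only [LieSubalgebra.coe_bracket, LieRing.of_associative_ring_bracket, mul_sub, sub_mul]
    congr 1
    · simp only [mul_assoc]
      rw [← mul_assoc (Pts.toDual A g⁻¹) (Pts.toDual A g), h, one_mul]
    · simp only [mul_assoc]
      rw [← mul_assoc (Pts.toDual A g⁻¹) (Pts.toDual A g), h, one_mul])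

theorem Ad_one : Ad (1 : Pts A) = LieHom.id := by
  ext1 X
  apply Subtype.ext
  simp [Ad]

theorem Ad_mul (g h : Pts A) : Ad (g * h) = (Ad g).comp (Ad h) := by
  ext1 X
  apply Subtype.ext
  simp [Ad, mul_assoc]

variable {B : Type*} [CommRing B] [HopfAlgebra ℂ B]

/-- The map on points of the morphism of algebraic groups with comorphism `γ : A → B`. -/
def ptsMap (γ : A →ₐc[ℂ] B) : Pts B →* Pts A where
  toFun g := toConv (g.ofConv.comp (γ : A →ₐ[ℂ] B))
  map_one' := by
    apply WithConv.ext
    ext a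
    simp
  map_mul' g h := by
    apply WithConv.ext
    exact AlgHom.convMul_comp_bialgHom_distrib g h γ

/-- Transposition along the comorphism `γ : A → B`. -/
def dualMap (γ : A →ₐc[ℂ] B) (X : WithConv (B →ₗ[ℂ] ℂ)) : WithConv (A →ₗ[ℂ] ℂ) :=
  toConv (X.ofConv ∘ₗ (γ : A →ₗc[ℂ] B).toLinearMap)

@[simp] theorem dualMap_apply (γ : A →ₐc[ℂ] B) (X : WithConv (B →ₗ[ℂ] ℂ)) (a : A) :
    dualMap γ X a = X (γ a) := rfl

theorem dualMap_mul (γ : A →ₐc[ℂ] B) (X Y : WithConv (B →ₗ[ℂ] ℂ)) :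
    dualMap γ (X * Y) = dualMap γ X * dualMap γ Y :=
  WithConv.ext (LinearMap.convMul_comp_coalgHom_distrib X Y (γ : A →ₗc[ℂ] B))

theorem dualMap_toDual (γ : A →ₐc[ℂ] B) (g : Pts B) :
    dualMap γ (Pts.toDual B g) = Pts.toDual A (ptsMap γ g) := rfl

/-- The differential of the morphism of algebraic groups with comorphism `γ : A → B`. -/
def differential (γ : A →ₐc[ℂ] B) : LieOf B →ₗ⁅ℂ⁆ LieOf A where
  toFun X := ⟨dualMap γ X.1, fun a b => by
    have := X.2 (γ a) (γ b)
    simpa using this⟩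
  map_add' X Y := Subtype.ext rfl
  map_smul' c X := Subtype.ext rfl
  map_lie' {X Y} := Subtype.ext (by
    simp only [LieSubalgebra.coe_bracket, LieRing.of_associative_ring_bracket, ← dualMap_mul]
    rfl)

/-- The Lie algebras of two algebraic groups and the action of the first group on both of them,
for a morphism of algebraic groups with comorphism `γ : A → B`. -/
def pair (γ : A →ₐc[ℂ] B) : LiePair (Pts B) (LieOf A) (LieOf B) where
  j := differential γ
  adK g := Ad (ptsMap γ g)
  adT g := Ad g
  adK_one := by rw [map_one, Ad_one]
  adK_mul g h := by rw [map_mul, Ad_mul]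
  adT_one := Ad_one
  adT_mul := Ad_mul
  j_ad g x := Subtype.ext (by
    change dualMap γ (Pts.toDual B g * x.1 * Pts.toDual B g⁻¹) =
      Pts.toDual A (ptsMap γ g) * dualMap γ x.1 * Pts.toDual A (ptsMap γ g)⁻¹
    rw [dualMap_mul, dualMap_mul, dualMap_toDual, dualMap_toDual, map_inv])

section

variable {V : Type*} [AddCommGroup V] [Module ℂ V]

/-- A representation of the points of an algebraic group is algebraic if `V` is the union of
finite-dimensional invariant subspaces on which the matrix coefficients are regular functions. -/
def IsAlgebraicRep (ν : Representation ℂ (Pts B) V) : Prop :=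
  ∀ v : V, ∃ W : Submodule ℂ V, FiniteDimensional ℂ W ∧ v ∈ W ∧
    (∀ g, ∀ w ∈ W, ν g w ∈ W) ∧
    ∀ w ∈ W, ∀ φ : Module.Dual ℂ V, ∃ f : B, ∀ g : Pts B, φ (ν g w) = g f

/-- `D` is the derivative of the representation `ν` in the direction of `X ∈ Lie`: whenever
the function `g ↦ φ (ν(g) v)` is the regular function `f`, then `φ (D v) = X(f)`. -/
def IsDifferential (ν : Representation ℂ (Pts B) V) (X : LieOf B) (D : Module.End ℂ V) : Prop :=
  ∀ (v : V) (φ : Module.Dual ℂ V) (f : B),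
    (∀ g : Pts B, φ (ν g v) = g f) → φ (D v) = X.1 f

end

/-- The axioms of a `(K, G, N(T))`-module, where `G` is the algebraic group with coordinate ring `B`
and `T` is its Lie algebra. -/
structure IsHCModule {K : Type*} [LieRing K] [LieAlgebra ℂ K]
    (P : LiePair (Pts B) K (LieOf B)) (M : PreModule (Pts B) K (LieOf B)) : Prop where
  /-- `M` is a complex. -/
  internal : DirectSum.IsInternal M.gr
  d_mem : ∀ i, ∀ v ∈ M.gr i, M.d v ∈ M.gr (i + 1)
  d_d : ∀ v, M.d (M.d v) = 0
  /-- `U(K)` acts by chain maps. -/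
  π_mem : ∀ u i, ∀ v ∈ M.gr i, M.π u v ∈ M.gr i
  d_π : ∀ u v, M.d (M.π u v) = M.π u (M.d v)
  /-- `G` acts algebraically and by chain maps. -/
  ν_algebraic : IsAlgebraicRep M.ν
  ν_mem : ∀ g i, ∀ v ∈ M.gr i, M.ν g v ∈ M.gr i
  d_ν : ∀ g v, M.d (M.ν g v) = M.ν g (M.d v)
  /-- `M` is a DG module over `N(T)`. -/
  ω_mem : ∀ i l, ∀ m ∈ N.gr (LieOf B) i, ∀ v ∈ M.gr l, M.ω m v ∈ M.gr (i + l)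
  d_ω : ∀ i, ∀ m ∈ N.gr (LieOf B) i, ∀ v,
    M.d (M.ω m v) = M.ω (N.d m) v + ((-1 : ℂ) ^ i) • M.ω m (M.d v)
  /-- `π` and `ω` are equivariant and commute. -/
  ν_π : ∀ g u v, M.ν g (M.π u v) = M.π (Umap (P.adK g) u) (M.ν g v)
  ν_ω : ∀ g m v, M.ν g (M.ω m v) = M.ω (N.map (P.adT g) m) (M.ν g v)
  π_ω : ∀ u m v, M.π u (M.ω m v) = M.ω m (M.π u v)
  /-- On `T`, the differential of `ν` is `π + ω`. -/
  sum : ∀ X : LieOf B, IsDifferential M.ν X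
    (M.π (UniversalEnvelopingAlgebra.ι ℂ (P.j X)) + M.ω (N.ev X))

end Groups

section Classes

open scoped TensorProduct

variable {G K T : Type*} [Group G] [LieRing K] [LieAlgebra ℂ K] [LieRing T] [LieAlgebra ℂ T]

namespace LiePair

variable (P : LiePair G K T)

theorem monomial_mem_F (p : ℕ) (u : UniversalEnvelopingAlgebra ℂ K) (ξ : Fin p → K) :
    N.ofU u * (List.ofFn fun i => N.od (ξ i)).prod ∈ P.F p := by
  refine P.mem_F le_rfl ?_
  have h : (List.ofFn fun i => N.od (ξ i)).prod ∈ N.gr K (-(p : ℤ)) := by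
    refine Submodule.subset_span ⟨List.ofFn fun i => Sum.inr (ξ i), ?_, ?_⟩
    · rw [List.countP_eq_length.2]
      · simp
      · intro a ha
        obtain ⟨i, rfl⟩ := (List.mem_ofFn' _ _).1 ha
        rfl
    · simp [N.word, List.map_ofFn, Function.comp_def]
  simpa using N.mul_mem_gr (N.ofU_mem_gr u) h

/-- The class of `u ξ₁ ⋯ ξ_p ∈ N^{-p}(K)` in `Gr_p N(K)`. -/
def grMk (p : ℕ) (u : UniversalEnvelopingAlgebra ℂ K) (ξ : Fin p → K) : (P.Gr p).V :=
  (Submodule.Quotient.mk ⟨_, P.monomial_mem_F p u ξ⟩ :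
    P.F p ⧸ (P.F (p - 1)).comap (P.F p).subtype)

/-- The element `(u ⊗ ξ̄₁ ∧ ⋯ ∧ ξ̄_p) ⊗ 1` of `(U(K) ⊗ ⋀^p (K / T)[p]) ⊗_{U(T)} N(T)`. -/
def indMk (p : ℕ) (u : UniversalEnvelopingAlgebra ℂ K) (ξ : Fin p → K) :
    ((P.ind (P.extPow p)).C p).V :=
  (P.ind (P.extPow p)).tm
    ((u ⊗ₜ exteriorPower.ιMulti ℂ p fun i => Submodule.Quotient.mk (ξ i) :
      UniversalEnvelopingAlgebra ℂ K ⊗[ℂ] ⋀[ℂ]^p (K ⧸ LinearMap.range (P.j : T →ₗ[ℂ] K)))) 1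

end LiePair

end Classes

end HS

end

/-! Up to sign, `ωN m n` is the product of `n` with an element of the image of N(T) on the right. By
straightening words, N^{-i}(K) = U(K)·⋀^i K and N(T) = U(T)·⋀T, so F_p is spanned by monomials u·a·b
with u in U(K), a in ⋀^q K for some q ≤ p, and b in ⋀T (`F_monomial_induction`). In Gr_p only q = p
survives. An odd factor of a that lies in T can be moved, up to sign, to the far right, where it
leaves only p - 1 factors; hence modulo F_{p-1} the element a matters only through its image in
⋀^p(K/T) (`ofΛ_sub_mem_F`). For x in T, u·a·x = u·x·a - u·ad(x)(a), which is the right action of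
U(T) on U(K) ⊗ ⋀^p(K/T) (`indToN_ω_mem_F`). So (u ⊗ ā) ⊗ e ↦ [u·a·e] is a well-defined map
`comparison` from C_T to Gr_p. It is surjective because the monomials span, and it respects the
differentials because da has only p - 1 odd factors.

Injectivity is where the injectivity of T → K enters. It does not go through a
Poincaré–Birkhoff–Witt basis of U(K): it is enough that multiplication U(K) ⊗ ⋀K → N(K) has a left
inverse `split`, obtained by letting N(K) act from the right on U(K) ⊗ ⋀K. A linear retraction K → T
together with K → K/T defines an action of ⋀K on ⋀(K/T) ⊗ N(T); applied to 1 ⊗ 1 and followed by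
projection to exterior degree p, it turns `split` into a map `retract` that kills F_{p-1} and sends
the representative of a tensor back to its class.

The module axioms are proved for N(K) and pass to Gr_p as a subquotient, then to C_T along the
isomorphism. Directness of the grading comes from the automorphism `N.scale`, whose eigenvalues 2^i
separate degrees. Algebraicity and the formula for the differential of ν are both read off from
regular orbit maps (`IsSmoothVector`): on generators they come from the adjoint representation, and
they propagate along products. Since the coordinate ring is reduced and of finite type, the
Nullstellensatz makes the regular function behind a matrix coefficient unique, hence its derivative
well defined. -/

noncomputable section

open scoped TensorProduct

attribute [local instance 100] LieRing.ofAssociativeRing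

namespace HS

/-! ### Direct sum decompositions from eigenvalues -/

section Grading

variable {V : Type*} [AddCommGroup V] [Module ℂ V]

/-- A spanning family of subspaces on which an endomorphism acts by distinct scalars is a direct
sum decomposition. -/
theorem isInternal_of_eigenvalues (E : Module.End ℂ V) (A : ℤ → Submodule ℂ V) (a : ℤ → ℂ)
    (ha : Function.Injective a) (h : ∀ i, ∀ v ∈ A i, E v = a i • v) (htop : ⨆ i, A i = ⊤) :
    DirectSum.IsInternal A := by
  refine DirectSum.isInternal_submodule_of_iSupIndep_of_iSup_eq_top ?_ htop
  exact ((Module.End.eigenspaces_iSupIndep E).comp ha).mono fun i v hv =>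
    Module.End.mem_eigenspace_iff.2 (h i v hv)

/-- A spanning family of subspaces of the summands of a direct sum consists of the full summands. -/
theorem eq_of_le_of_iSup_eq_top {A B : ℤ → Submodule ℂ V} (hB : iSupIndep B)
    (h : ∀ i, A i ≤ B i) (htop : ⨆ i, A i = ⊤) (i : ℤ) : A i = B i := by
  refine le_antisymm (h i) fun v hv => ?_
  have hv' : v ∈ A i ⊔ ⨆ (j) (_ : j ≠ i), A j := by
    have : (⊤ : Submodule ℂ V) ≤ A i ⊔ ⨆ (j) (_ : j ≠ i), A j := by
      rw [← htop]
      refine iSup_le fun j => ?_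
      by_cases hj : j = i
      · subst hj; exact le_sup_left
      · exact le_sup_of_le_right (le_iSup₂_of_le j hj le_rfl)
    exact this Submodule.mem_top
  obtain ⟨x, hx, y, hy, rfl⟩ := Submodule.mem_sup.1 hv'
  have hy1 : y ∈ B i := by simpa using sub_mem hv (h i hx)
  have hy2 : y ∈ ⨆ (j) (_ : j ≠ i), B j := (iSup₂_mono fun j _ => h j) hy
  have : y = 0 := Submodule.disjoint_def.1 (hB i) y hy1 hy2
  simpa [this] using hx

end Grading

/-! ### The grading of N(L) and straightening of words into U(L)·⋀L -/

namespace N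

variable {L : Type*} [LieRing L] [LieAlgebra ℂ L]

theorem d_d (n : N L) : d (d n) = 0 := by
  induction n using N.induction with
  | one => simp
  | hev x n ih => simp [d_mul, ih]
  | hod x n ih => simp [d_mul, ih]
  | add m n hm hn => simp [hm, hn]
  | smul c n hn => simp [hn]

/-- The automorphism of `N(L)` that multiplies elements of degree `i` by `2 ^ i`. -/
def scale : N L →ₐ[ℂ] N L := lift ev ((2⁻¹ : ℂ) • od) ev_ev
  (fun x y => by simp [ev_od]) (fun x y => by simp [← smul_add, od_od])

@[simp] theorem scale_ev (x : L) : scale (ev x) = ev x := by simp [scale]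
@[simp] theorem scale_od (x : L) : scale (od x) = (2⁻¹ : ℂ) • od x := by simp [scale]

theorem scale_of_mem {i : ℤ} {n : N L} (hn : n ∈ gr L i) : scale n = ((2 : ℂ) ^ i) • n := by
  refine gr_induction (p := fun i n => scale n = ((2 : ℂ) ^ i) • n) ?_ ?_ ?_ ?_ ?_ ?_ hn
  · simp
  · intro i x n _ ih; simp [ih]
  · intro i x n _ ih
    rw [map_mul, ih, scale_od, smul_mul_smul_comm, zpow_sub₀ (by norm_num), zpow_one, mul_comm,
      div_eq_mul_inv]
  · simp
  · intro i m n hm hn; simp [hm, hn]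
  · intro i c n hn; rw [map_smul, hn, smul_comm]

theorem two_zpow_injective : Function.Injective fun i : ℤ => (2 : ℂ) ^ i := by
  intro i j h
  have h' : ((2 : ℝ) ^ i : ℝ) = 2 ^ j := by
    apply Complex.ofReal_injective
    push_cast
    exact h
  exact zpow_right_injective₀ (by norm_num) (by norm_num) h'

variable (L) in
theorem iSup_gr : ⨆ i, gr L i = ⊤ := by
  rw [eq_top_iff]
  rintro n -
  induction n using N.induction with
  | one => exact Submodule.mem_iSup_of_mem 0 one_mem_gr
  | hev x n ih =>
    induction ih using Submodule.iSup_induction' with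
    | mem i n hn => exact Submodule.mem_iSup_of_mem i (ev_mul_mem x hn)
    | zero => simp
    | add m n _ _ hm hn => rw [mul_add]; exact add_mem hm hn
  | hod x n ih =>
    induction ih using Submodule.iSup_induction' with
    | mem i n hn => exact Submodule.mem_iSup_of_mem (i - 1) (od_mul_mem x hn)
    | zero => simp
    | add m n _ _ hm hn => rw [mul_add]; exact add_mem hm hn
  | add m n hm hn => exact add_mem hm hn
  | smul c n hn => exact Submodule.smul_mem _ c hn

/-- To prove a linear property of all elements it suffices to prove it for homogeneous ones. -/
theorem homogeneous_induction {p : N L → Prop} (mem : ∀ i, ∀ n ∈ gr L i, p n)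
    (add : ∀ m n, p m → p n → p (m + n)) (n : N L) : p n := by
  have hn : n ∈ ⨆ i, gr L i := by rw [iSup_gr]; trivial
  exact Submodule.iSup_induction (motive := p) _ hn mem (mem 0 0 (zero_mem _)) add

variable (L) in
theorem isInternal_gr : DirectSum.IsInternal (gr L) :=
  isInternal_of_eigenvalues scale.toLinearMap (gr L) _ two_zpow_injective
    (fun _ _ hv => scale_of_mem hv) (iSup_gr L)

/-- The anticommutation relation only gives 2ξ² = 0; division by 2 is what lets the exterior algebra
map to N(L). -/
theorem od_mul_self (x : L) : od x * od x = 0 := by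
  have h := od_od x x
  rw [← two_smul ℂ] at h
  exact (smul_eq_zero.1 h).resolve_left two_ne_zero

/-- The inclusion of the exterior algebra of `L`, with `L` placed in degree `-1`. -/
def ofΛ : ExteriorAlgebra ℂ L →ₐ[ℂ] N L := ExteriorAlgebra.lift ℂ ⟨od, od_mul_self⟩

@[simp] theorem ofΛ_ι (x : L) : ofΛ (ExteriorAlgebra.ι ℂ x) = od x :=
  ExteriorAlgebra.lift_ι_apply ℂ _ _ x

variable (L) in
/-- The subspace `U(L)` of `N(L)`. -/
def evens : Submodule ℂ (N L) := LinearMap.range (ofU (L := L)).toLinearMap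

variable (L) in
/-- The subspace of the generators of degree `-1`. -/
def odds : Submodule ℂ (N L) := LinearMap.range (od (L := L))

theorem ev_mem_evens (x : L) : ev x ∈ evens L := ⟨UniversalEnvelopingAlgebra.ι ℂ x, ofU_ι x⟩
theorem one_mem_evens : (1 : N L) ∈ evens L := ⟨1, by simp⟩
theorem od_mem_odds (x : L) : od x ∈ odds L := ⟨x, rfl⟩

theorem evens_mul_evens : evens L * evens L ≤ evens L := by
  rw [Submodule.mul_le]
  rintro _ ⟨u, rfl⟩ _ ⟨v, rfl⟩
  exact ⟨u * v, by simp⟩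

theorem map_ofΛ_exteriorPower (q : ℕ) :
    (⋀[ℂ]^q L).map (ofΛ (L := L)).toLinearMap = odds L ^ q := by
  rw [ExteriorAlgebra.exteriorPower, Submodule.map_pow]
  congr 1
  rw [← LinearMap.range_comp, odds]
  congr 1
  ext x
  simp

theorem ofΛ_mem_gr {q : ℕ} {a : ExteriorAlgebra ℂ L} (ha : a ∈ ⋀[ℂ]^q L) :
    ofΛ a ∈ gr L (-(q : ℤ)) := by
  induction q generalizing a with
  | zero =>
    rw [ExteriorAlgebra.exteriorPower, pow_zero, Submodule.mem_one] at ha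
    obtain ⟨c, rfl⟩ := ha
    rw [AlgHom.commutes, Algebra.algebraMap_eq_smul_one]
    exact Submodule.smul_mem _ _ (by simpa using one_mem_gr)
  | succ q ih =>
    rw [ExteriorAlgebra.exteriorPower, pow_succ'] at ha
    induction ha using Submodule.mul_induction_on' with
    | mem_mul_mem x hx y hy =>
      obtain ⟨m, rfl⟩ := hx
      rw [map_mul, ofΛ_ι]
      have := od_mul_mem m (ih hy)
      rwa [show -(q : ℤ) - 1 = -((q + 1 : ℕ) : ℤ) by push_cast; ring] at this
    | add x _ y _ hx hy => rw [map_add]; exact add_mem hx hy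

/-- Moving ξ past x costs the commutator, ξx = xξ - [x, ξ], which is again a generator of degree -1
in front of a shorter word. The induction therefore runs over all ξ at once. -/
theorem odds_mul_evens : odds L * evens L ≤ evens L * odds L := by
  rw [Submodule.mul_le]
  rintro _ ⟨ξ, rfl⟩ _ ⟨u, rfl⟩
  change od ξ * ofU u ∈ _
  induction u using U_induction generalizing ξ with
  | one =>
    simpa using Submodule.mul_mem_mul one_mem_evens (od_mem_odds ξ)
  | hι x n ih =>
    have h : od ξ * ofU (UniversalEnvelopingAlgebra.ι ℂ x * n) =
        ev x * (od ξ * ofU n) - od ⁅x, ξ⁆ * ofU n := by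
      rw [map_mul, ofU_ι, ← mul_assoc, ← mul_assoc, ev_od, add_mul, add_sub_cancel_right]
    rw [h]
    refine sub_mem ?_ (ih _)
    have := Submodule.mul_mem_mul (ev_mem_evens x) (ih ξ)
    rw [← mul_assoc] at this
    exact mul_le_mul' evens_mul_evens le_rfl this
  | add m n hm hn => rw [map_add, mul_add]; exact add_mem (hm ξ) (hn ξ)
  | smul c n hn => rw [map_smul, mul_smul_comm]; exact Submodule.smul_mem _ _ (hn ξ)

/-- The spanning half of N^{-q}(L) = U(L) ⊗ ⋀^q L: all factors of degree 0 are collected on the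
left. -/
theorem gr_le (q : ℕ) : gr L (-(q : ℤ)) ≤ evens L * odds L ^ q := by
  intro n hn
  have := gr_induction (p := fun i n => ∀ q : ℕ, i = -(q : ℤ) → n ∈ evens L * odds L ^ q)
    ?_ ?_ ?_ ?_ ?_ ?_ hn
  · exact this q rfl
  · intro q hq
    obtain rfl : q = 0 := by omega
    rw [pow_zero, mul_one]; exact one_mem_evens
  · intro i x n _ ih q hq
    have := Submodule.mul_mem_mul (ev_mem_evens x) (ih q hq)
    rw [← mul_assoc] at this
    exact mul_le_mul' evens_mul_evens le_rfl this
  · intro i x n hn ih q hq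
    rcases q with _ | q
    -- Here the shorter word has degree i = 1, where N(L) vanishes.
    · rw [eq_zero_of_mem_gr (by omega) hn]; simp
    have := Submodule.mul_mem_mul (od_mem_odds x) (ih q (by omega))
    rw [← mul_assoc] at this
    have := mul_le_mul' odds_mul_evens le_rfl this
    rwa [mul_assoc, ← pow_succ'] at this
  · intro i q _; exact zero_mem _
  · intro i m n hm hn q hq; exact add_mem (hm q hq) (hn q hq)
  · intro i c n hn q hq; exact Submodule.smul_mem _ _ (hn q hq)

/-- Every element is a sum of products of an element of `U(L)` and an element of `⋀ L`. -/
theorem ofU_ofΛ_induction {p : N L → Prop} (mul : ∀ u a, p (ofU u * ofΛ a))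
    (add : ∀ m n, p m → p n → p (m + n)) (n : N L) : p n := by
  induction n using homogeneous_induction with
  | mem i n hn =>
    rcases lt_or_ge 0 i with hi | hi
    · rw [eq_zero_of_mem_gr hi hn]; simpa using mul 0 0
    obtain ⟨q, rfl⟩ := Int.exists_eq_neg_ofNat hi
    have := gr_le q hn
    rw [← map_ofΛ_exteriorPower] at this
    refine Submodule.mul_induction_on this ?_ add
    rintro _ ⟨u, rfl⟩ _ ⟨a, -, rfl⟩
    exact mul u a
  | add m n hm hn => exact add _ _ hm hn

theorem map_ofU {L' : Type*} [LieRing L'] [LieAlgebra ℂ L'] (f : L →ₗ⁅ℂ⁆ L')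
    (x : UniversalEnvelopingAlgebra ℂ L) : map f (ofU x) = ofU (Umap f x) := by
  induction x using U_induction with
  | one => simp
  | hι x n ih => rw [map_mul, map_mul, ofU_ι, map_ev, ih, map_mul, Umap_ι, map_mul, ofU_ι]
  | add m n hm hn => simp [hm, hn]
  | smul c n hn => simp [hn]

theorem map_ofΛ {L' : Type*} [LieRing L'] [LieAlgebra ℂ L'] (f : L →ₗ⁅ℂ⁆ L')
    (a : ExteriorAlgebra ℂ L) : map f (ofΛ a) = ofΛ (ExteriorAlgebra.map (f : L →ₗ[ℂ] L') a) := by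
  have : (map f).comp ofΛ = ofΛ.comp (ExteriorAlgebra.map (f : L →ₗ[ℂ] L')) := by
    apply ExteriorAlgebra.hom_ext
    ext x
    simp
  exact DFunLike.congr_fun this a

/-- The commutator with x is a derivation that agrees with ad x on generators of degree -1, so it is
the derivation extending ad x. -/
theorem ev_mul_ofΛ (x : L) (a : ExteriorAlgebra ℂ L) :
    ev x * ofΛ a = ofΛ a * ev x + ofΛ (der (LieAlgebra.ad ℂ L x) a) := by
  induction a using ExteriorAlgebra.induction with
  | algebraMap r => simp [Algebra.commutes]
  | ι y => simp [ev_od]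
  | mul a b ha hb =>
    rw [map_mul, ← mul_assoc, ha, add_mul, mul_assoc, hb, der_mul, map_add, map_mul, map_mul]
    noncomm_ring
  | add a b ha hb => simp only [map_add, mul_add, ha, hb, add_mul]; abel

end N

/-- The sign from `iota_od_mul` and the sign from reversing the product again are (-1)^i and
(-1)^{-i}, and cancel. This makes ι surjective, so that right multiplication by every element of
N(T) occurs in ω. -/
theorem N.iota_iota {L : Type*} [LieRing L] [LieAlgebra ℂ L] (n : N L) :
    N.iota (N.iota n) = n := by
  induction n using N.homogeneous_induction with
  | mem i n hn =>
    refine N.gr_induction (p := fun _ n => N.iota (N.iota n) = n) ?_ ?_ ?_ ?_ ?_ ?_ hn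
    · simp
    · intro i x n hn ih
      have h0 : N.ev x ∈ N.gr L 0 := by simpa using N.ev_mul_mem x N.one_mem_gr
      rw [N.iota_ev_mul, map_neg, N.iota_mul (N.iota_mem_gr hn) h0, ih]
      simp
    · intro i x n hn ih
      have h1 : N.od x ∈ N.gr L (-1) := by simpa using N.od_mul_mem x N.one_mem_gr
      rw [N.iota_od_mul, N.par_of_mem (N.iota_mem_gr hn), map_neg, smul_mul_assoc, map_smul,
        N.iota_mul (N.iota_mem_gr hn) h1, ih, smul_smul, ← zpow_add₀ (by norm_num)]
      simp
    · simp
    · intro i m n hm hn; rw [map_add, map_add, hm, hn]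
    · intro i c n hn; rw [map_smul, map_smul, hn]
  | add m n hm hn => rw [map_add, map_add, hm, hn]

/-! ### The Hochschild–Serre filtration through right multiplication -/

namespace LiePair

variable {G K T : Type*} [Group G] [LieRing K] [LieAlgebra ℂ K] [LieRing T] [LieAlgebra ℂ T]
variable (P : LiePair G K T)

/-- The Hochschild–Serre filtration is spanned by the products `n m` with `m` in the image of
`N(T)`. -/
theorem F_eq_span (p : ℤ) : P.F p = Submodule.span ℂ {v | ∃ (m : N T) (i : ℕ) (n : N K),
    (i : ℤ) ≤ p ∧ n ∈ N.gr K (-(i : ℤ)) ∧ v = n * N.map P.j m} := by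
  refine le_antisymm (Submodule.span_le.2 ?_) (Submodule.span_le.2 ?_)
  · rintro _ ⟨m, i, n, hi, hn, rfl⟩
    induction m using N.homogeneous_induction with
    | mem l m hm =>
      rw [P.ωN_apply hm hn]
      exact Submodule.smul_mem _ _ (Submodule.subset_span ⟨_, i, n, hi, hn, rfl⟩)
    | add m m' h h' => rw [map_add]; exact add_mem h h'
  · rintro _ ⟨m, i, n, hi, hn, rfl⟩
    induction m using N.homogeneous_induction with
    | mem l m hm =>
      -- Right multiplication by m is, up to sign, the action of ιm, because ι is an involution.
      have h := P.ωN_apply (N.iota_mem_gr hm) hn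
      rw [N.iota_iota] at h
      have h1 : n * N.map P.j m = ((-1 : ℂ) ^ (l * -(i : ℤ)))⁻¹ • P.ωN (N.iota m) n := by
        rw [h, inv_smul_smul₀ (zpow_ne_zero _ (by norm_num))]
      rw [h1]
      exact Submodule.smul_mem _ _ (Submodule.subset_span ⟨_, i, n, hi, hn, rfl⟩)
    | add m m' h h' => rw [map_add, mul_add]; exact add_mem h h'

variable {P}

theorem mul_map_mem_F {p : ℤ} {v : N K} (hv : v ∈ P.F p) (m : N T) : v * N.map P.j m ∈ P.F p := by
  rw [F_eq_span] at hv ⊢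
  induction hv using Submodule.span_induction with
  | mem v hv =>
    obtain ⟨m', i, n, hi, hn, rfl⟩ := hv
    exact Submodule.subset_span ⟨m' * m, i, n, hi, hn, by rw [map_mul, mul_assoc]⟩
  | zero => simp
  | add v w _ _ hv hw => rw [add_mul]; exact add_mem hv hw
  | smul c v _ hv => rw [smul_mul_assoc]; exact Submodule.smul_mem _ _ hv

theorem F_mono {p q : ℤ} (h : p ≤ q) : P.F p ≤ P.F q := by
  refine Submodule.span_mono ?_
  rintro _ ⟨m, i, n, hi, hn, rfl⟩
  exact ⟨m, i, n, hi.trans h, hn, rfl⟩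

/-- Left multiplication does not touch the factor from N(T) on the right, and it adds one odd
generator to the factor that is counted. -/
theorem od_mul_mem_F (x : K) {p : ℤ} {v : N K} (hv : v ∈ P.F p) : N.od x * v ∈ P.F (p + 1) := by
  rw [F_eq_span] at hv ⊢
  induction hv using Submodule.span_induction with
  | mem v hv =>
    obtain ⟨m, i, n, hi, hn, rfl⟩ := hv
    refine Submodule.subset_span ⟨m, i + 1, N.od x * n, by push_cast; linarith, ?_,
      (mul_assoc _ _ _).symm⟩
    have := N.od_mul_mem x hn
    rwa [show -(i : ℤ) - 1 = -((i + 1 : ℕ) : ℤ) by push_cast; ring] at this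
  | zero => simp
  | add v w _ _ hv hw => rw [mul_add]; exact add_mem hv hw
  | smul c v _ hv => rw [mul_smul_comm]; exact Submodule.smul_mem _ _ hv

theorem ofU_mul_mem_F (u : UniversalEnvelopingAlgebra ℂ K) {p : ℤ} {v : N K} (hv : v ∈ P.F p) :
    N.ofU u * v ∈ P.F p := (P.stable_F p).π u v hv

theorem ofΛ_mem_F {q : ℕ} {p : ℤ} (h : (q : ℤ) ≤ p) {a : ExteriorAlgebra ℂ K}
    (ha : a ∈ ⋀[ℂ]^q K) : N.ofΛ a ∈ P.F p := P.mem_F h (N.ofΛ_mem_gr ha)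

/-- In a product n·x·b with x in U(T) and b in ⋀T, the element x has degree 0, so n·x still lies in
N^{-i}(K) and can be straightened in U(K)·⋀^i K. Only b has to stay on the right. -/
theorem F_monomial_induction {p : ℤ} {r : N K → Prop}
    (mul : ∀ (q : ℕ) (u : UniversalEnvelopingAlgebra ℂ K) (a : ExteriorAlgebra ℂ K)
      (b : ExteriorAlgebra ℂ T), (q : ℤ) ≤ p → a ∈ ⋀[ℂ]^q K →
      r (N.ofU u * N.ofΛ a * N.map P.j (N.ofΛ b)))
    (zero : r 0) (add : ∀ v w, r v → r w → r (v + w)) {v : N K} (hv : v ∈ P.F p) : r v := by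
  have key : ∀ (m : N T) (i : ℕ) (n : N K), (i : ℤ) ≤ p → n ∈ N.gr K (-(i : ℤ)) →
      r (n * N.map P.j m) := by
    intro m i n hi hn
    induction m using N.ofU_ofΛ_induction with
    | mul x b =>
      have hn' : n * N.ofU (Umap P.j x) ∈ N.gr K (-(i : ℤ)) := by
        simpa using N.mul_mem_gr hn (N.ofU_mem_gr (Umap P.j x))
      have h := N.gr_le i hn'
      rw [← N.map_ofΛ_exteriorPower] at h
      rw [map_mul, N.map_ofU, ← mul_assoc]
      refine Submodule.mul_induction_on (C := fun z => r (z * N.map P.j (N.ofΛ b))) h ?_ ?_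
      · rintro _ ⟨u, rfl⟩ _ ⟨a, ha, rfl⟩
        exact mul i u a b hi ha
      · intro y z hy hz
        rw [add_mul]; exact add _ _ hy hz
    | add m m' h h' => rw [map_add, mul_add]; exact add _ _ h h'
  rw [F_eq_span] at hv
  -- The predicate is not assumed stable under scalars: the span is generated additively by scalar
  -- multiples of products, and the scalar is absorbed into n.
  refine Submodule.closure_induction (p := fun v _ => r v) zero (fun v w _ _ => add v w) ?_ hv
  rintro c _ ⟨m, i, n, hi, hn, rfl⟩
  rw [← smul_mul_assoc]
  exact key m i _ hi (Submodule.smul_mem _ _ hn)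

end LiePair

/-! ### Regular orbit maps, algebraic representations and their differentials -/

section Regular

variable {B : Type*} [CommRing B] [HopfAlgebra ℂ B]
variable {V V' V'' : Type*} [AddCommGroup V] [Module ℂ V] [AddCommGroup V'] [Module ℂ V']
  [AddCommGroup V''] [Module ℂ V'']

/-- The contraction of the first factor of `B ⊗ V` with a linear form on `B`. -/
def contract (φ : B →ₗ[ℂ] ℂ) : B ⊗[ℂ] V →ₗ[ℂ] V := TensorProduct.lid ℂ V ∘ₗ φ.rTensor V

@[simp] theorem contract_tmul (φ : B →ₗ[ℂ] ℂ) (b : B) (v : V) : contract φ (b ⊗ₜ v) = φ b • v := by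
  simp [contract]

theorem contract_lTensor (φ : B →ₗ[ℂ] ℂ) (f : V →ₗ[ℂ] V') (t : B ⊗[ℂ] V) :
    contract φ (f.lTensor B t) = f (contract φ t) := by
  induction t using TensorProduct.induction_on with
  | zero => simp
  | tmul b v => simp
  | add s t hs ht => simp only [map_add, hs, ht]

/-- The value of a linear form on the contraction is the value of a function. -/
theorem apply_contract (φ : B →ₗ[ℂ] ℂ) (ψ : Module.Dual ℂ V) (t : B ⊗[ℂ] V) :
    ψ (contract φ t) = φ (TensorProduct.rid ℂ B (LinearMap.lTensor B ψ t)) := by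
  induction t using TensorProduct.induction_on with
  | zero => simp
  | tmul b v => simp [mul_comm]
  | add s t hs ht => simp only [map_add, hs, ht]

theorem IsPtDer.map_one {g : Pts B} {X : WithConv (B →ₗ[ℂ] ℂ)} (hX : IsPtDer g X) : X 1 = 0 := by
  have h := hX 1 1
  have h1 : g 1 = 1 := _root_.map_one g.ofConv
  rw [mul_one, h1] at h
  linear_combination -h

/-- The map on vector valued functions induced by a bilinear map. -/
def pairing (β : V →ₗ[ℂ] V' →ₗ[ℂ] V'') :
    B ⊗[ℂ] V →ₗ[ℂ] B ⊗[ℂ] V' →ₗ[ℂ] B ⊗[ℂ] V'' := TensorProduct.map₂ (LinearMap.mul ℂ B) β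

theorem pairing_tmul (β : V →ₗ[ℂ] V' →ₗ[ℂ] V'') (b b' : B) (v : V) (v' : V') :
    pairing β (b ⊗ₜ v) (b' ⊗ₜ v') = (b * b') ⊗ₜ β v v' := rfl

/-- A point is multiplicative on B, so evaluation commutes with products of vector valued functions.
-/
theorem contract_pairing_point (β : V →ₗ[ℂ] V' →ₗ[ℂ] V'') (g : Pts B) (s : B ⊗[ℂ] V)
    (t : B ⊗[ℂ] V') : contract (Pts.toDual B g).ofConv (pairing β s t) =
      β (contract (Pts.toDual B g).ofConv s) (contract (Pts.toDual B g).ofConv t) := by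
  induction s using TensorProduct.induction_on with
  | zero => simp
  | add s s' hs hs' => simp only [map_add, LinearMap.add_apply, hs, hs']
  | tmul b v =>
    induction t using TensorProduct.induction_on with
    | zero => simp
    | add t t' ht ht' => simp only [map_add, ht, ht']
    | tmul b' v' =>
      have h : (Pts.toDual B g).ofConv (b * b') =
        (Pts.toDual B g).ofConv b * (Pts.toDual B g).ofConv b' := Pts.toDual_mul_apply g b b'
      simp only [pairing_tmul, contract_tmul, map_smul, LinearMap.smul_apply, smul_smul, h, mul_comm]

/-- The product rule at the identity, for products of vector valued functions. -/
theorem contract_pairing_derivation (β : V →ₗ[ℂ] V' →ₗ[ℂ] V'') (X : LieOf B) (s : B ⊗[ℂ] V)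
    (t : B ⊗[ℂ] V') : contract X.1.ofConv (pairing β s t) =
      β (contract (Pts.toDual B 1).ofConv s) (contract X.1.ofConv t) +
        β (contract X.1.ofConv s) (contract (Pts.toDual B 1).ofConv t) := by
  induction s using TensorProduct.induction_on with
  | zero => simp
  | add s s' hs hs' => simp only [map_add, LinearMap.add_apply, hs, hs']; abel
  | tmul b v =>
    induction t using TensorProduct.induction_on with
    | zero => simp
    | add t t' ht ht' => simp only [map_add, ht, ht']; abel
    | tmul b' v' =>
      have h : X.1.ofConv (b * b') = (Pts.toDual B 1).ofConv b * X.1.ofConv b' +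
          X.1.ofConv b * (Pts.toDual B 1).ofConv b' :=
        X.2 b b'
      simp only [pairing_tmul, contract_tmul, map_smul, LinearMap.smul_apply, smul_smul, h, add_smul,
        mul_comm]

/-- The orbit map `g ↦ ν(g) v` of `v` is a regular function with values in `V`, and its derivative
at the identity in the direction of `X` is `D X v`. -/
def IsSmoothVector (ν : Representation ℂ (Pts B) V) (D : LieOf B → Module.End ℂ V) (v : V) : Prop :=
  ∃ t : B ⊗[ℂ] V, (∀ g, contract (Pts.toDual B g).ofConv t = ν g v) ∧
    ∀ X : LieOf B, contract X.1.ofConv t = D X v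

variable {ν : Representation ℂ (Pts B) V} {D : LieOf B → Module.End ℂ V}
  {ν' : Representation ℂ (Pts B) V'} {D' : LieOf B → Module.End ℂ V'}
  {ν'' : Representation ℂ (Pts B) V''} {D'' : LieOf B → Module.End ℂ V''}

theorem IsSmoothVector.add {v w : V} (hv : IsSmoothVector ν D v) (hw : IsSmoothVector ν D w) :
    IsSmoothVector ν D (v + w) := by
  obtain ⟨s, hs, hs'⟩ := hv
  obtain ⟨t, ht, ht'⟩ := hw
  exact ⟨s + t, fun g => by simp only [map_add, hs, ht], fun X => by simp only [map_add, hs', ht']⟩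

theorem IsSmoothVector.smul (c : ℂ) {v : V} (hv : IsSmoothVector ν D v) :
    IsSmoothVector ν D (c • v) := by
  obtain ⟨s, hs, hs'⟩ := hv
  exact ⟨c • s, fun g => by simp only [map_smul, hs], fun X => by simp only [map_smul, hs']⟩

/-- Compatibility is required on the orbit of v only. For subquotients f involves a linear
retraction that need not be equivariant anywhere else. -/
theorem IsSmoothVector.map (f : V →ₗ[ℂ] V') {v : V} {v' : V'} (hv : IsSmoothVector ν D v)
    (h : ∀ g, f (ν g v) = ν' g v') (h' : ∀ X, f (D X v) = D' X v') : IsSmoothVector ν' D' v' := by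
  obtain ⟨s, hs, hs'⟩ := hv
  exact ⟨f.lTensor B s, fun g => by rw [contract_lTensor, hs, h],
    fun X => by rw [contract_lTensor, hs', h']⟩

/-- The orbit map of β(v, v') is the product of the two orbit maps, and the two contraction rules
for `pairing` compute its values and its derivative. -/
theorem IsSmoothVector.bilin (β : V →ₗ[ℂ] V' →ₗ[ℂ] V'') {v : V} {v' : V'}
    (hv : IsSmoothVector ν D v) (hv' : IsSmoothVector ν' D' v')
    (h : ∀ g, ν'' g (β v v') = β (ν g v) (ν' g v'))
    (h' : ∀ X, D'' X (β v v') = β v (D' X v') + β (D X v) v') :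
    IsSmoothVector ν'' D'' (β v v') := by
  obtain ⟨s, hs, hs'⟩ := hv
  obtain ⟨t, ht, ht'⟩ := hv'
  refine ⟨pairing β s t, fun g => by rw [contract_pairing_point, hs, ht, h], fun X => ?_⟩
  rw [contract_pairing_derivation, hs, ht, hs', ht', h', map_one, map_one, Module.End.one_apply,
    Module.End.one_apply]

theorem IsSmoothVector.of_fixed {v : V} (h : ∀ g, ν g v = v) (h' : ∀ X, D X v = 0) :
    IsSmoothVector ν D v := by
  refine ⟨1 ⊗ₜ v, fun g => ?_, fun X => ?_⟩
  · have h1 : (Pts.toDual B g).ofConv 1 = 1 := _root_.map_one g.ofConv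
    rw [contract_tmul, h, h1, one_smul]
  · have h1 : X.1.ofConv 1 = 0 := IsPtDer.map_one X.2
    rw [contract_tmul, h', h1, zero_smul]

/-- The right translate of a regular function by a fixed point h is regular. -/
theorem toDual_mul_apply (g h : Pts B) (f : B) : (g * h) f = g (TensorProduct.rid ℂ B
    (LinearMap.lTensor B h.ofConv.toLinearMap (Coalgebra.comul f))) := by
  rw [Pts.mul_apply, (Coalgebra.Repr.arbitrary ℂ f).convMul_apply]
  conv_rhs => rw [← (Coalgebra.Repr.arbitrary ℂ f).eq]
  simp only [map_sum, LinearMap.lTensor_tmul, TensorProduct.rid_tmul, map_smul, smul_eq_mul,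
    mul_comm]
  rfl

/-- The invariant subspace is the span of the orbit of v. If the orbit map is a finite sum of b_i ⊗
v_i, every ν(g)v lies in the span of the v_i, which bounds the dimension. -/
theorem isAlgebraicRep_of_isSmoothVector (h : ∀ v, IsSmoothVector ν D v) : IsAlgebraicRep ν := by
  intro v
  obtain ⟨t, ht, -⟩ := h v
  have hreg : ∀ w ∈ Submodule.span ℂ (Set.range fun g => ν g v), ∀ φ : Module.Dual ℂ V,
      ∃ f : B, ∀ g : Pts B, φ (ν g w) = g f := by
    intro w hw φ
    induction hw using Submodule.span_induction with
    | mem w hw =>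
      obtain ⟨h, rfl⟩ := hw
      -- This is the coefficient g ↦ φ(ν(g)v); for the vector ν(h)v the coefficient is its right
      -- translate by h.
      let f := TensorProduct.rid ℂ B (LinearMap.lTensor B φ t)
      refine ⟨TensorProduct.rid ℂ B (LinearMap.lTensor B h.ofConv.toLinearMap (Coalgebra.comul f)),
        fun g => ?_⟩
      rw [← toDual_mul_apply, ← Module.End.mul_apply, ← map_mul, ← ht, apply_contract]
      rfl
    | zero => exact ⟨0, fun g => by rw [map_zero, map_zero]; exact (map_zero g.ofConv).symm⟩
    | add x y _ _ hx hy =>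
      obtain ⟨a, ha⟩ := hx
      obtain ⟨b, hb⟩ := hy
      exact ⟨a + b, fun g => by
        rw [map_add, map_add, ha, hb]; exact (map_add g.ofConv a b).symm⟩
    | smul c x _ hx =>
      obtain ⟨a, ha⟩ := hx
      exact ⟨c • a, fun g => by
        rw [map_smul, map_smul, ha]; exact (map_smul g.ofConv c a).symm⟩
  refine ⟨Submodule.span ℂ (Set.range fun g => ν g v), ?_, ?_, ?_, hreg⟩
  · classical
    obtain ⟨S, hS⟩ := TensorProduct.exists_finset t
    refine Submodule.finiteDimensional_of_le (S₂ := Submodule.span ℂ (S.image Prod.snd : Set V)) ?_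
    rw [Submodule.span_le]
    rintro _ ⟨g, rfl⟩
    change ν g v ∈ _
    rw [← ht, hS, map_sum]
    refine Submodule.sum_mem _ fun i hi => ?_
    rw [contract_tmul]
    exact Submodule.smul_mem _ _ (Submodule.subset_span (Finset.mem_image_of_mem _ hi))
  · exact Submodule.subset_span ⟨1, by simp⟩
  · intro g w hw
    induction hw using Submodule.span_induction with
    | mem w hw =>
      obtain ⟨h, rfl⟩ := hw
      exact Submodule.subset_span ⟨g * h, by simp⟩
    | zero => simp
    | add x y _ _ hx hy => rw [map_add]; exact add_mem hx hy
    | smul c x _ hx => rw [map_smul]; exact Submodule.smul_mem _ _ hx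

/-- A regular function that vanishes at all points is zero. -/
theorem eq_zero_of_forall_point [Algebra.FiniteType ℂ B] [IsReduced B] (f : B)
    (h : ∀ g : Pts B, g f = 0) : f = 0 := by
  have hJ : IsJacobsonRing B := isJacobsonRing_of_finiteType (A := ℂ)
  have hrad : (⊥ : Ideal B).jacobson = ⊥ :=
    hJ.out fun x ⟨n, hn⟩ => IsReduced.eq_zero x ⟨n, hn⟩
  have hf : f ∈ (⊥ : Ideal B).jacobson := by
    rw [Ideal.jacobson, Ideal.mem_sInf]
    rintro M ⟨-, hM⟩
    let _ := Ideal.Quotient.field M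
    have : Algebra.FiniteType ℂ (B ⧸ M) := inferInstance
    -- Zariski's lemma: the residue field is finite over ℂ, hence equal to ℂ, and reduction modulo M
    -- is a point at which f vanishes by assumption.
    have : Module.Finite ℂ (B ⧸ M) := finite_of_finite_type_of_isJacobsonRing ℂ (B ⧸ M)
    have hb := IsAlgClosed.algebraMap_bijective_of_isIntegral (k := ℂ) (K := B ⧸ M)
    let e : ℂ ≃ₐ[ℂ] (B ⧸ M) := AlgEquiv.ofBijective (Algebra.ofId ℂ _) hb
    have := h (WithConv.toConv ((e.symm : (B ⧸ M) →ₐ[ℂ] ℂ).comp (Ideal.Quotient.mkₐ ℂ M)))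
    have h0 : e.symm (Ideal.Quotient.mkₐ ℂ M f) = 0 := this
    rw [map_eq_zero_iff _ e.symm.injective] at h0
    exact Ideal.Quotient.eq_zero_iff_mem.1 h0
  rwa [hrad] at hf

/-- The orbit map supplies one regular function for the coefficient, with the right derivative.
`IsDifferential` asks this of every regular function with the same values at points, and there is
only one. -/
theorem isDifferential_of_isSmoothVector [Algebra.FiniteType ℂ B] [IsReduced B]
    (h : ∀ v, IsSmoothVector ν D v) (X : LieOf B) : IsDifferential ν X (D X) := by
  intro v φ f hf
  obtain ⟨t, ht, ht'⟩ := h v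
  have e : f = TensorProduct.rid ℂ B (LinearMap.lTensor B φ t) := by
    rw [← sub_eq_zero]
    refine eq_zero_of_forall_point _ fun g => ?_
    have h1 : g (f - TensorProduct.rid ℂ B (LinearMap.lTensor B φ t)) =
      g f - g (TensorProduct.rid ℂ B (LinearMap.lTensor B φ t)) := map_sub g.ofConv _ _
    rw [h1, ← hf, ← ht, apply_contract, sub_eq_zero]
    rfl
  rw [← ht', apply_contract, e]

end Regular

/-! ### The adjoint representation is algebraic with differential ad -/

section Adjoint

variable {A : Type*} [CommRing A] [HopfAlgebra ℂ A]

/-- Finitely many functions give coordinates on the Lie algebra. -/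
theorem exists_lieOf_coordinates [Algebra.FiniteType ℂ A] :
    ∃ (s : Finset A) (x : s → LieOf A), ∀ X : LieOf A, X = ∑ i : s, X.1 (i : A) • x i := by
  obtain ⟨s, hs⟩ := Algebra.FiniteType.out (R := ℂ) (A := A)
  let ev : LieOf A →ₗ[ℂ] (s → ℂ) :=
    { toFun := fun X i => X.1 (i : A)
      map_add' := fun X Y => rfl
      map_smul' := fun c X => rfl }
  -- A derivation at the identity is determined by its values on algebra generators.
  have hinj : LinearMap.ker ev = ⊥ := by
    rw [LinearMap.ker_eq_bot']
    intro X hX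
    have hX1 : ∀ a : A, X.1 a = 0 := by
      intro a
      have ha : a ∈ Algebra.adjoin ℂ (s : Set A) := by rw [hs]; trivial
      induction ha using Algebra.adjoin_induction with
      | mem a ha => exact congrFun hX ⟨a, ha⟩
      | algebraMap c =>
        have h : X.1 (c • (1 : A)) = c • X.1 1 := map_smul X.1.ofConv c 1
        rw [Algebra.algebraMap_eq_smul_one, h, IsPtDer.map_one X.2, smul_zero]
      | add a b _ _ ha hb =>
        have h : X.1 (a + b) = X.1 a + X.1 b := map_add X.1.ofConv a b
        rw [h, ha, hb, add_zero]
      | mul a b _ _ ha hb => rw [X.2 a b, ha, hb]; simp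
    apply Subtype.ext
    apply WithConv.ext
    ext a
    exact hX1 a
  -- The vectors x i are the images of the standard basis under a left inverse of the coordinate
  -- map.
  obtain ⟨r, hr⟩ := ev.exists_leftInverse_of_injective hinj
  classical
  refine ⟨s, fun i => r (Pi.single i 1), fun X => ?_⟩
  have h := LinearMap.congr_fun hr X
  conv_lhs => rw [← LinearMap.id_apply (R := ℂ) X, ← h, LinearMap.comp_apply,
    pi_eq_sum_univ' (ev X)]
  rw [map_sum]
  refine Finset.sum_congr rfl fun i _ => ?_
  rw [map_smul]
  congr 2

/-- Composition of a convolution operator with a linear form. -/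
def post (φ : WithConv (A →ₗ[ℂ] ℂ)) (F : WithConv (A →ₗ[ℂ] A)) : WithConv (A →ₗ[ℂ] ℂ) :=
  WithConv.toConv (φ.ofConv ∘ₗ F.ofConv)

theorem post_apply (φ : WithConv (A →ₗ[ℂ] ℂ)) (F : WithConv (A →ₗ[ℂ] A)) (a : A) :
    post φ F a = φ (F a) := rfl

/-- Composition with an algebra homomorphism A → ℂ respects convolution. Convolution operators on A
thus serve as families of linear forms on A parametrized by the points g. -/
theorem post_point_mul (g : Pts A) (F H : WithConv (A →ₗ[ℂ] A)) :
    post (Pts.toDual A g) (F * H) = post (Pts.toDual A g) F * post (Pts.toDual A g) H := by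
  apply WithConv.ext
  ext a
  change g.ofConv ((F * H) a) = (post (Pts.toDual A g) F * post (Pts.toDual A g) H) a
  rw [(Coalgebra.Repr.arbitrary ℂ a).convMul_apply, (Coalgebra.Repr.arbitrary ℂ a).convMul_apply,
    map_sum]
  refine Finset.sum_congr rfl fun i _ => ?_
  rw [map_mul]
  rfl

/-- Composition with Y differentiates such a family at the identity; this is its product rule. -/
theorem post_derivation_mul (Y : LieOf A) (F H : WithConv (A →ₗ[ℂ] A)) :
    post Y.1 (F * H) = post (Pts.toDual A 1) F * post Y.1 H +
      post Y.1 F * post (Pts.toDual A 1) H := by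
  apply WithConv.ext
  ext a
  change Y.1.ofConv ((F * H) a) = (post (Pts.toDual A 1) F * post Y.1 H) a +
      (post Y.1 F * post (Pts.toDual A 1) H) a
  rw [(Coalgebra.Repr.arbitrary ℂ a).convMul_apply, (Coalgebra.Repr.arbitrary ℂ a).convMul_apply,
    (Coalgebra.Repr.arbitrary ℂ a).convMul_apply, map_sum, ← Finset.sum_add_distrib]
  exact Finset.sum_congr rfl fun i _ => Y.2 _ _

/-- The operator `a ↦ X(a) 1`. -/
def constConv (X : WithConv (A →ₗ[ℂ] ℂ)) : WithConv (A →ₗ[ℂ] A) :=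
  WithConv.toConv (Algebra.linearMap ℂ A ∘ₗ X.ofConv)

theorem post_point_constConv (g : Pts A) (X : WithConv (A →ₗ[ℂ] ℂ)) :
    post (Pts.toDual A g) (constConv X) = X := by
  apply WithConv.ext
  ext a
  exact g.ofConv.commutes (X a)

theorem post_derivation_constConv (Y : LieOf A) (X : WithConv (A →ₗ[ℂ] ℂ)) :
    post Y.1 (constConv X) = 0 := by
  apply WithConv.ext
  ext a
  change Y.1.ofConv (algebraMap ℂ A (X a)) = 0
  have h : Y.1.ofConv 1 = 0 := IsPtDer.map_one Y.2
  rw [Algebra.algebraMap_eq_smul_one, map_smul, h, smul_zero]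

/-- The identity operator. -/
def idConv : WithConv (A →ₗ[ℂ] A) := WithConv.toConv LinearMap.id

/-- The antipode as a convolution operator. -/
def antipodeConv : WithConv (A →ₗ[ℂ] A) := WithConv.toConv (HopfAlgebra.antipode ℂ)

theorem post_idConv (φ : WithConv (A →ₗ[ℂ] ℂ)) : post φ idConv = φ := rfl

theorem idConv_mul_antipodeConv : (idConv * antipodeConv : WithConv (A →ₗ[ℂ] A)) = 1 := by
  exact LinearMap.id_mul_antipode

theorem post_point_antipodeConv (g : Pts A) :
    post (Pts.toDual A g) antipodeConv = Pts.toDual A g⁻¹ := rfl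

/-- The derivative of g ↦ g⁻¹ at the identity, found by differentiating g·g⁻¹ = 1. -/
theorem post_derivation_antipodeConv (Y : LieOf A) : post Y.1 antipodeConv = -Y.1 := by
  have h : post Y.1 (idConv * antipodeConv) = 0 := by
    rw [idConv_mul_antipodeConv]
    -- The convolution unit is the constant family with value the counit.
    exact post_derivation_constConv Y 1
  rw [post_derivation_mul, post_idConv, post_idConv, post_point_antipodeConv, inv_one, map_one,
    one_mul, mul_one] at h
  exact eq_neg_of_add_eq_zero_left h

/-- The convolution of the identity, the constant X and the antipode is the family g ↦ g X g⁻¹, so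
each value at a fixed a is a regular function of g. -/
theorem Ad_apply_apply (g : Pts A) (X : LieOf A) (a : A) : (Ad g X).1 a =
    Pts.toDual A g ((idConv * constConv X.1 * antipodeConv : WithConv (A →ₗ[ℂ] A)) a) := by
  rw [← post_apply, post_point_mul, post_point_mul, post_idConv, post_point_constConv,
    post_point_antipodeConv]
  rfl

/-- Differentiating the three factors of g X g⁻¹ in the direction of Y gives YX + 0 - XY. -/
theorem lie_apply_apply (Y X : LieOf A) (a : A) : ⁅Y, X⁆.1 a =
    Y.1 ((idConv * constConv X.1 * antipodeConv : WithConv (A →ₗ[ℂ] A)) a) := by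
  rw [← post_apply, post_derivation_mul, post_derivation_mul, post_point_mul, post_idConv,
    post_idConv, post_point_constConv, post_derivation_constConv, post_point_antipodeConv,
    post_derivation_antipodeConv, inv_one, map_one, one_mul, mul_zero, zero_add, mul_one]
  have h : X.1 * -Y.1 + Y.1 * X.1 = Y.1 * X.1 - X.1 * Y.1 :=
    (congrArg (· + Y.1 * X.1) (mul_neg X.1 Y.1)).trans (neg_add_eq_sub _ _)
  exact (congrArg (fun Z : WithConv (A →ₗ[ℂ] ℂ) => Z a) h).symm

variable {B : Type*} [CommRing B] [HopfAlgebra ℂ B]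

/-- The adjoint representation of the target of a morphism of algebraic groups, restricted to the
source, is algebraic, and its differential is the adjoint representation of Lie algebras. -/
theorem exists_contract_eq_Ad [Algebra.FiniteType ℂ A] (γ : A →ₐc[ℂ] B) (X : LieOf A) :
    ∃ t : B ⊗[ℂ] LieOf A,
      (∀ g : Pts B, contract (Pts.toDual B g).ofConv t = Ad (ptsMap γ g) X) ∧
      ∀ Y : LieOf B, contract Y.1.ofConv t = ⁅differential γ Y, X⁆ := by
  obtain ⟨s, x, hx⟩ := exists_lieOf_coordinates (A := A)
  -- The coefficients are the coordinates of Ad(g)X as regular functions on the target group, pulled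
  -- back along γ.
  refine ⟨∑ i : s, γ ((idConv * constConv X.1 * antipodeConv : WithConv (A →ₗ[ℂ] A)) (i : A)) ⊗ₜ x i,
    fun g => ?_, fun Y => ?_⟩
  · rw [hx (Ad (ptsMap γ g) X), map_sum]
    refine Finset.sum_congr rfl fun i _ => ?_
    rw [contract_tmul, Ad_apply_apply]
    rfl
  · rw [hx ⁅differential γ Y, X⁆, map_sum]
    refine Finset.sum_congr rfl fun i _ => ?_
    rw [contract_tmul, lie_apply_apply]
    rfl

end Adjoint

/-! ### Module axioms for subquotients and along isomorphisms -/

section Subquotients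

variable {G K T : Type*} [Group G] [LieRing K] [LieAlgebra ℂ K] [LieRing T] [LieAlgebra ℂ T]

namespace PreModule

/-- The class in a subquotient of an element of the larger subspace. -/
def subquotMk (M : PreModule G K T) (F F' : Submodule ℂ M.V) (hF : M.Stable F)
    (hF' : M.Stable F') : F →ₗ[ℂ] (M.subquot F F' hF hF').V := (F'.comap F.subtype).mkQ

section

variable (M : PreModule G K T) (F F' : Submodule ℂ M.V) (hF : M.Stable F) (hF' : M.Stable F')

theorem subquotMk_surjective : Function.Surjective (M.subquotMk F F' hF hF') :=
  Submodule.mkQ_surjective _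

theorem subquotMk_eq_iff (x y : F) :
    M.subquotMk F F' hF hF' x = M.subquotMk F F' hF hF' y ↔ x.1 - y.1 ∈ F' :=
  Submodule.Quotient.eq _

theorem subquotMk_mem_gr {x : F} {i : ℤ} (hx : x.1 ∈ M.gr i) :
    M.subquotMk F F' hF hF' x ∈ (M.subquot F F' hF hF').gr i := ⟨x, hx, rfl⟩

theorem subquot_d (x : F) : (M.subquot F F' hF hF').d (M.subquotMk F F' hF hF' x) =
    M.subquotMk F F' hF hF' ⟨M.d x, hF.d _ x.2⟩ := rfl

end

/-- The inverse of an isomorphism. -/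
def Iso.symm {M M' : PreModule G K T} (f : M.Iso M') : M'.Iso M where
  e := f.e.symm
  gr i v := by rw [f.gr, f.e.apply_symm_apply]
  d v := by rw [LinearEquiv.symm_apply_eq, f.d, f.e.apply_symm_apply]
  π u v := by rw [LinearEquiv.symm_apply_eq, f.π, f.e.apply_symm_apply]
  ν g v := by rw [LinearEquiv.symm_apply_eq, f.ν, f.e.apply_symm_apply]
  ω n v := by rw [LinearEquiv.symm_apply_eq, f.ω, f.e.apply_symm_apply]

end PreModule

variable {B : Type*} [CommRing B] [HopfAlgebra ℂ B]

/-- The operators that form the differential of the group action of a module. -/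
def PreModule.dν (P : LiePair (Pts B) K (LieOf B)) (M : PreModule (Pts B) K (LieOf B))
    (X : LieOf B) : Module.End ℂ M.V :=
  M.π (UniversalEnvelopingAlgebra.ι ℂ (P.j X)) + M.ω (N.ev X)

/-- Identities descend to the quotient directly. Directness of the grading is a hypothesis because
`Stable` does not ask for homogeneous subspaces, and algebraicity with its differential is recovered
from smooth vectors. -/
theorem IsHCModule.subquot [Algebra.FiniteType ℂ B] [IsReduced B]
    {P : LiePair (Pts B) K (LieOf B)} {M : PreModule (Pts B) K (LieOf B)}
    (hM : IsHCModule P M) (hs : ∀ v, IsSmoothVector M.ν (M.dν P) v)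
    {F F' : Submodule ℂ M.V} (hF : M.Stable F) (hF' : M.Stable F')
    (hgr : DirectSum.IsInternal (M.subquot F F' hF hF').gr) :
    IsHCModule P (M.subquot F F' hF hF') := by
  have hs' : ∀ v, IsSmoothVector (M.subquot F F' hF hF').ν ((M.subquot F F' hF hF').dν P) v := by
    intro v
    obtain ⟨x, rfl⟩ := M.subquotMk_surjective F F' hF hF' v
    -- The orbit map of x is given as an element of B ⊗ V, not of B ⊗ F. A linear retraction onto F
    -- brings it to F, and it is harmless since the orbit stays in F.
    obtain ⟨r, hr⟩ := F.subtype.exists_leftInverse_of_injective F.ker_subtype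
    have hr' : ∀ y : F, r y.1 = y := fun y => LinearMap.congr_fun hr y
    refine (hs x.1).map (M.subquotMk F F' hF hF' ∘ₗ r) (fun g => ?_) (fun X => ?_)
    · exact congrArg _ (hr' ⟨M.ν g x.1, hF.ν g _ x.2⟩)
    · exact congrArg _ (hr' ⟨M.dν P X x.1, add_mem (hF.π _ _ x.2) (hF.ω _ _ x.2)⟩)
  exact {
    internal := hgr
    d_mem := by
      rintro i _ ⟨x, hx, rfl⟩
      exact M.subquotMk_mem_gr F F' hF hF' (x := ⟨_, hF.d _ x.2⟩) (hM.d_mem i _ hx)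
    d_d := fun v => by
      obtain ⟨x, rfl⟩ := M.subquotMk_surjective F F' hF hF' v
      rw [PreModule.subquot_d, PreModule.subquot_d, ← map_zero (M.subquotMk F F' hF hF')]
      exact congrArg _ (Subtype.ext (hM.d_d _))
    π_mem := by
      rintro u i _ ⟨x, hx, rfl⟩
      exact M.subquotMk_mem_gr F F' hF hF' (x := ⟨_, hF.π _ _ x.2⟩) (hM.π_mem u i _ hx)
    d_π := fun u v => by
      obtain ⟨x, rfl⟩ := M.subquotMk_surjective F F' hF hF' v
      exact congrArg _ (Subtype.ext (hM.d_π u x.1))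
    ν_algebraic := isAlgebraicRep_of_isSmoothVector hs'
    ν_mem := by
      rintro g i _ ⟨x, hx, rfl⟩
      exact M.subquotMk_mem_gr F F' hF hF' (x := ⟨_, hF.ν _ _ x.2⟩) (hM.ν_mem g i _ hx)
    d_ν := fun g v => by
      obtain ⟨x, rfl⟩ := M.subquotMk_surjective F F' hF hF' v
      exact congrArg _ (Subtype.ext (hM.d_ν g x.1))
    ω_mem := by
      rintro i l m hm _ ⟨x, hx, rfl⟩
      exact M.subquotMk_mem_gr F F' hF hF' (x := ⟨_, hF.ω _ _ x.2⟩) (hM.ω_mem i l m hm _ hx)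
    d_ω := fun i m hm v => by
      obtain ⟨x, rfl⟩ := M.subquotMk_surjective F F' hF hF' v
      exact congrArg _ (Subtype.ext (hM.d_ω i m hm x.1))
    ν_π := fun g u v => by
      obtain ⟨x, rfl⟩ := M.subquotMk_surjective F F' hF hF' v
      exact congrArg _ (Subtype.ext (hM.ν_π g u x.1))
    ν_ω := fun g m v => by
      obtain ⟨x, rfl⟩ := M.subquotMk_surjective F F' hF hF' v
      exact congrArg _ (Subtype.ext (hM.ν_ω g m x.1))
    π_ω := fun u m v => by
      obtain ⟨x, rfl⟩ := M.subquotMk_surjective F F' hF hF' v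
      exact congrArg _ (Subtype.ext (hM.π_ω u m x.1))
    sum := fun X => isDifferential_of_isSmoothVector hs' X }

/-- This is how the induced module acquires all its axioms, including directness of its grading,
from the graded piece. -/
theorem IsHCModule.of_iso {P : LiePair (Pts B) K (LieOf B)} {M M' : PreModule (Pts B) K (LieOf B)}
    (hM : IsHCModule P M) (f : M.Iso M') : IsHCModule P M' where
  internal := by
    have h : M'.gr = fun i => (M.gr i).map (f.e : M.V →ₗ[ℂ] M'.V) := by
      funext i
      ext v
      obtain ⟨v, rfl⟩ := f.e.surjective v
      rw [← f.gr]
      exact ⟨fun h => ⟨v, h, rfl⟩, fun ⟨w, hw, h⟩ => f.e.injective h ▸ hw⟩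
    rw [h, DirectSum.isInternal_submodule_iff_iSupIndep_and_iSup_eq_top]
    have h1 := (DirectSum.isInternal_submodule_iff_iSupIndep_and_iSup_eq_top _).1 hM.internal
    refine ⟨h1.1.map_orderIso (Submodule.orderIsoMapComap f.e), ?_⟩
    rw [← Submodule.map_iSup, h1.2, Submodule.map_top, LinearEquiv.range]
  d_mem i v hv := by
    obtain ⟨v, rfl⟩ := f.e.surjective v
    rw [← f.d, ← f.gr]
    exact hM.d_mem i v ((f.gr i v).2 hv)
  d_d v := by
    obtain ⟨v, rfl⟩ := f.e.surjective v
    rw [← f.d, ← f.d, hM.d_d, map_zero]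
  π_mem u i v hv := by
    obtain ⟨v, rfl⟩ := f.e.surjective v
    rw [← f.π, ← f.gr]
    exact hM.π_mem u i v ((f.gr i v).2 hv)
  d_π u v := by
    obtain ⟨v, rfl⟩ := f.e.surjective v
    rw [← f.d, ← f.π, ← f.π, ← f.d, hM.d_π]
  ν_algebraic v := by
    obtain ⟨v, rfl⟩ := f.e.surjective v
    obtain ⟨W, hW, hv, hinv, hreg⟩ := hM.ν_algebraic v
    refine ⟨W.map (f.e : M.V →ₗ[ℂ] M'.V), inferInstance, ⟨v, hv, rfl⟩, ?_, ?_⟩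
    · rintro g _ ⟨w, hw, rfl⟩
      exact ⟨M.ν g w, hinv g w hw, f.ν g w⟩
    · rintro _ ⟨w, hw, rfl⟩ φ
      obtain ⟨a, ha⟩ := hreg w hw (φ ∘ₗ (f.e : M.V →ₗ[ℂ] M'.V))
      exact ⟨a, fun g => by rw [← ha]; exact congrArg φ (f.ν g w).symm⟩
  ν_mem g i v hv := by
    obtain ⟨v, rfl⟩ := f.e.surjective v
    rw [← f.ν, ← f.gr]
    exact hM.ν_mem g i v ((f.gr i v).2 hv)
  d_ν g v := by
    obtain ⟨v, rfl⟩ := f.e.surjective v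
    rw [← f.d, ← f.ν, ← f.ν, ← f.d, hM.d_ν]
  ω_mem i l m hm v hv := by
    obtain ⟨v, rfl⟩ := f.e.surjective v
    rw [← f.ω, ← f.gr]
    exact hM.ω_mem i l m hm v ((f.gr l v).2 hv)
  d_ω i m hm v := by
    obtain ⟨v, rfl⟩ := f.e.surjective v
    rw [← f.d, ← f.ω, ← f.ω, ← f.ω, ← f.d, hM.d_ω i m hm, map_add, map_smul]
  ν_π g u v := by
    obtain ⟨v, rfl⟩ := f.e.surjective v
    rw [← f.π, ← f.ν, ← f.ν, ← f.π, hM.ν_π]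
  ν_ω g m v := by
    obtain ⟨v, rfl⟩ := f.e.surjective v
    rw [← f.ω, ← f.ν, ← f.ν, ← f.ω, hM.ν_ω]
  π_ω u m v := by
    obtain ⟨v, rfl⟩ := f.e.surjective v
    rw [← f.ω, ← f.π, ← f.π, ← f.ω, hM.π_ω]
  sum X v φ a ha := by
    obtain ⟨v, rfl⟩ := f.e.surjective v
    have h := hM.sum X v (φ ∘ₗ (f.e : M.V →ₗ[ℂ] M'.V)) a fun g => by
      rw [← ha, ← f.ν]; rfl
    rw [← h, LinearMap.add_apply, ← f.π, ← f.ω, ← map_add]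
    rfl

end Subquotients

theorem N.d_ofU_mul {L : Type*} [LieRing L] [LieAlgebra ℂ L] (u : UniversalEnvelopingAlgebra ℂ L)
    (v : N L) : N.d (N.ofU u * v) = N.ofU u * N.d v := by
  rw [N.d_mul, N.d_ofU, N.par_ofU, zero_mul, zero_add]

namespace LiePair

/-! ### The grading on Gr_p and the DG identities on N(K) -/

section Graded

variable {G K T : Type*} [Group G] [LieRing K] [LieAlgebra ℂ K] [LieRing T] [LieAlgebra ℂ T]
variable (P : LiePair G K T)

/-- The scaling automorphism commutes with ω(x) for x of degree 0 and with ω(ξ) for ξ of degree -1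
up to the factor 1/2; on the homogeneous elements that generate F_p it is a scalar. -/
theorem scale_mem_F {p : ℤ} {v : N K} (hv : v ∈ P.F p) : N.scale v ∈ P.F p := by
  refine F_induction (q := fun v => N.scale v ∈ P.F p) ?_ ?_ ?_ ?_ ?_ ?_ hv
  · intro i n hi hn
    rw [N.scale_of_mem hn]
    exact Submodule.smul_mem _ _ (P.mem_F hi hn)
  · intro x v _ h
    simpa using P.ωN_mem_F (N.ev x) h
  · intro x v _ h
    have e : N.scale (P.ωN (N.od x) v) = (2⁻¹ : ℂ) • P.ωN (N.od x) (N.scale v) := by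
      have h1 : N.scale (N.par v) = N.par (N.scale v) := by
        have : (N.scale (L := K)).comp N.par = N.par.comp N.scale := N.hom_ext (by simp) (by simp)
        exact DFunLike.congr_fun this v
      simp [h1]
    rw [e]
    exact Submodule.smul_mem _ _ (P.ωN_mem_F _ h)
  · simp
  · intro v w h h'; rw [map_add]; exact add_mem h h'
  · intro c v h; rw [map_smul]; exact Submodule.smul_mem _ _ h

theorem F_le_iSup_inf_gr (p : ℤ) : P.F p ≤ ⨆ i, P.F p ⊓ N.gr K i := by
  refine Submodule.span_le.2 ?_
  rintro _ ⟨m, i, n, hi, hn, rfl⟩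
  induction m using N.homogeneous_induction with
  | mem l m hm =>
    refine Submodule.mem_iSup_of_mem (-(i : ℤ) + l) ⟨P.ωN_mem_F m (P.mem_F hi hn), ?_⟩
    rw [P.ωN_apply hm hn]
    exact Submodule.smul_mem _ _ (N.mul_mem_gr hn (N.map_mem_gr _ (N.iota_mem_gr hm)))
  | add m m' h h' => rw [map_add]; exact add_mem h h'

/-- The class in `Gr_p N(K)` of an element of `F_p N(K)`. -/
def cls (p : ℤ) : P.F p →ₗ[ℂ] (P.Gr p).V :=
  P.std.subquotMk (P.F p) (P.F (p - 1)) (P.stable_F p) (P.stable_F (p - 1))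

theorem cls_surjective (p : ℤ) : Function.Surjective (P.cls p) := Submodule.mkQ_surjective _

theorem cls_eq_iff {p : ℤ} (x y : P.F p) : P.cls p x = P.cls p y ↔ x.1 - y.1 ∈ P.F (p - 1) :=
  P.std.subquotMk_eq_iff (P.F p) (P.F (p - 1)) (P.stable_F p) (P.stable_F (p - 1)) x y

theorem cls_mem_gr {p i : ℤ} {x : P.F p} (hx : x.1 ∈ N.gr K i) : P.cls p x ∈ (P.Gr p).gr i :=
  ⟨x, hx, rfl⟩

/-- Scaling descends to Gr_p with eigenvalue 2^i in degree i, which gives independence. The degrees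
span because F_p is generated by homogeneous elements. -/
theorem isInternal_Gr (p : ℤ) : DirectSum.IsInternal (P.Gr p).gr := by
  let E : Module.End ℂ (P.Gr p).V := stabHom (P.F p) (P.F (p - 1))
    ⟨((N.scale (L := K)).toLinearMap : Module.End ℂ (N K)),
      fun _ hv => P.scale_mem_F hv, fun _ hv => P.scale_mem_F hv⟩
  have hE : ∀ x : P.F p, E (P.cls p x) = P.cls p ⟨N.scale x.1, P.scale_mem_F x.2⟩ := fun _ => rfl
  refine isInternal_of_eigenvalues E _ _ N.two_zpow_injective ?_ ?_
  · rintro i _ ⟨⟨x, hx'⟩, hx, rfl⟩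
    refine (hE ⟨x, hx'⟩).trans (Eq.trans ?_ (map_smul (P.cls p) ((2 : ℂ) ^ i) ⟨x, hx'⟩))
    exact congrArg (P.cls p) (Subtype.ext (N.scale_of_mem hx))
  · rw [eq_top_iff]
    rintro v -
    obtain ⟨⟨x, hx⟩, rfl⟩ := P.cls_surjective p v
    have h : ∀ y ∈ ⨆ i, P.F p ⊓ N.gr K i, ∃ hy : y ∈ P.F p,
        P.cls p ⟨y, hy⟩ ∈ ⨆ i, (P.Gr p).gr i := by
      intro y hy
      refine Submodule.iSup_induction _ (motive := fun y => ∃ hy : y ∈ P.F p,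
        P.cls p ⟨y, hy⟩ ∈ ⨆ i, (P.Gr p).gr i) hy ?_ ?_ ?_
      · intro i y hy
        exact ⟨hy.1, Submodule.mem_iSup_of_mem i (P.cls_mem_gr hy.2)⟩
      · exact ⟨zero_mem _, by
          have := zero_mem (⨆ i, (P.Gr p).gr i)
          rwa [← map_zero (P.cls p)] at this⟩
      · rintro y z ⟨hy, hy'⟩ ⟨hz, hz'⟩
        refine ⟨add_mem hy hz, ?_⟩
        have := add_mem hy' hz'
        rwa [← map_add] at this
    exact (h x (P.F_le_iSup_inf_gr p hx)).2

theorem ωN_mem_gr {i l : ℤ} {m : N T} (hm : m ∈ N.gr T i) {v : N K} (hv : v ∈ N.gr K l) :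
    P.ωN m v ∈ N.gr K (i + l) := by
  rw [P.ωN_apply hm hv, add_comm]
  exact Submodule.smul_mem _ _ (N.mul_mem_gr hv (N.map_mem_gr _ (N.iota_mem_gr hm)))

theorem d_ωN {i : ℤ} {m : N T} (hm : m ∈ N.gr T i) (v : N K) :
    N.d (P.ωN m v) = P.ωN (N.d m) v + ((-1 : ℂ) ^ i) • P.ωN m (N.d v) := by
  refine N.gr_induction (p := fun i m => N.d (P.ωN m v) =
    P.ωN (N.d m) v + ((-1 : ℂ) ^ i) • P.ωN m (N.d v)) ?_ ?_ ?_ ?_ ?_ ?_ hm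
  · simp
  · intro i x n _ ih
    simp [N.d_mul, ih, add_mul]
    abel
  · intro i x n _ ih
    have h : ((-1 : ℂ) ^ (i - 1)) = -(-1) ^ i := by
      rw [zpow_sub₀ (by norm_num), zpow_one, div_neg, div_one]
    rw [h]
    simp [N.d_mul, N.d_par, ih, add_mul]
    abel
  · simp
  · intro i m n hm hn; simp only [map_add, LinearMap.add_apply, hm, hn, smul_add]; abel
  · intro i c n hn; simp only [map_smul, LinearMap.smul_apply, hn, smul_add, smul_comm c]

theorem map_ωN (g : G) (m : N T) (v : N K) :
    N.map (P.adK g) (P.ωN m v) = P.ωN (N.map (P.adT g) m) (N.map (P.adK g) v) := by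
  induction m using N.induction with
  | one => simp
  | hev x n ih => simp [ih, P.j_ad]
  | hod x n ih => simp [← ih, P.j_ad, N.par_map]
  | add m n hm hn => simp [hm, hn]
  | smul c n hn => simp [hn]

theorem ofU_mul_ωN (u : UniversalEnvelopingAlgebra ℂ K) (m : N T) (v : N K) :
    N.ofU u * P.ωN m v = P.ωN m (N.ofU u * v) := by
  induction m using N.induction with
  | one => simp
  | hev x n ih => simp [← ih, mul_assoc]
  | hod x n ih => simp [← ih, mul_assoc]
  | add m n hm hn => simp [← hm, ← hn, mul_add]
  | smul c n hn => simp [← hn]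

/-- The action of `T` on `N(K)` by inner derivations. -/
def dνK (x : T) : Module.End ℂ (N K) :=
  Algebra.lmul ℂ (N K) (N.ofU (UniversalEnvelopingAlgebra.ι ℂ (P.j x))) + P.ωN (N.ev x)

theorem dνK_apply (x : T) (n : N K) : P.dνK x n = N.ev (P.j x) * n - n * N.ev (P.j x) := by
  rw [dνK, LinearMap.add_apply, N.ofU_ι, ωN_ev, sub_eq_add_neg]
  rfl

end Graded

/-! ### N(K) and Gr_p as modules for the pair of algebraic groups -/

section Standard

variable {A B : Type*} [CommRing A] [HopfAlgebra ℂ A] [CommRing B] [HopfAlgebra ℂ B]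

/-- The group acts by algebra automorphisms and its Lie algebra by inner derivations, so smooth
vectors form a subalgebra. It contains the generators, which span two copies of the adjoint
representation. -/
theorem isSmoothVector_νK [Algebra.FiniteType ℂ A] (γ : A →ₐc[ℂ] B) (n : N (LieOf A)) :
    IsSmoothVector (pair γ).νK (pair γ).dνK n := by
  have hmul : ∀ m n : N (LieOf A), IsSmoothVector (pair γ).νK (pair γ).dνK m →
      IsSmoothVector (pair γ).νK (pair γ).dνK n →
      IsSmoothVector (pair γ).νK (pair γ).dνK (m * n) := by
    intro m n hm hn
    refine hm.bilin (LinearMap.mul ℂ (N (LieOf A))) hn (fun g => ?_) (fun X => ?_)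
    · exact map_mul (N.map ((pair γ).adK g)) m n
    · simp only [LinearMap.mul_apply', dνK_apply]
      noncomm_ring
  have hlin : ∀ (f : LieOf A →ₗ[ℂ] N (LieOf A)),
      (∀ g x, N.map ((pair γ).adK g) (f x) = f ((pair γ).adK g x)) →
      (∀ y x, N.ev y * f x - f x * N.ev y = f ⁅y, x⁆) → ∀ x,
      IsSmoothVector (pair γ).νK (pair γ).dνK (f x) := by
    intro f h1 h2 x
    obtain ⟨t, ht, ht'⟩ := exists_contract_eq_Ad γ x
    refine ⟨f.lTensor B t, fun g => ?_, fun X => ?_⟩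
    · rw [contract_lTensor, ht]
      exact (h1 g x).symm
    · rw [contract_lTensor, ht', dνK_apply]
      exact (h2 _ x).symm
  induction n using N.induction with
  | one =>
    refine IsSmoothVector.of_fixed (fun g => map_one (N.map ((pair γ).adK g))) fun X => ?_
    rw [dνK_apply, mul_one, one_mul, sub_self]
  | hev x n ih =>
    exact hmul _ _ (hlin N.ev (by simp) (fun y x => by rw [N.ev_ev y x]; abel) x) ih
  | hod x n ih =>
    exact hmul _ _ (hlin N.od (by simp) (fun y x => by rw [N.ev_od y x]; abel) x) ih
  | add m n hm hn => exact hm.add hn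
  | smul c n hn => exact hn.smul c

theorem isHCModule_std [Algebra.FiniteType ℂ A] [Algebra.FiniteType ℂ B] [IsReduced B]
    (γ : A →ₐc[ℂ] B) : IsHCModule (pair γ) (pair γ).std where
  internal := N.isInternal_gr _
  d_mem _ _ hv := N.d_mem_gr hv
  d_d := N.d_d
  π_mem u i _ hv := zero_add i ▸ N.mul_mem_gr (N.ofU_mem_gr u) hv
  d_π u v := N.d_ofU_mul u v
  ν_algebraic := isAlgebraicRep_of_isSmoothVector (isSmoothVector_νK γ)
  ν_mem _ _ _ hv := N.map_mem_gr _ hv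
  d_ν _ _ := N.d_map _ _
  ω_mem _ _ _ hm _ hv := (pair γ).ωN_mem_gr hm hv
  d_ω _ _ hm v := (pair γ).d_ωN hm v
  ν_π g u v := (map_mul (N.map ((pair γ).adK g)) (N.ofU u) v).trans (by rw [N.map_ofU]; rfl)
  ν_ω := (pair γ).map_ωN
  π_ω := (pair γ).ofU_mul_ωN
  sum X := isDifferential_of_isSmoothVector (isSmoothVector_νK γ) X

theorem isHCModule_Gr [Algebra.FiniteType ℂ A] [Algebra.FiniteType ℂ B] [IsReduced B]
    (γ : A →ₐc[ℂ] B) (p : ℤ) : IsHCModule (pair γ) ((pair γ).Gr p) :=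
  (isHCModule_std γ).subquot (isSmoothVector_νK γ) _ _ ((pair γ).isInternal_Gr p)

end Standard

end LiePair

/-! ### A left inverse of multiplication U(L) ⊗ ⋀L → N(L) -/

section Straightening

variable {L : Type*} [LieRing L] [LieAlgebra ℂ L]

namespace N

theorem od_mul_ofΛ (x : L) (a : ExteriorAlgebra ℂ L) : od x * ofΛ a = par (ofΛ a) * od x := by
  induction a using ExteriorAlgebra.induction with
  | algebraMap r => simp [Algebra.commutes]
  | ι y => simpa using eq_neg_of_add_eq_zero_left (od_od x y)
  | mul a b ha hb => rw [map_mul, ← mul_assoc, ha, mul_assoc, hb, map_mul, mul_assoc]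
  | add a b ha hb => simp only [map_add, mul_add, ha, hb, add_mul]

theorem par_ofΛ {p : ℕ} {a : ExteriorAlgebra ℂ L} (ha : a ∈ ⋀[ℂ]^p L) :
    par (ofΛ a) = ((-1 : ℂ) ^ p) • ofΛ a := by
  rw [par_of_mem (ofΛ_mem_gr ha), zpow_neg, zpow_natCast, ← inv_pow, inv_neg, inv_one]

/-- The right action of a generator of degree `0` on `U(L) ⊗ ⋀ L`. -/
def rightEv : L →ₗ[ℂ] Module.End ℂ (UniversalEnvelopingAlgebra ℂ L ⊗[ℂ] ExteriorAlgebra ℂ L) where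
  toFun x := (LinearMap.mulRight ℂ (UniversalEnvelopingAlgebra.ι ℂ x)).rTensor _
    - (der (LieAlgebra.ad ℂ L x)).lTensor _
  map_add' x y := TensorProduct.ext' fun u a => by
    simp only [map_add, LinearMap.sub_apply, LinearMap.add_apply, LinearMap.rTensor_tmul,
      LinearMap.lTensor_tmul, LinearMap.mulRight_apply, mul_add, TensorProduct.add_tmul,
      (der_linear (LieAlgebra.ad ℂ L x) (LieAlgebra.ad ℂ L y) 0 a).1, TensorProduct.tmul_add]
    abel
  map_smul' c x := TensorProduct.ext' fun u a => by
    simp only [map_smul, LinearMap.sub_apply, LinearMap.smul_apply, LinearMap.rTensor_tmul,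
      LinearMap.lTensor_tmul, LinearMap.mulRight_apply, mul_smul_comm, RingHom.id_apply,
      (der_linear (LieAlgebra.ad ℂ L x) (LieAlgebra.ad ℂ L x) c a).2.1, TensorProduct.tmul_smul,
      TensorProduct.smul_tmul', smul_sub]

/-- The right action of a generator of degree `-1` on `U(L) ⊗ ⋀ L`. -/
def rightOd : L →ₗ[ℂ] Module.End ℂ (UniversalEnvelopingAlgebra ℂ L ⊗[ℂ] ExteriorAlgebra ℂ L) where
  toFun x := (LinearMap.mulRight ℂ (ExteriorAlgebra.ι ℂ x)).lTensor _
  map_add' x y := TensorProduct.ext' fun u a => by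
    simp [mul_add, TensorProduct.tmul_add]
  map_smul' c x := TensorProduct.ext' fun u a => by simp

/-- The formula is forced by straightening in N(L): u·a·x = u·x·a - u·ad(x)(a). -/
theorem rightEv_tmul (x : L) (u : UniversalEnvelopingAlgebra ℂ L) (a : ExteriorAlgebra ℂ L) :
    rightEv x (u ⊗ₜ a) = (u * UniversalEnvelopingAlgebra.ι ℂ x) ⊗ₜ a -
      u ⊗ₜ der (LieAlgebra.ad ℂ L x) a := rfl

theorem rightOd_tmul (x : L) (u : UniversalEnvelopingAlgebra ℂ L) (a : ExteriorAlgebra ℂ L) :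
    rightOd x (u ⊗ₜ a) = u ⊗ₜ (a * ExteriorAlgebra.ι ℂ x) := rfl

theorem ι_lie (x y : L) : UniversalEnvelopingAlgebra.ι ℂ ⁅x, y⁆ =
    UniversalEnvelopingAlgebra.ι ℂ x * UniversalEnvelopingAlgebra.ι ℂ y -
      UniversalEnvelopingAlgebra.ι ℂ y * UniversalEnvelopingAlgebra.ι ℂ x := by
  rw [LieHom.map_lie, LieRing.of_associative_ring_bracket]

/-- The right action of `N(L)` on `U(L) ⊗ ⋀ L`. -/
def rightAct : N L →ₐ[ℂ]
    (Module.End ℂ (UniversalEnvelopingAlgebra ℂ L ⊗[ℂ] ExteriorAlgebra ℂ L))ᵐᵒᵖ :=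
  lift ((MulOpposite.opLinearEquiv ℂ).toLinearMap ∘ₗ rightEv)
    ((MulOpposite.opLinearEquiv ℂ).toLinearMap ∘ₗ rightOd)
    (fun x y => by
      apply MulOpposite.unop_injective
      refine TensorProduct.ext' fun u a => ?_
      -- In the opposite algebra the left factor of a product acts first.
      change rightEv y (rightEv x (u ⊗ₜ a)) = rightEv x (rightEv y (u ⊗ₜ a)) +
        rightEv ⁅x, y⁆ (u ⊗ₜ a)
      simp only [rightEv_tmul, map_sub, LieHom.map_lie (LieAlgebra.ad ℂ L), ι_lie,
        (der_linear (LieAlgebra.ad ℂ L x) (LieAlgebra.ad ℂ L y) 0 a).2.2, mul_sub,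
        TensorProduct.sub_tmul, TensorProduct.tmul_sub, mul_assoc]
      abel)
    (fun x y => by
      apply MulOpposite.unop_injective
      refine TensorProduct.ext' fun u a => ?_
      change rightOd y (rightEv x (u ⊗ₜ a)) = rightEv x (rightOd y (u ⊗ₜ a)) +
        rightOd ⁅x, y⁆ (u ⊗ₜ a)
      simp only [rightEv_tmul, rightOd_tmul, map_sub, der_mul, der_ι, LieAlgebra.ad_apply,
        TensorProduct.tmul_add]
      abel)
    (fun x y => by
      apply MulOpposite.unop_injective
      refine TensorProduct.ext' fun u a => ?_
      change rightOd y (rightOd x (u ⊗ₜ a)) + rightOd x (rightOd y (u ⊗ₜ a)) = 0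
      simp only [rightOd_tmul]
      rw [← TensorProduct.tmul_add, mul_assoc, mul_assoc, ← mul_add,
        ExteriorAlgebra.ι_add_mul_swap, mul_zero, TensorProduct.tmul_zero])

theorem rightAct_od (x : L) : (rightAct (od x)).unop = rightOd x :=
  congrArg MulOpposite.unop (lift_od _ _ _ _ _ x)

theorem rightAct_ev (x : L) : (rightAct (ev x)).unop = rightEv x :=
  congrArg MulOpposite.unop (lift_ev _ _ _ _ _ x)

/-- The inverse of the multiplication map `U(L) ⊗ ⋀ L → N(L)`. -/
def split : N L →ₗ[ℂ] UniversalEnvelopingAlgebra ℂ L ⊗[ℂ] ExteriorAlgebra ℂ L :=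
  LinearMap.applyₗ (1 ⊗ₜ 1) ∘ₗ (MulOpposite.opLinearEquiv ℂ).symm.toLinearMap ∘ₗ
    rightAct.toLinearMap

theorem split_apply (n : N L) : split n = (rightAct n).unop (1 ⊗ₜ 1) := rfl

/-- Left and right multiplications commute; this makes `split` linear over U(L). -/
theorem rightAct_rTensor (n : N L) (u : UniversalEnvelopingAlgebra ℂ L)
    (v : UniversalEnvelopingAlgebra ℂ L ⊗[ℂ] ExteriorAlgebra ℂ L) :
    (rightAct n).unop ((LinearMap.mulLeft ℂ u).rTensor _ v) =
      (LinearMap.mulLeft ℂ u).rTensor _ ((rightAct n).unop v) := by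
  induction n using N.induction generalizing v with
  | one => simp
  | hev x n ih =>
    rw [map_mul, MulOpposite.unop_mul, Module.End.mul_apply, Module.End.mul_apply, ← ih,
      rightAct_ev]
    congr 1
    induction v using TensorProduct.induction_on with
    | zero => simp
    | tmul u' a => simp only [rightEv_tmul, LinearMap.rTensor_tmul, map_sub,
        LinearMap.mulLeft_apply, mul_assoc]
    | add v w hv hw => simp only [map_add, hv, hw]
  | hod x n ih =>
    rw [map_mul, MulOpposite.unop_mul, Module.End.mul_apply, Module.End.mul_apply, ← ih,
      rightAct_od]
    congr 1
    induction v using TensorProduct.induction_on with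
    | zero => simp
    | tmul u' a => simp only [rightOd_tmul, LinearMap.rTensor_tmul]
    | add v w hv hw => simp only [map_add, hv, hw]
  | add m n hm hn =>
    simp only [map_add, MulOpposite.unop_add, LinearMap.add_apply, hm, hn]
  | smul c n hn =>
    simp only [map_smul, MulOpposite.unop_smul, LinearMap.smul_apply, hn]

theorem rightAct_ofΛ (b : ExteriorAlgebra ℂ L) (u : UniversalEnvelopingAlgebra ℂ L)
    (a : ExteriorAlgebra ℂ L) : (rightAct (ofΛ b)).unop (u ⊗ₜ a) = u ⊗ₜ (a * b) := by
  induction b using ExteriorAlgebra.induction generalizing a with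
  | algebraMap r =>
    rw [AlgHom.commutes, AlgHom.commutes, Algebra.algebraMap_eq_smul_one,
      Algebra.algebraMap_eq_smul_one, MulOpposite.unop_smul, LinearMap.smul_apply,
      MulOpposite.unop_one, Module.End.one_apply, mul_smul_comm, mul_one, TensorProduct.tmul_smul]
  | ι y => rw [ofΛ_ι, rightAct_od, rightOd_tmul]
  | mul b c hb hc =>
    rw [map_mul, map_mul, MulOpposite.unop_mul, Module.End.mul_apply, hb, hc, mul_assoc]
  | add b c hb hc =>
    simp only [map_add, MulOpposite.unop_add, LinearMap.add_apply, hb, hc, mul_add,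
      TensorProduct.tmul_add]

theorem split_ofΛ (a : ExteriorAlgebra ℂ L) : split (ofΛ a) = 1 ⊗ₜ a := by
  rw [split_apply, rightAct_ofΛ, one_mul]

/-- The first letter x of a word takes 1 ⊗ 1 to x ⊗ 1, which is also left multiplication by x, and
this commutes with the right action of the rest of the word. -/
theorem split_ofU_mul (u : UniversalEnvelopingAlgebra ℂ L) (n : N L) :
    split (ofU u * n) = (LinearMap.mulLeft ℂ u).rTensor _ (split n) := by
  induction u using U_induction generalizing n with
  | one =>
    have h : LinearMap.mulLeft ℂ (1 : UniversalEnvelopingAlgebra ℂ L) = LinearMap.id :=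
      LinearMap.mulLeft_one ℂ _
    rw [map_one, one_mul, h, LinearMap.rTensor_id, LinearMap.id_apply]
  | hι x u ih =>
    have h : split (ev x) = (LinearMap.mulLeft ℂ (UniversalEnvelopingAlgebra.ι ℂ x)).rTensor _
        ((1 : UniversalEnvelopingAlgebra ℂ L) ⊗ₜ[ℂ] (1 : ExteriorAlgebra ℂ L)) := by
      have h1 : der (LieAlgebra.ad ℂ L x) 1 = 0 := by
        simpa using der_algebraMap (LieAlgebra.ad ℂ L x) 1
      rw [split_apply, rightAct_ev, rightEv_tmul, h1, TensorProduct.tmul_zero, sub_zero, one_mul,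
        LinearMap.rTensor_tmul, LinearMap.mulLeft_apply, mul_one]
    rw [map_mul ofU, ofU_ι, mul_assoc, split_apply, map_mul rightAct, MulOpposite.unop_mul,
      Module.End.mul_apply, ← split_apply, h, rightAct_rTensor, ← split_apply, ih,
      LinearMap.mulLeft_mul, LinearMap.rTensor_comp, LinearMap.comp_apply]
  | add u v hu hv =>
    have h : LinearMap.mulLeft ℂ (u + v) = LinearMap.mulLeft ℂ u + LinearMap.mulLeft ℂ v :=
      map_add (LinearMap.mul ℂ _) u v
    rw [map_add, add_mul, map_add, hu, hv, h, LinearMap.rTensor_add, LinearMap.add_apply]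
  | smul c u hu =>
    have h : LinearMap.mulLeft ℂ (c • u) = c • LinearMap.mulLeft ℂ u :=
      map_smul (LinearMap.mul ℂ _) c u
    rw [map_smul, smul_mul_assoc, map_smul, hu, h, LinearMap.rTensor_smul, LinearMap.smul_apply]

end N

end Straightening

/-! ### Splitting ⋀M along M → Q and a retraction M → L -/

section Contraction

variable {M : Type*} [AddCommGroup M] [Module ℂ M]

/-- The parity automorphism of the exterior algebra. -/
def extPar : ExteriorAlgebra ℂ M →ₐ[ℂ] ExteriorAlgebra ℂ M := ExteriorAlgebra.map (-LinearMap.id)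

@[simp] theorem extPar_ι (m : M) :
    extPar (ExteriorAlgebra.ι ℂ m) = -ExteriorAlgebra.ι ℂ m := by simp [extPar]

theorem map_mem_exteriorPower {M' : Type*} [AddCommGroup M'] [Module ℂ M'] (f : M →ₗ[ℂ] M')
    {p : ℕ} {a : ExteriorAlgebra ℂ M} (ha : a ∈ ⋀[ℂ]^p M) :
    ExteriorAlgebra.map f a ∈ ⋀[ℂ]^p M' := by
  rw [← coe_exteriorPower_map p f ⟨a, ha⟩]
  exact (exteriorPower.map p f ⟨a, ha⟩).2

/-- The projection of the exterior algebra to its component of degree `p`. -/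
def extProj (p : ℕ) : ExteriorAlgebra ℂ M →ₗ[ℂ] ⋀[ℂ]^p M :=
  DirectSum.component ℂ ℕ (fun i => ⋀[ℂ]^i M) p ∘ₗ
    (DirectSum.decomposeLinearEquiv fun i => ⋀[ℂ]^i M).toLinearMap

theorem extProj_same {p : ℕ} (a : ⋀[ℂ]^p M) : extProj p a.1 = a :=
  Subtype.ext (DirectSum.decompose_of_mem_same (fun i => ⋀[ℂ]^i M) a.2)

theorem extProj_ne {p q : ℕ} (h : q ≠ p) {a : ExteriorAlgebra ℂ M} (ha : a ∈ ⋀[ℂ]^q M) :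
    extProj p a = 0 :=
  Subtype.ext (DirectSum.decompose_of_mem_ne (fun i => ⋀[ℂ]^i M) ha h)

variable {L Q : Type*} [LieRing L] [LieAlgebra ℂ L] [AddCommGroup Q] [Module ℂ Q]

/-- The action of `m ∈ M` on `⋀ Q ⊗ N(L)` given by linear maps `q : M → Q` and `r : M → L`. -/
def gradedOd (q : M →ₗ[ℂ] Q) (r : M →ₗ[ℂ] L) :
    M →ₗ[ℂ] Module.End ℂ (ExteriorAlgebra ℂ Q ⊗[ℂ] N L) where
  toFun m := (LinearMap.mulLeft ℂ (ExteriorAlgebra.ι ℂ (q m))).rTensor _ +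
    TensorProduct.map extPar.toLinearMap (LinearMap.mulLeft ℂ (N.od (r m)))
  map_add' x y := TensorProduct.ext' fun a n => by
    simp [add_mul, TensorProduct.add_tmul, TensorProduct.tmul_add]
    abel
  map_smul' c x := TensorProduct.ext' fun a n => by
    simp [TensorProduct.smul_tmul']

theorem gradedOd_tmul (q : M →ₗ[ℂ] Q) (r : M →ₗ[ℂ] L) (m : M) (a : ExteriorAlgebra ℂ Q) (n : N L) :
    gradedOd q r m (a ⊗ₜ n) =
      (ExteriorAlgebra.ι ℂ (q m) * a) ⊗ₜ n + extPar a ⊗ₜ (N.od (r m) * n) := rfl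

/-- The action of `⋀ M` on `⋀ Q ⊗ N(L)` given by linear maps `q : M → Q` and `r : M → L`. -/
def gradedAct (q : M →ₗ[ℂ] Q) (r : M →ₗ[ℂ] L) :
    ExteriorAlgebra ℂ M →ₐ[ℂ] Module.End ℂ (ExteriorAlgebra ℂ Q ⊗[ℂ] N L) :=
  ExteriorAlgebra.lift ℂ ⟨gradedOd q r, fun m => TensorProduct.ext' fun a n => by
    -- The two diagonal terms of the square vanish; the mixed terms cancel because parity
    -- anticommutes with multiplication by a vector.
    rw [Module.End.mul_apply, gradedOd_tmul, map_add, gradedOd_tmul, gradedOd_tmul, ← mul_assoc,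
      ← mul_assoc, ExteriorAlgebra.ι_sq_zero, N.od_mul_self, map_mul, extPar_ι]
    simp [TensorProduct.neg_tmul]⟩

theorem gradedAct_ι (q : M →ₗ[ℂ] Q) (r : M →ₗ[ℂ] L) (m : M) :
    gradedAct q r (ExteriorAlgebra.ι ℂ m) = gradedOd q r m :=
  ExteriorAlgebra.lift_ι_apply ℂ _ _ m

variable (Q L) in
/-- The part of `⋀ Q ⊗ N(L)` of exterior degree less than `p`. -/
def extLT (p : ℕ) : Submodule ℂ (ExteriorAlgebra ℂ Q ⊗[ℂ] N L) :=
  Submodule.span ℂ {z | ∃ (i : ℕ) (a : ExteriorAlgebra ℂ Q) (n : N L), i < p ∧ a ∈ ⋀[ℂ]^i Q ∧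
    z = a ⊗ₜ n}

theorem ι_mul_mem {i : ℕ} (x : Q) {a : ExteriorAlgebra ℂ Q} (ha : a ∈ ⋀[ℂ]^i Q) :
    ExteriorAlgebra.ι ℂ x * a ∈ ⋀[ℂ]^(i + 1) Q := by
  rw [ExteriorAlgebra.exteriorPower, pow_succ']
  exact Submodule.mul_mem_mul ⟨x, rfl⟩ ha

theorem gradedOd_mem (q : M →ₗ[ℂ] Q) (r : M →ₗ[ℂ] L) (m : M) {p : ℕ}
    {z : ExteriorAlgebra ℂ Q ⊗[ℂ] N L} (hz : z ∈ extLT L Q p) :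
    gradedOd q r m z ∈ extLT L Q (p + 1) := by
  induction hz using Submodule.span_induction with
  | mem z hz =>
    obtain ⟨i, a, n, hi, ha, rfl⟩ := hz
    rw [gradedOd_tmul]
    exact add_mem (Submodule.subset_span ⟨i + 1, _, n, by omega, ι_mul_mem _ ha, rfl⟩)
      (Submodule.subset_span ⟨i, _, _, by omega, map_mem_exteriorPower _ ha, rfl⟩)
  | zero => simp
  | add y z _ _ hy hz => rw [map_add]; exact add_mem hy hz
  | smul c z _ hz => rw [map_smul]; exact Submodule.smul_mem _ _ hz

/-- Each of the p factors either raises the exterior degree through q or goes to N(L) through r.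
Exterior degree p is reached only if all of them go through q. -/
theorem gradedAct_sub_mem (q : M →ₗ[ℂ] Q) (r : M →ₗ[ℂ] L) (n : N L) {p : ℕ}
    {a : ExteriorAlgebra ℂ M} (ha : a ∈ ⋀[ℂ]^p M) :
    gradedAct q r a (1 ⊗ₜ n) - ExteriorAlgebra.map q a ⊗ₜ n ∈ extLT L Q p := by
  induction p generalizing a with
  | zero =>
    rw [ExteriorAlgebra.exteriorPower, pow_zero, Submodule.mem_one] at ha
    obtain ⟨c, rfl⟩ := ha
    have : gradedAct q r (algebraMap ℂ _ c) ((1 : ExteriorAlgebra ℂ Q) ⊗ₜ n) -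
        ExteriorAlgebra.map q (algebraMap ℂ _ c) ⊗ₜ n = 0 := by
      rw [AlgHom.commutes, AlgHom.commutes, Algebra.algebraMap_eq_smul_one,
        Algebra.algebraMap_eq_smul_one, ← TensorProduct.smul_tmul']
      exact sub_self _
    rw [this]
    exact zero_mem _
  | succ p ih =>
    rw [ExteriorAlgebra.exteriorPower, pow_succ'] at ha
    induction ha using Submodule.mul_induction_on' with
    | mem_mul_mem x hx a ha =>
      obtain ⟨m, rfl⟩ := hx
      have h1 := gradedOd_mem q r m (ih ha)
      have h2 : extPar (ExteriorAlgebra.map q a) ⊗ₜ (N.od (r m) * n) ∈ extLT L Q (p + 1) :=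
        Submodule.subset_span ⟨p, _, _, by omega,
          map_mem_exteriorPower _ (map_mem_exteriorPower q ha), rfl⟩
      have h3 := add_mem h1 h2
      rw [map_sub, gradedOd_tmul, sub_add_eq_add_sub, add_sub_add_right_eq_sub] at h3
      rwa [map_mul, map_mul, gradedAct_ι, Module.End.mul_apply, ExteriorAlgebra.map_apply_ι]
    | add x _ y _ hx hy =>
      have := add_mem hx hy
      rwa [sub_add_sub_comm, ← TensorProduct.add_tmul, ← LinearMap.add_apply, ← map_add,
        ← map_add] at this

/-- On vectors from L only the r-term is present, and no sign arises because the first factor stays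
equal to 1. -/
theorem gradedAct_map (q : M →ₗ[ℂ] Q) (r : M →ₗ[ℂ] L) (j : L →ₗ[ℂ] M) (hq : ∀ x, q (j x) = 0)
    (hr : ∀ x, r (j x) = x) (b : ExteriorAlgebra ℂ L) (n : N L) :
    gradedAct q r (ExteriorAlgebra.map j b) (1 ⊗ₜ n) = 1 ⊗ₜ (N.ofΛ b * n) := by
  induction b using ExteriorAlgebra.induction generalizing n with
  | algebraMap c =>
    rw [AlgHom.commutes, AlgHom.commutes, AlgHom.commutes, ← Algebra.smul_def,
      TensorProduct.tmul_smul]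
    rfl
  | ι x =>
    rw [ExteriorAlgebra.map_apply_ι, gradedAct_ι, gradedOd_tmul, hq, hr, map_zero, zero_mul,
      TensorProduct.zero_tmul, zero_add, map_one, N.ofΛ_ι]
  | mul a b ha hb => rw [map_mul, map_mul, Module.End.mul_apply, hb, ha, map_mul, mul_assoc]
  | add a b ha hb => simp only [map_add, LinearMap.add_apply, ha, hb, add_mul, TensorProduct.tmul_add]

/-- The component of exterior degree `p` of the action on `1 ⊗ 1`. -/
def gradedComp (p : ℕ) (q : M →ₗ[ℂ] Q) (r : M →ₗ[ℂ] L) :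
    ExteriorAlgebra ℂ M →ₗ[ℂ] ⋀[ℂ]^p Q ⊗[ℂ] N L :=
  (extProj p).rTensor _ ∘ₗ LinearMap.applyₗ (1 ⊗ₜ 1) ∘ₗ (gradedAct q r).toLinearMap

theorem extProj_rTensor_of_mem {p i : ℕ} (h : i ≤ p) {z : ExteriorAlgebra ℂ Q ⊗[ℂ] N L}
    (hz : z ∈ extLT L Q i) : (extProj p).rTensor (N L) z = 0 := by
  induction hz using Submodule.span_induction with
  | mem z hz =>
    obtain ⟨k, a, n, hk, ha, rfl⟩ := hz
    rw [LinearMap.rTensor_tmul, extProj_ne (by omega) ha, TensorProduct.zero_tmul]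
  | zero => simp
  | add y z _ _ hy hz => rw [map_add, hy, hz, add_zero]
  | smul c z _ hz => rw [map_smul, hz, smul_zero]

/-- The right factor acts first and gives 1 ⊗ b; then a contributes its image under q and terms of
exterior degree below i ≤ p, which the projection kills. For i < p the right-hand side is zero too.
-/
theorem gradedComp_mul (q : M →ₗ[ℂ] Q) (r : M →ₗ[ℂ] L) (j : L →ₗ[ℂ] M) (hq : ∀ x, q (j x) = 0)
    (hr : ∀ x, r (j x) = x) {p i : ℕ} (h : i ≤ p) {a : ExteriorAlgebra ℂ M} (ha : a ∈ ⋀[ℂ]^i M)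
    (b : ExteriorAlgebra ℂ L) : gradedComp p q r (a * ExteriorAlgebra.map j b) =
      extProj p (ExteriorAlgebra.map q a) ⊗ₜ N.ofΛ b := by
  have h1 := extProj_rTensor_of_mem h (gradedAct_sub_mem q r (N.ofΛ b) ha)
  rw [map_sub, sub_eq_zero, LinearMap.rTensor_tmul] at h1
  rw [← h1]
  change (extProj p).rTensor (N L) (gradedAct q r (a * ExteriorAlgebra.map j b) (1 ⊗ₜ 1)) = _
  rw [map_mul, Module.End.mul_apply, gradedAct_map q r j hq hr, mul_one]

end Contraction

namespace LiePair

/-! ### The comparison map and its bijectivity -/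

section Comparison

variable {G K T : Type*} [Group G] [LieRing K] [LieAlgebra ℂ K] [LieRing T] [LieAlgebra ℂ T]
variable (P : LiePair G K T)

/-- The quotient `K / T`. -/
abbrev Quo : Type _ := K ⧸ LinearMap.range (P.j : T →ₗ[ℂ] K)

/-- The quotient map `K → K / T`. -/
abbrev quo : K →ₗ[ℂ] P.Quo := (LinearMap.range (P.j : T →ₗ[ℂ] K)).mkQ

/-- A linear section of `K → K / T`. -/
def sec : P.Quo →ₗ[ℂ] K := (P.quo.exists_rightInverse_of_surjective (Submodule.range_mkQ _)).choose

theorem quo_comp_sec : P.quo ∘ₗ P.sec = LinearMap.id :=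
  (P.quo.exists_rightInverse_of_surjective (Submodule.range_mkQ _)).choose_spec

theorem quo_sec (z : P.Quo) : P.quo (P.sec z) = z := LinearMap.congr_fun P.quo_comp_sec z

theorem quo_j (x : T) : P.quo (P.j x) = 0 :=
  (Submodule.Quotient.mk_eq_zero _).2 ⟨x, rfl⟩

theorem map_quo_map_sec (a : ExteriorAlgebra ℂ P.Quo) :
    ExteriorAlgebra.map P.quo (ExteriorAlgebra.map P.sec a) = a := by
  rw [← AlgHom.comp_apply, ExteriorAlgebra.map_comp_map, quo_comp_sec, ExteriorAlgebra.map_id,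
    AlgHom.id_apply]

/-- Modulo the previous step of the filtration, an element of `⋀^p K` depends only on its image in
`⋀^p (K / T)`. -/
theorem ofΛ_sub_mem_F {p : ℕ} {a : ExteriorAlgebra ℂ K} (ha : a ∈ ⋀[ℂ]^p K) :
    N.ofΛ a - N.ofΛ (ExteriorAlgebra.map P.sec (ExteriorAlgebra.map P.quo a)) ∈
      P.F ((p : ℤ) - 1) := by
  induction p generalizing a with
  | zero =>
    rw [ExteriorAlgebra.exteriorPower, pow_zero, Submodule.mem_one] at ha
    obtain ⟨c, rfl⟩ := ha
    simp
  | succ p ih =>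
    rw [ExteriorAlgebra.exteriorPower, pow_succ'] at ha
    induction ha using Submodule.mul_induction_on' with
    | mem_mul_mem x hx a ha =>
      obtain ⟨ξ, rfl⟩ := hx
      have hξ : ξ - P.sec (P.quo ξ) ∈ LinearMap.range (P.j : T →ₗ[ℂ] K) := by
        have h : P.quo (ξ - P.sec (P.quo ξ)) = 0 := by rw [map_sub, P.quo_sec, sub_self]
        exact (Submodule.Quotient.mk_eq_zero _).1 h
      obtain ⟨τ, hτ⟩ := hξ
      have hτ' : ξ = P.j τ + P.sec (P.quo ξ) := sub_eq_iff_eq_add.1 hτ.symm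
      -- Write ξ as an element of T plus the chosen lift of its class. The first part is moved to
      -- the right end of the product, at the price of the parity of a; the second is left to the
      -- induction.
      have e : N.ofΛ (ExteriorAlgebra.ι ℂ ξ * a) - N.ofΛ (ExteriorAlgebra.map P.sec
          (ExteriorAlgebra.map P.quo (ExteriorAlgebra.ι ℂ ξ * a))) =
          N.par (N.ofΛ a) * N.map P.j (N.od τ) + N.od (P.sec (P.quo ξ)) * (N.ofΛ a -
            N.ofΛ (ExteriorAlgebra.map P.sec (ExteriorAlgebra.map P.quo a))) := by
        rw [N.map_od, ← N.od_mul_ofΛ, map_mul, map_mul, map_mul, map_mul, N.ofΛ_ι,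
          ExteriorAlgebra.map_apply_ι, ExteriorAlgebra.map_apply_ι, N.ofΛ_ι]
        conv_lhs => rw [hτ', map_add]
        rw [← hτ']
        noncomm_ring
      rw [e]
      refine add_mem (mul_map_mem_F ?_ _) ?_
      · rw [N.par_ofΛ ha]
        exact Submodule.smul_mem _ _ (ofΛ_mem_F (by push_cast; linarith) ha)
      · have := od_mul_mem_F (P.sec (P.quo ξ)) (ih ha)
        rwa [show (p : ℤ) - 1 + 1 = ((p + 1 : ℕ) : ℤ) - 1 by push_cast; ring] at this
    | add x _ y _ hx hy =>
      have := add_mem hx hy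
      rwa [sub_add_sub_comm, ← map_add, ← map_add, ← map_add, ← map_add] at this

theorem monomial_mul_mem_F {p : ℕ} (u : UniversalEnvelopingAlgebra ℂ K) {a : ExteriorAlgebra ℂ K}
    (ha : a ∈ ⋀[ℂ]^p K) (e : N T) : N.ofU u * N.ofΛ a * N.map P.j e ∈ P.F p :=
  mul_map_mem_F (ofU_mul_mem_F u (ofΛ_mem_F le_rfl ha)) e

/-- The weak module `ind ⋀^p (K / T)`. -/
abbrev indExt (p : ℕ) : P.WeakModule := P.ind (P.extPow p)

/-- The element `u ⊗ λ` of `U(K) ⊗ ⋀^p (K / T)`. -/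
def pureInd (p : ℕ) (u : UniversalEnvelopingAlgebra ℂ K) (b : ⋀[ℂ]^p P.Quo) : (P.indExt p).V :=
  (u ⊗ₜ b : UniversalEnvelopingAlgebra ℂ K ⊗[ℂ] ⋀[ℂ]^p P.Quo)

theorem pureInd_induction {p : ℕ} {r : (P.indExt p).V → Prop} (pure : ∀ u b, r (P.pureInd p u b))
    (add : ∀ v w, r v → r w → r (v + w)) (v : (P.indExt p).V) : r v := by
  refine TensorProduct.induction_on (motive := r) v ?_ pure add
  have := pure 0 0
  rwa [pureInd, TensorProduct.zero_tmul] at this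

theorem indExt_ω (p : ℕ) (x : T) (u : UniversalEnvelopingAlgebra ℂ K) (b : ⋀[ℂ]^p P.Quo) :
    (P.indExt p).ω x (P.pureInd p u b) = P.pureInd p u (extDer p (P.lieQuot x) b) -
      P.pureInd p (u * UniversalEnvelopingAlgebra.ι ℂ (P.j x)) b :=
  P.ωInd_tmul (P.extPow p) x u b

theorem indExt_π (p : ℕ) (u u' : UniversalEnvelopingAlgebra ℂ K) (b : ⋀[ℂ]^p P.Quo) :
    (P.indExt p).π u (P.pureInd p u' b) = P.pureInd p (u * u') b := rfl

theorem indExt_ν (p : ℕ) (g : G) (u : UniversalEnvelopingAlgebra ℂ K) (b : ⋀[ℂ]^p P.Quo) :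
    (P.indExt p).ν g (P.pureInd p u b) =
      P.pureInd p (Umap (P.adK g) u) (exteriorPower.map p (P.adQuot g) b) := rfl

/-- The map `u ⊗ λ ↦ u · s(λ)`, where `s` is the chosen section. -/
def indToN (p : ℕ) : (P.indExt p).V →ₗ[ℂ] N K :=
  (TensorProduct.lift ((LinearMap.mul ℂ (N K)).compl₁₂ (N.ofU (L := K)).toLinearMap
    ((N.ofΛ (L := K)).toLinearMap ∘ₗ (ExteriorAlgebra.map P.sec).toLinearMap ∘ₗ
      (⋀[ℂ]^p P.Quo).subtype)) : UniversalEnvelopingAlgebra ℂ K ⊗[ℂ] ⋀[ℂ]^p P.Quo →ₗ[ℂ] N K)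

theorem indToN_pureInd (p : ℕ) (u : UniversalEnvelopingAlgebra ℂ K) (b : ⋀[ℂ]^p P.Quo) :
    P.indToN p (P.pureInd p u b) = N.ofU u * N.ofΛ (ExteriorAlgebra.map P.sec b.1) := rfl

theorem indToN_mem_F (p : ℕ) (w : (P.indExt p).V) : P.indToN p w ∈ P.F p := by
  induction w using P.pureInd_induction with
  | pure u b =>
    rw [indToN_pureInd]
    exact ofU_mul_mem_F u (ofΛ_mem_F le_rfl (map_mem_exteriorPower _ b.2))
  | add v w hv hw => rw [map_add]; exact add_mem hv hw

/-- The map `w ⊗ e ↦ w e` to `N(K)`. -/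
def tensorToN (p : ℕ) : (P.indExt p).V ⊗[ℂ] N T →ₗ[ℂ] N K :=
  TensorProduct.lift ((LinearMap.mul ℂ (N K)).compl₁₂ (P.indToN p) (N.map P.j).toLinearMap)

theorem tensorToN_tmul (p : ℕ) (w : (P.indExt p).V) (e : N T) :
    P.tensorToN p (w ⊗ₜ e) = P.indToN p w * N.map P.j e := rfl

theorem tensorToN_mem_F (p : ℕ) (z : (P.indExt p).V ⊗[ℂ] N T) : P.tensorToN p z ∈ P.F p := by
  induction z using TensorProduct.induction_on with
  | zero => simp
  | tmul w e => exact mul_map_mem_F (P.indToN_mem_F p w) e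
  | add v w hv hw => rw [map_add]; exact add_mem hv hw

/-- Modulo F_{p-1}, right multiplication by x in N(K) is the right action w·x = -ω(x)w. The
commutator term involves ad(x) of the lift of λ, while ω involves the lift of ad(x)λ; both have the
same image in ⋀^p(K/T). -/
theorem indToN_ω_mem_F (p : ℕ) (x : T) (w : (P.indExt p).V) :
    P.indToN p ((P.indExt p).ω x w) + P.indToN p w * N.ev (P.j x) ∈ P.F ((p : ℤ) - 1) := by
  induction w using P.pureInd_induction with
  | pure u b =>
    rw [indExt_ω, map_sub, indToN_pureInd, indToN_pureInd, indToN_pureInd]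
    set c := ExteriorAlgebra.map P.sec b.1
    have hc : der (LieAlgebra.ad ℂ K (P.j x)) c ∈ ⋀[ℂ]^p K :=
      der_mem _ p _ (map_mem_exteriorPower _ b.2)
    have h1 := P.ofΛ_sub_mem_F hc
    rw [map_der P.quo _ (P.lieQuot x) (fun m => rfl), P.map_quo_map_sec] at h1
    have h2 := N.ev_mul_ofΛ (P.j x) c
    have e : N.ofU u * N.ofΛ (ExteriorAlgebra.map P.sec (extDer p (P.lieQuot x) b).1) -
        N.ofU (u * UniversalEnvelopingAlgebra.ι ℂ (P.j x)) * N.ofΛ c +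
          N.ofU u * N.ofΛ c * N.ev (P.j x) =
        -(N.ofU u * (N.ofΛ (der (LieAlgebra.ad ℂ K (P.j x)) c) -
          N.ofΛ (ExteriorAlgebra.map P.sec (der (P.lieQuot x) b.1)))) := by
      rw [map_mul, N.ofU_ι, mul_assoc (N.ofU u), h2]
      change N.ofU u * N.ofΛ (ExteriorAlgebra.map P.sec (der (P.lieQuot x) b.1)) - _ + _ = _
      noncomm_ring
    rw [e]
    exact neg_mem (ofU_mul_mem_F u h1)
  | add v w hv hw =>
    rw [map_add, map_add, map_add, add_mul, add_add_add_comm]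
    exact add_mem hv hw

/-- Letter by letter, this extends the previous congruence from T to U(T) and shows that the map is
balanced over U(T) modulo F_{p-1}. -/
theorem tensorToN_rU_sub_mem_F (p : ℕ) (w : (P.indExt p).V) (x : UniversalEnvelopingAlgebra ℂ T)
    (e : N T) : P.tensorToN p ((P.indExt p).rU x w ⊗ₜ e - w ⊗ₜ (N.ofU x * e)) ∈
      P.F ((p : ℤ) - 1) := by
  rw [map_sub, tensorToN_tmul, tensorToN_tmul]
  induction x using U_induction generalizing w with
  | one => simp [WeakModule.rU]
  | hι x n ih =>
    have h1 := ih ((P.indExt p).ω x w)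
    have h2 := mul_map_mem_F (P.indToN_ω_mem_F p x w) (N.ofU n * e)
    rw [WeakModule.rU_ι_mul, map_neg, map_mul N.ofU, N.ofU_ι, mul_assoc, map_mul (N.map P.j) (N.ev x),
      N.map_ev, ← mul_assoc]
    rw [add_mul] at h2
    have := neg_mem (add_mem h1 h2)
    convert this using 1
    noncomm_ring
  | add m n hm hn =>
    have h1 : (P.indExt p).rU (m + n) w = (P.indExt p).rU m w + (P.indExt p).rU n w := by
      simp only [WeakModule.rU, map_add, MulOpposite.unop_add, LinearMap.add_apply]
    rw [h1, map_add, map_add, add_mul, add_mul, map_add, mul_add, add_sub_add_comm]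
    exact add_mem (hm w) (hn w)
  | smul c n hn =>
    have h1 : (P.indExt p).rU (c • n) w = c • (P.indExt p).rU n w := by
      simp only [WeakModule.rU, map_smul, MulOpposite.unop_smul, LinearMap.smul_apply]
    rw [h1, map_smul, map_smul, smul_mul_assoc, smul_mul_assoc, map_smul, mul_smul_comm, ← smul_sub]
    exact Submodule.smul_mem _ _ (hn w)

theorem tensorToN_mem_F_of_mem_Z (p : ℕ) {z : (P.indExt p).V ⊗[ℂ] N T} (hz : z ∈ (P.indExt p).Z) :
    P.tensorToN p z ∈ P.F ((p : ℤ) - 1) := by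
  induction hz using Submodule.span_induction with
  | mem z hz => obtain ⟨w, x, e, rfl⟩ := hz; exact P.tensorToN_rU_sub_mem_F p w x e
  | zero => simp
  | add y z _ _ hy hz => rw [map_add]; exact add_mem hy hz
  | smul c z _ hz => rw [map_smul]; exact Submodule.smul_mem _ _ hz

/-- The comparison map `C_T(ind ⋀^p (K / T)[p]) → Gr_p N(K)`. -/
def comparison (p : ℕ) : ((P.indExt p).C p).V →ₗ[ℂ] (P.Gr p).V :=
  ((P.indExt p).Z.liftQ (P.cls p ∘ₗ (P.tensorToN p).codRestrict (P.F p) (P.tensorToN_mem_F p))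
    (fun z hz => by
      have h := (P.cls_eq_iff ⟨P.tensorToN p z, P.tensorToN_mem_F p z⟩ 0).2 (by
        simpa using P.tensorToN_mem_F_of_mem_Z p hz)
      rw [map_zero] at h
      exact h) : ((P.indExt p).V ⊗[ℂ] N T) ⧸ (P.indExt p).Z →ₗ[ℂ] (P.Gr p).V)

theorem comparison_mk (p : ℕ) (z : (P.indExt p).V ⊗[ℂ] N T) :
    P.comparison p ((P.indExt p).Z.mkQ z) = P.cls p ⟨P.tensorToN p z, P.tensorToN_mem_F p z⟩ := rfl

/-- Any lift a of the element of ⋀^p(K/T) may be used, not only the one given by the section, which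
is not equivariant. Compatibility with all the structures is checked through this formula. -/
theorem comparison_tm (p : ℕ) (u : UniversalEnvelopingAlgebra ℂ K) (a : ⋀[ℂ]^p K) (e : N T) :
    P.comparison p ((P.indExt p).tm (P.pureInd p u (exteriorPower.map p P.quo a)) e) =
      P.cls p ⟨N.ofU u * N.ofΛ a.1 * N.map P.j e, P.monomial_mul_mem_F u a.2 e⟩ := by
  refine (P.comparison_mk p _).trans ((P.cls_eq_iff _ _).2 ?_)
  change P.tensorToN p (_ ⊗ₜ e) - _ ∈ _
  rw [tensorToN_tmul, indToN_pureInd, coe_exteriorPower_map, ← sub_mul, ← mul_sub,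
    ← neg_sub (N.ofΛ a.1), mul_neg, neg_mul]
  exact neg_mem (mul_map_mem_F (ofU_mul_mem_F u (P.ofΛ_sub_mem_F a.2)) e)

theorem exteriorPower_map_quo_surjective (p : ℕ) :
    Function.Surjective (exteriorPower.map p P.quo) := fun b =>
  ⟨⟨ExteriorAlgebra.map P.sec b.1, map_mem_exteriorPower _ b.2⟩, Subtype.ext (by
    rw [coe_exteriorPower_map, P.map_quo_map_sec])⟩

/-- Induction on the elements `(u ⊗ λ) ⊗ e` of `C_T(ind ⋀^p (K / T)[p])`, with `λ` the image of an
element of `⋀^p K`. -/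
theorem C_induction {p : ℕ} {r : ((P.indExt p).C p).V → Prop}
    (tm : ∀ u (a : ⋀[ℂ]^p K) e,
      r ((P.indExt p).tm (P.pureInd p u (exteriorPower.map p P.quo a)) e))
    (add : ∀ v w, r v → r w → r (v + w)) (v : ((P.indExt p).C p).V) : r v := by
  obtain ⟨z, rfl⟩ := (P.indExt p).Z.mkQ_surjective v
  have hadd : ∀ y z, r ((P.indExt p).Z.mkQ y) → r ((P.indExt p).Z.mkQ z) →
      r ((P.indExt p).Z.mkQ (y + z)) := fun y z hy hz => by
    rw [map_add]; exact add _ _ hy hz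
  induction z using TensorProduct.induction_on with
  | zero =>
    have := tm 0 0 0
    rwa [WeakModule.tm, TensorProduct.tmul_zero] at this
  | tmul w e =>
    induction w using P.pureInd_induction with
    | pure u b =>
      obtain ⟨a, rfl⟩ := P.exteriorPower_map_quo_surjective p b
      exact tm u a e
    | add v w hv hw => rw [TensorProduct.add_tmul]; exact hadd _ _ hv hw
  | add y z hy hz => exact hadd _ _ hy hz

/-- Among the monomials that span F_p, those with fewer than p factors in ⋀K vanish in Gr_p and
those with exactly p are values of the map. -/
theorem comparison_surjective (p : ℕ) : Function.Surjective (P.comparison p) := by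
  intro v
  obtain ⟨⟨v, hv⟩, rfl⟩ := P.cls_surjective p v
  suffices h : ∃ (hv : v ∈ P.F p) (z : _), P.comparison p z = P.cls p ⟨v, hv⟩ from
    ⟨h.2.choose, h.2.choose_spec⟩
  refine F_monomial_induction (r := fun v => ∃ (hv : v ∈ P.F p) (z : _),
    P.comparison p z = P.cls p ⟨v, hv⟩) ?_ ?_ ?_ hv
  · intro q u a b hq ha
    rcases hq.lt_or_eq with h | h
    · have h1 : N.ofU u * N.ofΛ a * N.map P.j (N.ofΛ b) ∈ P.F ((p : ℤ) - 1) :=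
        F_mono (by omega) (P.monomial_mul_mem_F u ha _)
      refine ⟨F_mono hq (P.monomial_mul_mem_F u ha _), 0, ?_⟩
      rw [map_zero, ← map_zero (P.cls p), eq_comm, P.cls_eq_iff]
      simpa using h1
    · obtain rfl : q = p := by exact_mod_cast h
      exact ⟨_, _, P.comparison_tm q u ⟨a, ha⟩ (N.ofΛ b)⟩
  · exact ⟨zero_mem _, 0, by rw [map_zero]; exact (map_zero (P.cls p)).symm⟩
  · rintro v w ⟨hv, y, hy⟩ ⟨hw, z, hz⟩
    exact ⟨add_mem hv hw, y + z, by rw [map_add, hy, hz, ← map_add]; rfl⟩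

/-- A left inverse of the comparison map on `F_p N(K)`, given by a linear retraction `K → T`. -/
def retract (p : ℕ) (ρ : K →ₗ[ℂ] T) : N K →ₗ[ℂ] ((P.indExt p).C p).V :=
  ((P.indExt p).Z.mkQ ∘ₗ
    (TensorProduct.assoc ℂ (UniversalEnvelopingAlgebra ℂ K) (⋀[ℂ]^p P.Quo) (N T)).symm.toLinearMap ∘ₗ
    (gradedComp p P.quo ρ).lTensor (UniversalEnvelopingAlgebra ℂ K) ∘ₗ N.split :
    N K →ₗ[ℂ] ((P.indExt p).V ⊗[ℂ] N T) ⧸ (P.indExt p).Z)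

/-- The factor from ⋀T is merged into ⋀K for `split` and separated again by the contraction. Factors
from U(T) are excluded, since they would first have to be straightened. -/
theorem retract_monomial {ρ : K →ₗ[ℂ] T} (hρ : ∀ x, ρ (P.j x) = x) {p i : ℕ} (h : i ≤ p)
    (u : UniversalEnvelopingAlgebra ℂ K) {a : ExteriorAlgebra ℂ K} (ha : a ∈ ⋀[ℂ]^i K)
    (b : ExteriorAlgebra ℂ T) :
    P.retract p ρ (N.ofU u * N.ofΛ a * N.map P.j (N.ofΛ b)) =
      (P.indExt p).tm (P.pureInd p u (extProj p (ExteriorAlgebra.map P.quo a))) (N.ofΛ b) := by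
  have h1 : N.split (N.ofU u * N.ofΛ a * N.map P.j (N.ofΛ b)) =
      u ⊗ₜ (a * ExteriorAlgebra.map (P.j : T →ₗ[ℂ] K) b) := by
    rw [N.map_ofΛ, mul_assoc, ← map_mul, N.split_ofU_mul, N.split_ofΛ, LinearMap.rTensor_tmul,
      LinearMap.mulLeft_apply, mul_one]
  have h2 := gradedComp_mul P.quo ρ (P.j : T →ₗ[ℂ] K) P.quo_j hρ h ha b
  change (P.indExt p).Z.mkQ ((TensorProduct.assoc ℂ _ _ _).symm
    ((gradedComp p P.quo ρ).lTensor (UniversalEnvelopingAlgebra ℂ K) (N.split _))) = _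
  rw [h1, LinearMap.lTensor_tmul, h2]
  rfl

theorem retract_eq_zero {ρ : K →ₗ[ℂ] T} (hρ : ∀ x, ρ (P.j x) = x) {p : ℕ} {v : N K}
    (hv : v ∈ P.F ((p : ℤ) - 1)) : P.retract p ρ v = 0 := by
  refine F_monomial_induction (r := fun v => P.retract p ρ v = 0) ?_ (map_zero _) ?_ hv
  · intro q u a b hq ha
    rw [P.retract_monomial hρ (by omega) u ha,
      extProj_ne (by omega : q ≠ p) (map_mem_exteriorPower _ ha)]
    have : P.pureInd p u 0 = 0 := TensorProduct.tmul_zero _ _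
    rw [this, WeakModule.tm, TensorProduct.zero_tmul]
    rfl
  · intro v w hv hw
    rw [map_add, hv, hw, add_zero]

/-- For e in ⋀T this is the monomial formula. For e = x·b with x in U(T), the tensors w ⊗ xb and wx
⊗ b have the same class, and their images in N(K) differ by an element of F_{p-1}, which the
retraction kills. -/
theorem retract_tensorToN {ρ : K →ₗ[ℂ] T} (hρ : ∀ x, ρ (P.j x) = x) (p : ℕ)
    (z : (P.indExt p).V ⊗[ℂ] N T) :
    P.retract p ρ (P.tensorToN p z) = (P.indExt p).Z.mkQ z := by
  have hΛ : ∀ w b, P.retract p ρ (P.tensorToN p (w ⊗ₜ N.ofΛ b)) = (P.indExt p).tm w (N.ofΛ b) := by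
    intro w b
    induction w using P.pureInd_induction with
    | pure u c =>
      rw [tensorToN_tmul, indToN_pureInd,
        P.retract_monomial hρ le_rfl u (map_mem_exteriorPower _ c.2), P.map_quo_map_sec,
        extProj_same]
    | add v w hv hw =>
      rw [TensorProduct.add_tmul, map_add, map_add, hv, hw, WeakModule.tm, WeakModule.tm,
        WeakModule.tm, TensorProduct.add_tmul]
      rfl
  induction z using TensorProduct.induction_on with
  | zero => rw [map_zero, map_zero]; rfl
  | tmul w e =>
    induction e using N.ofU_ofΛ_induction with
    | mul x b =>
      have h := P.retract_eq_zero hρ (P.tensorToN_rU_sub_mem_F p w x (N.ofΛ b))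
      rw [map_sub, map_sub, sub_eq_zero, hΛ, WeakModule.tm_rU] at h
      exact h.symm
    | add m n hm hn =>
      rw [TensorProduct.tmul_add, map_add, map_add, hm, hn]
      exact (map_add (P.indExt p).Z.mkQ _ _).symm
  | add y z hy hz =>
    rw [map_add, map_add, hy, hz]
    exact (map_add (P.indExt p).Z.mkQ _ _).symm

/-- Injectivity of T → K provides the linear retraction K → T on which `retract` depends. -/
theorem comparison_injective (hj : Function.Injective P.j) (p : ℕ) :
    Function.Injective (P.comparison p) := by
  obtain ⟨ρ, hρ⟩ := (P.j : T →ₗ[ℂ] K).exists_leftInverse_of_injective (LinearMap.ker_eq_bot.2 hj)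
  rw [injective_iff_map_eq_zero]
  intro v hv
  obtain ⟨z, rfl⟩ := (P.indExt p).Z.mkQ_surjective v
  rw [comparison_mk, ← map_zero (P.cls p), P.cls_eq_iff] at hv
  have h := P.retract_eq_zero (fun x => LinearMap.congr_fun hρ x) (v := P.tensorToN p z)
    (by simpa using hv)
  rwa [P.retract_tensorToN (fun x => LinearMap.congr_fun hρ x)] at h

end Comparison

end LiePair

namespace LiePair

/-! ### Compatibility with differentials, actions and gradings -/

section Iso

variable {G K T : Type*} [Group G] [LieRing K] [LieAlgebra ℂ K] [LieRing T] [LieAlgebra ℂ T]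
variable (P : LiePair G K T)

/-- In d(u·a·e) the term with da lies in F_{p-1}, because da has degree -p + 1. What remains is
u·a·de with the sign (-1)^p from moving d past a. -/
theorem comparison_d (p : ℕ) (v : ((P.indExt p).C p).V) :
    P.comparison p (((P.indExt p).C p).d v) = (P.Gr p).d (P.comparison p v) := by
  induction v using P.C_induction with
  | tm u a e =>
    rw [WeakModule.C_d]
    refine (map_smul (P.comparison p) _ _).trans ?_
    rw [comparison_tm, comparison_tm, ← map_smul]
    refine (P.cls_eq_iff _ ⟨N.d (N.ofU u * N.ofΛ a.1 * N.map P.j e),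
      (P.stable_F p).d _ (P.monomial_mul_mem_F u a.2 e)⟩).2 ?_
    have h : N.d (N.ofΛ a.1) ∈ P.F ((p : ℤ) - 1) := by
      have h1 := N.d_mem_gr (N.ofΛ_mem_gr a.2)
      -- For p = 0 the element da has degree 1 and is zero.
      rcases Nat.eq_zero_or_pos p with rfl | hp
      · rw [N.eq_zero_of_mem_gr (by norm_num) h1]
        exact zero_mem _
      · refine P.mem_F (i := p - 1) (by omega) ?_
        rwa [show -((p - 1 : ℕ) : ℤ) = -(p : ℤ) + 1 by omega]
    have e1 : ((-1 : ℂ) ^ p) • (N.ofU u * N.ofΛ a.1 * N.map P.j (N.d e)) -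
        N.d (N.ofU u * N.ofΛ a.1 * N.map P.j e) = -(N.ofU u * N.d (N.ofΛ a.1) * N.map P.j e) := by
      simp only [mul_assoc]
      rw [N.d_ofU_mul, N.d_mul, N.par_ofΛ a.2, N.d_map, mul_add, smul_mul_assoc, mul_smul_comm]
      abel
    change ((-1 : ℂ) ^ p) • (N.ofU u * N.ofΛ a.1 * N.map P.j (N.d e)) -
        N.d (N.ofU u * N.ofΛ a.1 * N.map P.j e) ∈ _
    rw [e1]
    exact neg_mem (mul_map_mem_F (ofU_mul_mem_F u h) e)
  | add v w hv hw => simp only [map_add, hv, hw]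

theorem comparison_π (p : ℕ) (u : UniversalEnvelopingAlgebra ℂ K) (v : ((P.indExt p).C p).V) :
    P.comparison p (((P.indExt p).C p).π u v) = (P.Gr p).π u (P.comparison p v) := by
  induction v using P.C_induction with
  | tm u' a e =>
    rw [WeakModule.C_π, indExt_π, comparison_tm, comparison_tm]
    refine congrArg (P.cls p) (Subtype.ext ?_)
    change N.ofU (u * u') * N.ofΛ a.1 * N.map P.j e =
      N.ofU u * (N.ofU u' * N.ofΛ a.1 * N.map P.j e)
    simp only [map_mul, mul_assoc]
  | add v w hv hw => simp only [map_add, hv, hw]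

theorem exteriorPower_map_adQuot (p : ℕ) (g : G) (a : ⋀[ℂ]^p K) :
    exteriorPower.map p (P.adQuot g) (exteriorPower.map p P.quo a) =
      exteriorPower.map p P.quo (exteriorPower.map p (P.adK g : K →ₗ[ℂ] K) a) := by
  rw [← LinearMap.comp_apply, ← LinearMap.comp_apply, ← exteriorPower.map_comp,
    ← exteriorPower.map_comp]
  rfl

theorem comparison_ν (p : ℕ) (g : G) (v : ((P.indExt p).C p).V) :
    P.comparison p (((P.indExt p).C p).ν g v) = (P.Gr p).ν g (P.comparison p v) := by
  induction v using P.C_induction with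
  | tm u a e =>
    rw [WeakModule.C_ν, indExt_ν, exteriorPower_map_adQuot, comparison_tm, comparison_tm]
    refine congrArg (P.cls p) (Subtype.ext ?_)
    change N.ofU (Umap (P.adK g) u) * N.ofΛ (exteriorPower.map p (P.adK g : K →ₗ[ℂ] K) a).1 *
      N.map P.j (N.map (P.adT g) e) =
        N.map (P.adK g) (N.ofU u * N.ofΛ a.1 * N.map P.j e)
    rw [map_mul, map_mul, P.map_j_ad, N.map_ofU, N.map_ofΛ, coe_exteriorPower_map]
  | add v w hv hw => simp only [map_add, hv, hw]

theorem C_ω_ev (p : ℕ) (x : T) (v : (P.indExt p).V) (e : N T) :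
    ((P.indExt p).C p).ω (N.ev x) ((P.indExt p).tm v e) = -(P.indExt p).tm v (e * N.ev x) :=
  LinearMap.congr_fun (twist_ev (P.indExt p).rC (P.indExt p).rC_mul ((P.indExt p).sgnC p)
    ((P.indExt p).sgnC_mul_self p) ((P.indExt p).sgnC_rC p) x) ((P.indExt p).tm v e)

theorem C_ω_od (p : ℕ) (x : T) (v : (P.indExt p).V) (e : N T) :
    ((P.indExt p).C p).ω (N.od x) ((P.indExt p).tm v e) =
      -(((-1 : ℂ) ^ p) • (P.indExt p).tm v (N.par e * N.od x)) :=
  (LinearMap.congr_fun (twist_od (P.indExt p).rC (P.indExt p).rC_mul ((P.indExt p).sgnC p)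
    ((P.indExt p).sgnC_mul_self p) ((P.indExt p).sgnC_rC p) x) ((P.indExt p).tm v e)).trans (by
    rw [LinearMap.neg_apply, Module.End.mul_apply, WeakModule.sgnC_tm, map_smul, WeakModule.rC_tm])

/-- It suffices to treat generators. For those of degree -1, the parity of u·a·e is (-1)^p times
that of e, which is the sign of the shift by p in `sgnC`. -/
theorem comparison_ω (p : ℕ) (m : N T) (v : ((P.indExt p).C p).V) :
    P.comparison p (((P.indExt p).C p).ω m v) = (P.Gr p).ω m (P.comparison p v) := by
  induction m using N.induction generalizing v with
  | one => simp
  | hev x m ih =>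
    rw [map_mul, map_mul, Module.End.mul_apply, Module.End.mul_apply, ← ih]
    generalize ((P.indExt p).C p).ω m v = w
    induction w using P.C_induction with
    | tm u a e =>
      rw [C_ω_ev]
      refine (map_neg (P.comparison p) _).trans ?_
      rw [comparison_tm, comparison_tm, ← map_neg]
      refine congrArg (P.cls p) (Subtype.ext ?_)
      change -(N.ofU u * N.ofΛ a.1 * N.map P.j (e * N.ev x)) =
        P.ωN (N.ev x) (N.ofU u * N.ofΛ a.1 * N.map P.j e)
      rw [ωN_ev, map_mul, N.map_ev, mul_assoc _ (N.map P.j e)]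
    | add v w hv hw => simp only [map_add, hv, hw]
  | hod x m ih =>
    rw [map_mul, map_mul, Module.End.mul_apply, Module.End.mul_apply, ← ih]
    generalize ((P.indExt p).C p).ω m v = w
    induction w using P.C_induction with
    | tm u a e =>
      rw [C_ω_od]
      refine (map_neg (P.comparison p) _).trans ?_
      refine (congrArg Neg.neg (map_smul (P.comparison p) _ _)).trans ?_
      rw [comparison_tm, comparison_tm, ← map_smul, ← map_neg]
      refine congrArg (P.cls p) (Subtype.ext ?_)
      change -(((-1 : ℂ) ^ p) • (N.ofU u * N.ofΛ a.1 * N.map P.j (N.par e * N.od x))) =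
        P.ωN (N.od x) (N.ofU u * N.ofΛ a.1 * N.map P.j e)
      rw [ωN_od, map_mul, map_mul, map_mul, N.par_ofU, N.par_ofΛ a.2, N.map_od, N.par_map]
      simp only [mul_smul_comm, smul_mul_assoc, mul_assoc]
    | add v w hv hw => simp only [map_add, hv, hw]
  | add m n hm hn => simp only [map_add, LinearMap.add_apply, hm, hn]
  | smul c n hn => simp only [map_smul, LinearMap.smul_apply, hn]

theorem comparison_mem_gr (p : ℕ) (i : ℤ) {v : ((P.indExt p).C p).V}
    (hv : v ∈ ((P.indExt p).C p).gr i) : P.comparison p v ∈ (P.Gr p).gr i := by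
  induction hv using Submodule.span_induction with
  | mem v hv =>
    obtain ⟨w, e, he, rfl⟩ := hv
    induction w using P.pureInd_induction with
    | pure u b =>
      obtain ⟨a, rfl⟩ := P.exteriorPower_map_quo_surjective p b
      rw [comparison_tm]
      refine P.cls_mem_gr ?_
      have := N.mul_mem_gr (N.mul_mem_gr (N.ofU_mem_gr u) (N.ofΛ_mem_gr a.2))
        (N.map_mem_gr P.j he)
      rwa [show 0 + -(p : ℤ) + (i + p) = i by ring] at this
    | add v w hv hw =>
      have h : (P.indExt p).tm (v + w) e = (P.indExt p).tm v e + (P.indExt p).tm w e := by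
        rw [WeakModule.tm, TensorProduct.add_tmul]; rfl
      rw [h]
      exact (map_add (P.comparison p) _ _) ▸ add_mem hv hw
  | zero => rw [map_zero]; exact zero_mem _
  | add v w _ _ hv hw => rw [map_add]; exact add_mem hv hw
  | smul c v _ hv => rw [map_smul]; exact Submodule.smul_mem _ _ hv

theorem tm_mem_gr (p : ℕ) (w : (P.indExt p).V) {i : ℤ} {e : N T} (he : e ∈ N.gr T (i + p)) :
    (P.indExt p).tm w e ∈ ((P.indExt p).C p).gr i := by
  change (P.indExt p).tm w e ∈ Submodule.span ℂ {z : ((P.indExt p).V ⊗[ℂ] N T) ⧸ (P.indExt p).Z |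
    ∃ (v : (P.indExt p).V) (e : N T), e ∈ N.gr T (i + p) ∧ z = (P.indExt p).tm v e}
  exact Submodule.subset_span ⟨w, e, he, rfl⟩

theorem iSup_C_gr (p : ℕ) : ⨆ i, ((P.indExt p).C p).gr i = ⊤ := by
  rw [eq_top_iff]
  rintro v -
  induction v using P.C_induction with
  | tm u a e =>
    induction e using N.homogeneous_induction with
    | mem i e he =>
      have h : (P.indExt p).tm (P.pureInd p u (exteriorPower.map p P.quo a)) e ∈
          ((P.indExt p).C p).gr (i - p) :=
        P.tm_mem_gr p _ ((sub_add_cancel i (p : ℤ)).symm ▸ he)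
      exact le_iSup ((P.indExt p).C p).gr (i - p) h
    | add m n hm hn =>
      have h : ∀ w, (P.indExt p).tm w (m + n) = (P.indExt p).tm w m + (P.indExt p).tm w n :=
        fun w => by rw [WeakModule.tm, TensorProduct.tmul_add]; rfl
      rw [h]
      exact Submodule.add_mem (⨆ i, ((P.indExt p).C p).gr i) hm hn
  | add v w hv hw => exact add_mem hv hw

/-- The images of the degrees span Gr_p by surjectivity and lie in its degrees, which are
independent; so they fill them. This gives both directions of the grading condition without knowing
that the grading of C_T is direct. -/
theorem map_comparison_gr (p : ℕ) (i : ℤ) :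
    (((P.indExt p).C p).gr i).map (P.comparison p) = (P.Gr p).gr i := by
  refine eq_of_le_of_iSup_eq_top
    (A := fun i => (((P.indExt p).C p).gr i).map (P.comparison p))
    ((DirectSum.isInternal_submodule_iff_iSupIndep_and_iSup_eq_top _).1 (P.isInternal_Gr p)).1
    ?_ ?_ i
  · rintro i _ ⟨v, hv, rfl⟩
    exact P.comparison_mem_gr p i hv
  · rw [← Submodule.map_iSup, iSup_C_gr, Submodule.map_top, LinearMap.range_eq_top]
    exact P.comparison_surjective p

/-- The comparison map as an isomorphism of modules. -/
def comparisonIso (hj : Function.Injective P.j) (p : ℕ) :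
    ((P.indExt p).C p).Iso (P.Gr p) where
  e := LinearEquiv.ofBijective (P.comparison p)
    ⟨P.comparison_injective hj p, P.comparison_surjective p⟩
  gr i v := by
    rw [← P.map_comparison_gr]
    exact ⟨fun h => ⟨v, h, rfl⟩, fun ⟨w, hw, h⟩ => P.comparison_injective hj p h ▸ hw⟩
  d := P.comparison_d p
  π := P.comparison_π p
  ν := P.comparison_ν p
  ω := P.comparison_ω p

theorem comparison_indMk (p : ℕ) (u : UniversalEnvelopingAlgebra ℂ K) (ξ : Fin p → K) :
    P.comparison p (P.indMk p u ξ) = P.grMk p u ξ := by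
  have h1 : exteriorPower.map p P.quo (exteriorPower.ιMulti ℂ p ξ) =
      exteriorPower.ιMulti ℂ p fun i => P.quo (ξ i) := exteriorPower.map_apply_ιMulti _ _
  have h2 := P.comparison_tm p u (exteriorPower.ιMulti ℂ p ξ) 1
  rw [h1] at h2
  refine h2.trans (congrArg (P.cls p) (Subtype.ext ?_))
  change N.ofU u * N.ofΛ (ExteriorAlgebra.ιMulti ℂ p ξ) * N.map P.j 1 = N.ofU u * _
  rw [map_one, mul_one, ExteriorAlgebra.ιMulti_apply, map_list_prod, List.map_ofFn]
  simp only [Function.comp_def, N.ofΛ_ι]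

end Iso

end LiePair

end HS

end

theorem mainTheorem7 {A B : Type*}
    [CommRing A] [HopfAlgebra ℂ A] [Algebra.FiniteType ℂ A] [IsReduced A]
    [CommRing B] [HopfAlgebra ℂ B] [Algebra.FiniteType ℂ B] [IsReduced B]
    (γ : A →ₐc[ℂ] B) (hγ : Function.Injective (HS.differential γ)) (p : ℕ) :
    HS.IsHCModule (HS.pair γ) ((HS.pair γ).Gr p) ∧
    HS.IsHCModule (HS.pair γ) (((HS.pair γ).ind ((HS.pair γ).extPow p)).C p) ∧
    ∃ f : HS.PreModule.Iso ((HS.pair γ).Gr p) (((HS.pair γ).ind ((HS.pair γ).extPow p)).C p),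
      ∀ u ξ, f.e ((HS.pair γ).grMk p u ξ) = (HS.pair γ).indMk p u ξ := by
  have h := HS.LiePair.isHCModule_Gr γ p
  -- The comparison map goes from C_T to Gr_p, so its inverse is the isomorphism that is required.
  refine ⟨h, h.of_iso ((HS.pair γ).comparisonIso hγ p).symm,
    ((HS.pair γ).comparisonIso hγ p).symm, fun u ξ => ?_⟩
  refine (LinearEquiv.symm_apply_eq _).2 ?_
  exact ((HS.pair γ).comparison_indMk p u ξ).symm
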